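/- Let $\Omega\subset\mathbb C$ be a bounded domain whose boundary consists of $n$ pairwise disjoint $C^\infty$-smooth simple closed curves (so $\Omega$ is $n$-connected and has no isolated boundary points), positively oriented with respect to $\Omega$, with arc length element $ds$ and complex unit tangent $T$. Let $\varphi$ be a positive real-valued $C^\infty$ function on $\partial\Omega$ and let $a\in\Omega$. Let $L^2_\varphi(\partial\Omega)$ carry the inner product $\langle u,v\rangle_\varphi=\int_{\partial\Omega}u\,\bar v\,\varphi\,ds$, and let $H^2_\varphi(\partial\Omega)$ be the closure in it of the set of boundary values of functions that are holomorphic in $\Omega$ and $C^\infty$ on $\overline\Omega$; for $h\in H^2_\varphi(\partial\Omega)$ and $z\in\Omega$ put $h(z)=\frac1{2\pi i}\int_{\partial\Omega}\frac{h(\zeta)}{\zeta-z}\,d\zeta$. Let the weighted Szegő kernel $S_\varphi(\cdot,a)$ be the unique element of $H^2_\varphi(\partial\Omega)$ with $h(a)=\langle h,S_\varphi(\cdot,a)\rangle_\varphi$ for all $h\in H^2_\varphi(\partial\Omega)$. Let $C_a(z)$ be the complex conjugate of $\frac{1}{2\pi i}\frac{T(z)}{z-a}$ for $z\in\partial\Omega$,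 let $H_a$ be determined on $\partial\Omega$ by $\varphi^{-1}C_a=S_\varphi(\cdot,a)+\varphi^{-1}\,\overline{H_aT}$ and extended to $\Omega$ by its Cauchy integral, and let $$L_\varphi(z,a)=\frac1{2\pi}\,\frac1{z-a}-i\,H_a(z),\qquad z\in\Omega\setminus\{a\},$$ be the weighted Garabedian kernel. Let $$F(z)=\frac{S_\varphi(z,a)}{L_\varphi(z,a)}$$ be the weighted Ahlfors map, with $F(a)=0$ (because $L_\varphi(\cdot,a)$ has a pole at $a$). Then for every $z_0\in\partial\Omega$ the limit of $|F(z)|$ as $z\to z_0$, $z\in\Omega$, exists, and $$\lim_{z\to z_0}|F(z)|=\frac1{\varphi(z_0)}.$$ -/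

import Mathlib

open Set Filter Topology MeasureTheory
open scoped ContDiff ENNReal ComplexConjugate

/-- A positively oriented `C^∞`-smooth boundary of the plane set `Ω`, made of `n` curves:
`frontier Ω` is the disjoint union of `n` regular smooth simple closed curves
(parametrized with period `1`), and near each of its points `Ω` lies on the left of the curve
and only there. In particular no boundary component is a point. A domain with such a
boundary is `n`-connected. -/
structure SmoothBoundary (Ω : Set ℂ) (n : ℕ) where
  curve : Fin n → ℝ → ℂ
  smooth : ∀ j, ContDiff ℝ ∞ (curve j)
  periodic : ∀ j, Function.Periodic (curve j) 1
  regular : ∀ j t, deriv (curve j) t ≠ 0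
  simple : ∀ j, InjOn (curve j) (Ico 0 1)
  disjoint : ∀ i j, i ≠ j → Disjoint (range (curve i)) (range (curve j))
  frontier_eq : frontier Ω = ⋃ j, range (curve j)
  left_mem : ∀ j t, ∀ᶠ s : ℝ in 𝓝[>] 0,
    curve j t + s * Complex.I * deriv (curve j) t ∈ Ω
  right_notMem : ∀ j t, ∀ᶠ s : ℝ in 𝓝[>] 0,
    curve j t - s * Complex.I * deriv (curve j) t ∉ closure Ω

/-- `f ∈ A^∞(Ω)`: holomorphic on `Ω` and `C^∞` up to the boundary. -/
structure MemAInfty (Ω : Set ℂ) (f : ℂ → ℂ) : Prop where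
  holo : DifferentiableOn ℂ f Ω
  smooth : ContDiffOn ℝ ∞ f (closure Ω)

namespace SmoothBoundary

variable {Ω : Set ℂ} {n : ℕ} (Γ : SmoothBoundary Ω n)

/-- A positive `C^∞`-smooth real function on the boundary. Only the values of `φ` on
`frontier Ω` matter. -/
structure IsWeight (Γ : SmoothBoundary Ω n) (φ : ℂ → ℝ) : Prop where
  pos : ∀ z ∈ frontier Ω, 0 < φ z
  smooth : ∀ j, ContDiff ℝ ∞ (fun t => φ (Γ.curve j t))

open Classical in
/-- The complex unit tangent `T`, with `T (z(t)) = z'(t) / |z'(t)|` (and `0` off the boundary);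
see `tangent_curve`. -/
noncomputable def tangent (z : ℂ) : ℂ :=
  if h : ∃ p : Fin n × ℝ, Γ.curve p.1 p.2 = z then
    deriv (Γ.curve h.choose.1) h.choose.2 / ‖deriv (Γ.curve h.choose.1) h.choose.2‖
  else 0

/-- Arc length `ds = |z'(t)| dt` on the boundary, as a measure on `ℂ`. -/
noncomputable def arcLength : Measure ℂ :=
  Measure.sum fun j : Fin n =>
    ((volume.restrict (Ico (0 : ℝ) 1)).withDensity
      fun t => ENNReal.ofReal ‖deriv (Γ.curve j) t‖).map (Γ.curve j)

/-- The measure `φ ds`. -/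
noncomputable def weightedArc (φ : ℂ → ℝ) : Measure ℂ :=
  Γ.arcLength.withDensity fun z => ENNReal.ofReal (φ z)

/-- `L²_φ(∂Ω)`. Mathlib's inner product is conjugate linear in the first variable, so that
`∫ u v̄ φ ds` is `inner ℂ v u`. -/
abbrev L2 (φ : ℂ → ℝ) : Type := Lp ℂ 2 (Γ.weightedArc φ)

/-- `A^∞(∂Ω)`: boundary values of functions in `A^∞(Ω)`, as a subspace of `L²_φ(∂Ω)`. -/
def boundaryAInfty (φ : ℂ → ℝ) : Submodule ℂ (Γ.L2 φ) where
  carrier := {u | ∃ f, MemAInfty Ω f ∧ u =ᵐ[Γ.weightedArc φ] f}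
  zero_mem' := ⟨fun _ => 0, ⟨differentiableOn_const _, contDiffOn_const⟩, Lp.coeFn_zero _ _ _⟩
  add_mem' := by
    rintro u v ⟨f, hf, huf⟩ ⟨g, hg, hvg⟩
    exact ⟨f + g, ⟨hf.holo.add hg.holo, hf.smooth.add hg.smooth⟩,
      (Lp.coeFn_add u v).trans (huf.add hvg)⟩
  smul_mem' := by
    rintro c u ⟨f, hf, huf⟩
    exact ⟨c • f, ⟨hf.holo.const_smul c, hf.smooth.const_smul c⟩,
      (Lp.coeFn_smul c u).trans (huf.const_smul c)⟩

/-- The Hardy space `H²_φ(∂Ω)`: the closure of `A^∞(∂Ω)` in `L²_φ(∂Ω)`. -/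
noncomputable def hardy (φ : ℂ → ℝ) : Submodule ℂ (Γ.L2 φ) :=
  (Γ.boundaryAInfty φ).topologicalClosure

/-- The Cauchy transform `(2πi)⁻¹ ∫_{∂Ω} u(ζ) / (ζ - z) dζ`, where `dζ = T ds`.
For `h` in the Hardy space and `z ∈ Ω` this is the value `h(z)`. -/
noncomputable def cauchy (u : ℂ → ℂ) (z : ℂ) : ℂ :=
  (2 * Real.pi * Complex.I)⁻¹ * ∫ ζ, u ζ / (ζ - z) * Γ.tangent ζ ∂Γ.arcLength

/-- The Cauchy kernel `C_a`, the conjugate of `(2πi)⁻¹ T(z) / (z - a)`. -/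
noncomputable def cauchyKernel (a z : ℂ) : ℂ :=
  conj ((2 * Real.pi * Complex.I)⁻¹ * (Γ.tangent z / (z - a)))

/-- `s` is the function `S_φ(·, a)`: it lies in the Hardy space and `h(a) = ⟨h, s⟩_φ` for all `h`
in the Hardy space. See `existsUnique_isSzego`. -/
def IsSzego (φ : ℂ → ℝ) (a : ℂ) (s : Γ.L2 φ) : Prop :=
  s ∈ Γ.hardy φ ∧ ∀ h ∈ Γ.hardy φ, Γ.cauchy h a = inner ℂ s h

open Classical in
/-- The boundary function `S_φ(·, a)`, an element of `L²_φ(∂Ω)`. -/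
noncomputable def szegoBoundary (φ : ℂ → ℝ) (a : ℂ) : Γ.L2 φ :=
  if h : ∃ s, Γ.IsSzego φ a s then h.choose else 0

/-- The weighted Szegő kernel `S_φ(z, a)` for `z, a ∈ Ω`. -/
noncomputable def szego (φ : ℂ → ℝ) (z a : ℂ) : ℂ :=
  Γ.cauchy (Γ.szegoBoundary φ a) z

/-- The boundary function `H_a`, obtained by solving the orthogonal decomposition
`φ⁻¹ C_a = S_φ(·, a) + φ⁻¹ conj (H_a T)` for `H_a`; see `orthogonal_decomposition`. -/
noncomputable def garabedianAux (φ : ℂ → ℝ) (a z : ℂ) : ℂ :=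
  conj (Γ.tangent z * (Γ.cauchyKernel a z - φ z * Γ.szegoBoundary φ a z))

/-- The weighted Garabedian kernel `L_φ(z, a) = (2π)⁻¹ (z - a)⁻¹ - i H_a(z)` for `z, a ∈ Ω`,
`z ≠ a`. -/
noncomputable def garabedian (φ : ℂ → ℝ) (z a : ℂ) : ℂ :=
  1 / (2 * Real.pi) * (1 / (z - a)) - Complex.I * Γ.cauchy (Γ.garabedianAux φ a) z

open Classical in
/-- The weighted Ahlfors map `F(z) = S_φ(z, a) / L_φ(z, a)`; as `L_φ(·, a)` has a pole at `a`,
`F(a) = 0`. -/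
noncomputable def ahlfors (φ : ℂ → ℝ) (a z : ℂ) : ℂ :=
  if z = a then 0 else Γ.szego φ z a / Γ.garabedian φ z a

/-! ### The definitions are well posed -/

theorem curve_mem (j : Fin n) (t : ℝ) : Γ.curve j t ∈ frontier Ω := by
  rw [Γ.frontier_eq]; exact mem_iUnion.2 ⟨j, t, rfl⟩

theorem curve_fract (j : Fin n) (t : ℝ) : Γ.curve j (Int.fract t) = Γ.curve j t := by
  have := (Γ.periodic j).sub_int_mul_eq ⌊t⌋ (x := t)
  rwa [mul_one] at this

theorem deriv_fract (j : Fin n) (t : ℝ) :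
    deriv (Γ.curve j) (Int.fract t) = deriv (Γ.curve j) t := by
  have hp : Function.Periodic (deriv (Γ.curve j)) 1 := by
    intro x
    rw [← deriv_comp_add_const]
    congr 1
    funext y
    exact Γ.periodic j y
  have := hp.sub_int_mul_eq ⌊t⌋ (x := t)
  rwa [mul_one] at this

theorem tangent_curve (j : Fin n) (t : ℝ) :
    Γ.tangent (Γ.curve j t) = deriv (Γ.curve j) t / ‖deriv (Γ.curve j) t‖ := by
  have h : ∃ p : Fin n × ℝ, Γ.curve p.1 p.2 = Γ.curve j t := ⟨(j, t), rfl⟩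
  have key : ∀ p : Fin n × ℝ, Γ.curve p.1 p.2 = Γ.curve j t →
      deriv (Γ.curve p.1) p.2 = deriv (Γ.curve j) t := by
    rintro ⟨i, s⟩ hp
    have hij : i = j := by
      by_contra hne
      exact (Set.disjoint_left.1 (Γ.disjoint i j hne)) ⟨s, rfl⟩ ⟨t, hp.symm⟩
    subst hij
    have : Int.fract s = Int.fract t := by
      apply Γ.simple i ⟨Int.fract_nonneg _, Int.fract_lt_one _⟩
        ⟨Int.fract_nonneg _, Int.fract_lt_one _⟩
      rw [curve_fract, curve_fract]; exact hp
    show deriv (Γ.curve i) s = _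
    rw [← Γ.deriv_fract i s, this, Γ.deriv_fract]
  rw [tangent, dif_pos h, key _ h.choose_spec]

theorem norm_tangent {z : ℂ} (hz : z ∈ frontier Ω) : ‖Γ.tangent z‖ = 1 := by
  rw [Γ.frontier_eq] at hz
  obtain ⟨j, t, rfl⟩ := mem_iUnion.1 hz
  have := norm_ne_zero_iff.2 (Γ.regular j t)
  rw [tangent_curve]; simp [this]

theorem continuous_deriv (j : Fin n) : Continuous (deriv (Γ.curve j)) :=
  (Γ.smooth j).continuous_deriv (by simp)

theorem isCompact_frontier (Γ : SmoothBoundary Ω n) : IsCompact (frontier Ω) := by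
  have : frontier Ω = ⋃ j, Γ.curve j '' Icc 0 1 := by
    rw [Γ.frontier_eq]
    refine iUnion_congr fun j => Subset.antisymm ?_ (image_subset_range _ _)
    rintro _ ⟨t, rfl⟩
    exact ⟨Int.fract t, ⟨Int.fract_nonneg _, (Int.fract_lt_one _).le⟩, Γ.curve_fract j t⟩
  rw [this]
  exact isCompact_iUnion fun j => isCompact_Icc.image (Γ.smooth j).continuous

/-- A function is continuous on the boundary if it is so along each curve. -/
theorem continuousOn_frontier {E : Type*} [TopologicalSpace E] {g : ℂ → E}
    (hg : ∀ j, Continuous fun t => g (Γ.curve j t)) : ContinuousOn g (frontier Ω) := by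
  rw [continuousOn_iff_continuous_domRestrict]
  let p : Fin n × Icc (0 : ℝ) 1 → frontier Ω := fun x => ⟨Γ.curve x.1 x.2, Γ.curve_mem _ _⟩
  have hp : Continuous p := by
    refine continuous_prod_of_discrete_left.2 fun j => ?_
    exact ((Γ.smooth j).continuous.comp continuous_subtype_val).subtype_mk _
  have hs : Function.Surjective p := by
    rintro ⟨z, hz⟩
    have hz' := hz
    rw [Γ.frontier_eq] at hz'
    obtain ⟨j, t, rfl⟩ := mem_iUnion.1 hz'
    exact ⟨(j, ⟨Int.fract t, Int.fract_nonneg _, (Int.fract_lt_one _).le⟩),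
      Subtype.ext (Γ.curve_fract j t)⟩
  rw [(hp.isClosedMap.isQuotientMap hp hs).continuous_iff]
  refine continuous_prod_of_discrete_left.2 fun j => ?_
  exact (hg j).comp continuous_subtype_val

theorem continuousOn_tangent : ContinuousOn Γ.tangent (frontier Ω) := by
  refine Γ.continuousOn_frontier fun j => ?_
  simp only [tangent_curve]
  exact (Γ.continuous_deriv j).div
    (Complex.continuous_ofReal.comp (Γ.continuous_deriv j).norm)
    fun t => by simpa using Γ.regular j t

theorem IsWeight.continuousOn {Γ : SmoothBoundary Ω n} {φ : ℂ → ℝ} (hφ : Γ.IsWeight φ) :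
    ContinuousOn φ (frontier Ω) :=
  Γ.continuousOn_frontier fun j => (hφ.smooth j).continuous

theorem ae_mem_frontier : ∀ᵐ z ∂Γ.arcLength, z ∈ frontier Ω := by
  refine (Measure.ae_sum_iff' (p := fun z => z ∈ frontier Ω) isClosed_frontier.measurableSet).2 ?_
  intro j
  refine (ae_map_iff (p := fun z => z ∈ frontier Ω) (Γ.smooth j).continuous.aemeasurable
    isClosed_frontier.measurableSet).2 ?_
  exact Eventually.of_forall fun t => Γ.curve_mem j t

instance isFiniteMeasure_arcLength : IsFiniteMeasure Γ.arcLength := by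
  have hj : ∀ j : Fin n, IsFiniteMeasure ((volume.restrict (Ico (0 : ℝ) 1)).withDensity
      fun t => ENNReal.ofReal ‖deriv (Γ.curve j) t‖) := by
    intro j
    refine isFiniteMeasure_withDensity_ofReal ?_
    have hI : IntegrableOn (fun t => ‖deriv (Γ.curve j) t‖) (Ico 0 1) volume :=
      ((Γ.continuous_deriv j).norm.continuousOn.integrableOn_Icc).mono_set Ico_subset_Icc_self
    exact hI.2
  rw [arcLength, Measure.sum_fintype]
  infer_instance

theorem restrict_arcLength : Γ.arcLength.restrict (frontier Ω) = Γ.arcLength :=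
  Measure.restrict_eq_self_of_ae_mem Γ.ae_mem_frontier

theorem memLp_arcLength {E : Type*} [NormedAddCommGroup E] {g : ℂ → E}
    (hg : ContinuousOn g (frontier Ω)) (p : ℝ≥0∞) : MemLp g p Γ.arcLength := by
  obtain ⟨C, hC⟩ := Γ.isCompact_frontier.exists_bound_of_continuousOn hg
  refine MemLp.of_bound ?_ C (Γ.ae_mem_frontier.mono hC)
  rw [← restrict_arcLength]
  exact hg.aestronglyMeasurable_of_isCompact Γ.isCompact_frontier
    isClosed_frontier.measurableSet

theorem ae_weightedArc {φ : ℂ → ℝ} {P : ℂ → Prop} (h : ∀ᵐ z ∂Γ.arcLength, P z) :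
    ∀ᵐ z ∂Γ.weightedArc φ, P z :=
  withDensity_absolutelyContinuous _ _ h

variable {Γ} {φ : ℂ → ℝ}

theorem IsWeight.isFiniteMeasure (hφ : Γ.IsWeight φ) : IsFiniteMeasure (Γ.weightedArc φ) :=
  isFiniteMeasure_withDensity_ofReal
    (memLp_one_iff_integrable.1 (Γ.memLp_arcLength hφ.continuousOn 1)).2

theorem IsWeight.memLp (hφ : Γ.IsWeight φ) {g : ℂ → ℂ} (hg : ContinuousOn g (frontier Ω))
    (p : ℝ≥0∞) : MemLp g p (Γ.weightedArc φ) := by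
  have := hφ.isFiniteMeasure
  obtain ⟨C, hC⟩ := Γ.isCompact_frontier.exists_bound_of_continuousOn hg
  exact MemLp.of_bound ((Γ.memLp_arcLength hg p).1.mono_ac (withDensity_absolutelyContinuous _ _))
    C (Γ.ae_weightedArc (Γ.ae_mem_frontier.mono hC))

theorem IsWeight.integral (hφ : Γ.IsWeight φ) (g : ℂ → ℂ) :
    ∫ z, g z ∂Γ.weightedArc φ = ∫ z, (φ z : ℂ) * g z ∂Γ.arcLength := by
  have hm : AEMeasurable φ Γ.arcLength :=
    (Γ.memLp_arcLength hφ.continuousOn 1).1.aemeasurable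
  rw [weightedArc, integral_withDensity_eq_integral_toReal_smul₀ hm.ennreal_ofReal
    (Eventually.of_forall fun _ => ENNReal.ofReal_lt_top)]
  refine integral_congr_ae (Γ.ae_mem_frontier.mono fun z hz => ?_)
  simp [ENNReal.toReal_ofReal (hφ.pos z hz).le]

theorem continuousOn_cauchyKernel {a : ℂ} (ha : a ∉ frontier Ω) :
    ContinuousOn (Γ.cauchyKernel a) (frontier Ω) := by
  refine Complex.continuous_conj.comp_continuousOn (continuousOn_const.mul ?_)
  refine Γ.continuousOn_tangent.div (continuousOn_id.sub continuousOn_const) fun z hz => ?_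
  exact sub_ne_zero.2 fun h => ha (h ▸ hz)

/-- The weighted Szegő kernel exists and is unique. -/
theorem existsUnique_isSzego (hφ : Γ.IsWeight φ) {a : ℂ} (ha : a ∉ frontier Ω) :
    ∃! s, Γ.IsSzego φ a s := by
  have hc : ContinuousOn (fun z => (φ z : ℂ)⁻¹ * Γ.cauchyKernel a z) (frontier Ω) :=
    ((Complex.continuous_ofReal.comp_continuousOn hφ.continuousOn).inv₀
      fun z hz => by simpa using (hφ.pos z hz).ne').mul (continuousOn_cauchyKernel ha)
  have hk := hφ.memLp hc 2
  let k : Γ.L2 φ := hk.toLp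
  have heval : ∀ h : Γ.L2 φ, Γ.cauchy h a = inner ℂ k h := by
    intro h
    rw [L2.inner_def, cauchy, ← integral_const_mul]
    have : ∫ z, inner ℂ (k z) (h z) ∂Γ.weightedArc φ =
        ∫ z, inner ℂ ((φ z : ℂ)⁻¹ * Γ.cauchyKernel a z) (h z) ∂Γ.weightedArc φ :=
      integral_congr_ae (hk.coeFn_toLp.mono fun z hz => by simp only [k, hz])
    rw [this, hφ.integral]
    refine integral_congr_ae (Γ.ae_mem_frontier.mono fun z hz => ?_)
    have hz0 : (φ z : ℂ) ≠ 0 := by simpa using (hφ.pos z hz).ne'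
    simp only [RCLike.inner_apply, cauchyKernel, map_mul, map_inv₀, Complex.conj_ofReal,
      Complex.conj_conj]
    field_simp
  have : CompleteSpace (Γ.hardy φ) :=
    (Γ.boundaryAInfty φ).isClosed_topologicalClosure.completeSpace_coe
  have hproj : ∀ h ∈ Γ.hardy φ,
      inner ℂ ((Γ.hardy φ).starProjection k) h = inner ℂ k h := by
    intro h hh
    rw [Submodule.inner_starProjection_left_eq_right,
      Submodule.starProjection_eq_self_iff.2 hh]
  refine ⟨(Γ.hardy φ).starProjection k,
    ⟨Submodule.starProjection_apply_mem _ _, fun h hh => by rw [heval, hproj h hh]⟩, ?_⟩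
  rintro s ⟨hs, hs'⟩
  have hmem : s - (Γ.hardy φ).starProjection k ∈ Γ.hardy φ :=
    Submodule.sub_mem _ hs (Submodule.starProjection_apply_mem _ _)
  rw [← sub_eq_zero, ← inner_self_eq_zero (𝕜 := ℂ), inner_sub_left, ← hs' _ hmem, heval,
    hproj _ hmem, sub_self]

theorem isSzego_szegoBoundary (hφ : Γ.IsWeight φ) {a : ℂ} (ha : a ∉ frontier Ω) :
    Γ.IsSzego φ a (Γ.szegoBoundary φ a) := by
  have h := (existsUnique_isSzego hφ ha).exists
  rw [szegoBoundary, dif_pos h]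
  exact h.choose_spec

/-- The decomposition that determines `H_a`. -/
theorem orthogonal_decomposition (hφ : Γ.IsWeight φ) (a : ℂ) {z : ℂ} (hz : z ∈ frontier Ω) :
    (φ z : ℂ)⁻¹ * Γ.cauchyKernel a z = Γ.szegoBoundary φ a z +
      (φ z : ℂ)⁻¹ * conj (Γ.garabedianAux φ a z * Γ.tangent z) := by
  have hT : Γ.tangent z * conj (Γ.tangent z) = 1 := by
    rw [Complex.mul_conj, Complex.normSq_eq_norm_sq, Γ.norm_tangent hz]; simp
  have hz0 : (φ z : ℂ) ≠ 0 := by simpa using (hφ.pos z hz).ne'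
  have : conj (Γ.garabedianAux φ a z * Γ.tangent z) =
      Γ.cauchyKernel a z - φ z * Γ.szegoBoundary φ a z := by
    rw [garabedianAux, map_mul, Complex.conj_conj]
    linear_combination (Γ.cauchyKernel a z - φ z * Γ.szegoBoundary φ a z) * hT
  rw [this]
  field_simp
  ring

end SmoothBoundary

/-! Write `S` and `L` for the two kernels, `T` for the unit tangent, `φ` for the weight. Conjugating
the decomposition that defines `H_a` and using `|T| = 1` gives `φ S̄ = -i T L` on the boundary
(`mul_conj_szegoBoundary`), hence `φ |S| = |L|`. If `S` and `L` extend continuously to a boundary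
point where `L` is not zero, the limit follows at once. Two difficulties remain: the continuous
extension, and boundary points where both kernels vanish, which the argument does not exclude.

Continuity. The Szegő element is a priori only square integrable. Inserting the identity above into
the conjugated Cauchy integral of `S` turns it into an integral of the boundary values of `L`
against `φ⁻¹ / conj (ζ - z)`. If `z*` is the reflection of `z` across the boundary curve, this
kernel differs by a bounded amount from a continuous factor times `T(ζ) / (ζ - z*)`
(`exists_bound_reflected_kernel`). So `S` has a limit from inside once the Cauchy integral of `L`
has one from outside, and there it is explicit, because `H_a dz` annihilates holomorphic functions
smooth up to the boundary. Exchanging the roles of `S` and `L` treats `H_a`; now the Cauchy integral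
of `S` vanishes outside. A weak form of the jump formula (`ae_eq_of_cauchy`) shows that the
extensions agree almost everywhere with the original boundary functions, so that the identity holds
at every boundary point (`exists_kernels`). The vanishing outside rests on Cauchy's theorem for `Ω`,
obtained from Stokes' theorem in charts and a partition of unity.

Common zeros. The identity also gives `i S L T = -φ |S|²`, which is real. Let `k` map a half disc to
a one-sided neighbourhood of the boundary point, with derivative `D` equal to a positive multiple of
`T` on the diameter (`exists_uniformizer`). Then `(i S ∘ k) (L ∘ k) D` is real on the diameter,
extends by Schwarz reflection, and vanishes at the centre to finite order. So neither kernel has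
zeros near the centre other than the centre itself, and both quotients `S / L` and `L / S` grow at
most like a power of the inverse distance. Their moduli on the diameter are `φ⁻¹` and `φ`, and a
maximum principle tolerating such growth at one point (`eventually_norm_le_of_real_le`) carries both
bounds inside.

The uniformizer inverts a primitive of a holomorphic `f` with `f T > 0` on the boundary arc. Such an
`f` is the exponential of a Cauchy integral with real density; the density solves a Fredholm
equation on an arc short enough for a contraction argument. -/

/-- A preconnected set that meets an open set but not its frontier is contained in it. -/
theorem IsPreconnected.subset_of_disjoint_frontier {X : Type*} [TopologicalSpace X] {s U : Set X}
    (hs : IsPreconnected s) (hU : IsOpen U) (hne : (s ∩ U).Nonempty)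
    (hd : Disjoint s (frontier U)) : s ⊆ U := by
  refine hs.subset_left_of_subset_union hU isClosed_closure.isOpen_compl
    (disjoint_compl_right.mono_left subset_closure) (fun x hx => ?_) hne
  by_cases h : x ∈ closure U
  · left
    by_contra hn
    exact Set.disjoint_left.1 hd hx (hU.frontier_eq ▸ ⟨h, hn⟩)
  · exact Or.inr h

/-! ### Collar coordinates of a plane curve -/

/-- The collar map of a plane curve `γ`, sending `t + iy` to `γ t + i y γ' t`. -/
noncomputable def collar (γ : ℝ → ℂ) (w : ℂ) : ℂ :=
  γ w.re + Complex.I * w.im * deriv γ w.re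

section Collar

variable {γ : ℝ → ℂ}

@[simp] theorem collar_ofReal (γ : ℝ → ℂ) (t : ℝ) : collar γ t = γ t := by simp [collar]

theorem contDiff_deriv_curve (hγ : ContDiff ℝ ∞ γ) : ContDiff ℝ ∞ (deriv γ) :=
  ((contDiff_infty_iff_deriv).1 hγ).2

theorem contDiff_collar (hγ : ContDiff ℝ ∞ γ) : ContDiff ℝ ∞ (collar γ) := by
  have h1 : ContDiff ℝ ∞ fun w : ℂ => γ w.re := hγ.comp Complex.reCLM.contDiff
  have h2 : ContDiff ℝ ∞ fun w : ℂ => deriv γ w.re :=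
    (contDiff_deriv_curve hγ).comp Complex.reCLM.contDiff
  have h3 : ContDiff ℝ ∞ fun w : ℂ => (w.im : ℂ) :=
    Complex.ofRealCLM.contDiff.comp Complex.imCLM.contDiff
  exact h1.add ((contDiff_const.mul h3).mul h2)

theorem continuous_collar (hγ : ContDiff ℝ ∞ γ) : Continuous (collar γ) :=
  (contDiff_collar hγ).continuous

theorem hasDerivAt_curve (hγ : ContDiff ℝ ∞ γ) (t : ℝ) : HasDerivAt γ (deriv γ t) t :=
  (hγ.differentiable (by simp) t).hasDerivAt

/-- The real derivative of the collar map. -/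
noncomputable def collarDeriv (γ : ℝ → ℂ) (w : ℂ) : ℂ →L[ℝ] ℂ :=
  Complex.reCLM.smulRight (deriv γ w.re + Complex.I * w.im * deriv (deriv γ) w.re) +
    Complex.imCLM.smulRight (Complex.I * deriv γ w.re)

theorem collarDeriv_apply (γ : ℝ → ℂ) (w v : ℂ) :
    collarDeriv γ w v = v.re * (deriv γ w.re + Complex.I * w.im * deriv (deriv γ) w.re) +
      v.im * (Complex.I * deriv γ w.re) := by
  simp [collarDeriv]
  ring

theorem hasFDerivAt_collar (hγ : ContDiff ℝ ∞ γ) (w : ℂ) :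
    HasFDerivAt (collar γ) (collarDeriv γ w) w := by
  have h1 : HasFDerivAt (fun w : ℂ => γ w.re) (Complex.reCLM.smulRight (deriv γ w.re)) w :=
    (hasDerivAt_curve hγ w.re).hasFDerivAt.comp w Complex.reCLM.hasFDerivAt
  have h2 : HasFDerivAt (fun w : ℂ => deriv γ w.re)
      (Complex.reCLM.smulRight (deriv (deriv γ) w.re)) w :=
    (hasDerivAt_curve (contDiff_deriv_curve hγ) w.re).hasFDerivAt.comp w
      Complex.reCLM.hasFDerivAt
  have h3 : HasFDerivAt (fun w : ℂ => Complex.I * (w.im : ℂ))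
      (Complex.I • (Complex.ofRealCLM.comp Complex.imCLM)) w :=
    ((Complex.ofRealCLM.comp Complex.imCLM).hasFDerivAt).const_mul Complex.I
  have := h1.add (h3.mul h2)
  refine this.congr_fderiv ?_
  ext v <;> simp [collarDeriv] <;> ring

theorem hasStrictFDerivAt_collar (hγ : ContDiff ℝ ∞ γ) (w : ℂ) :
    HasStrictFDerivAt (collar γ) (collarDeriv γ w) w :=
  (contDiff_collar hγ).contDiffAt.hasStrictFDerivAt' (hasFDerivAt_collar hγ w) (by simp)

/-- Along the real axis the differential is multiplication by `γ'`, hence complex linear: the collar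
map is the first order part of an almost holomorphic extension of `γ`. This is why complex
conjugation of the parameter acts as a reflection to leading order. -/
theorem collarDeriv_ofReal (γ : ℝ → ℂ) (t : ℝ) (v : ℂ) : collarDeriv γ t v = deriv γ t * v := by
  rw [collarDeriv_apply]
  conv_rhs => rw [← Complex.re_add_im v]
  simp only [Complex.ofReal_re, Complex.ofReal_im, Complex.ofReal_zero]
  ring

/-- Strict differentiability at a point of the axis. It supplies at once injectivity, a local
inverse and lower bounds for distances. -/
theorem exists_collar_approx (hγ : ContDiff ℝ ∞ γ) (t₀ : ℝ) {ε : ℝ} (hε : 0 < ε) :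
    ∃ δ > 0, ∀ w ∈ Metric.ball (t₀ : ℂ) δ, ∀ w' ∈ Metric.ball (t₀ : ℂ) δ,
      ‖collar γ w - collar γ w' - deriv γ t₀ * (w - w')‖ ≤ ε * ‖w - w'‖ := by
  obtain ⟨s, hs, h⟩ := (hasStrictFDerivAt_collar hγ t₀).approximates_deriv_on_nhds
    (c := ⟨ε, hε.le⟩) (Or.inr hε)
  obtain ⟨δ, hδ, hsub⟩ := Metric.mem_nhds_iff.1 hs
  refine ⟨δ, hδ, fun w hw w' hw' => ?_⟩
  have := h w (hsub hw) w' (hsub hw')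
  rwa [collarDeriv_ofReal] at this

end Collar

/-! ### Charts that straighten the boundary -/

namespace SmoothBoundary

variable {Ω : Set ℂ} {n : ℕ} (Γ : SmoothBoundary Ω n)

/-- Boundary points near `Γ.curve j t₀` lie on the `j`-th curve with parameter near `t₀`. -/
theorem frontier_near (j : Fin n) (t₀ : ℝ) {ε : ℝ} (hε : 0 < ε) :
    ∃ ρ > 0, ∀ ζ ∈ frontier Ω, ‖ζ - Γ.curve j t₀‖ < ρ → ∃ τ : ℝ, |τ - t₀| < ε ∧
      ζ = Γ.curve j τ := by
  -- The other curves, together with the part of this curve whose parameter stays at distance at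
  -- least `ε` from `t₀` modulo the period. This compact set misses the base point, so its distance
  -- from it serves as `ρ`.
  let K : Set ℂ := (⋃ i ∈ ({i | i ≠ j} : Set (Fin n)), Γ.curve i '' Icc 0 1) ∪
    Γ.curve j '' Icc (t₀ + ε) (t₀ + 1 - ε)
  have hK : IsCompact K := by
    refine IsCompact.union ?_ (isCompact_Icc.image (Γ.smooth j).continuous)
    exact (toFinite _).isCompact_biUnion fun i _ => isCompact_Icc.image (Γ.smooth i).continuous
  have hz : Γ.curve j t₀ ∉ K := by
    rintro (h | ⟨τ, ⟨h1, h2⟩, h⟩)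
    · simp only [mem_ofPred_eq, mem_iUnion] at h
      obtain ⟨i, hi, t, -, ht⟩ := h
      exact (Set.disjoint_left.1 (Γ.disjoint i j hi)) ⟨t, rfl⟩ ⟨t₀, ht.symm⟩
    · have h3 : Γ.curve j (Int.fract (τ - t₀) + t₀) = Γ.curve j τ := by
        have := (Γ.periodic j).sub_int_mul_eq ⌊τ - t₀⌋ (x := τ)
        rw [mul_one] at this
        rw [← this]; congr 1; rw [← Int.self_sub_floor]; ring
      have hfr : Int.fract τ = Int.fract t₀ := by
        apply Γ.simple j ⟨Int.fract_nonneg _, Int.fract_lt_one _⟩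
          ⟨Int.fract_nonneg _, Int.fract_lt_one _⟩
        rw [Γ.curve_fract, Γ.curve_fract]; exact h
      obtain ⟨m, hm⟩ := Int.fract_eq_fract.1 hfr
      have m0 : (0 : ℝ) < m := by linarith
      have m1 : (m : ℝ) < 1 := by linarith
      norm_cast at m0 m1
      omega
  obtain ⟨ρ, hρ, hsub⟩ := Metric.isOpen_iff.1 hK.isClosed.isOpen_compl _ hz
  refine ⟨ρ, hρ, fun ζ hζ hd => ?_⟩
  have hnK : ζ ∉ K := hsub (by rwa [Metric.mem_ball, dist_eq_norm])
  rw [Γ.frontier_eq] at hζ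
  obtain ⟨i, t, rfl⟩ := mem_iUnion.1 hζ
  have hij : i = j := by
    by_contra hne
    refine hnK (Or.inl ?_)
    simp only [mem_ofPred_eq, mem_iUnion]
    exact ⟨i, hne, Int.fract t, ⟨Int.fract_nonneg _, (Int.fract_lt_one _).le⟩,
      Γ.curve_fract i t⟩
  subst hij
  have per : ∀ m : ℤ, Γ.curve i (t - m) = Γ.curve i t := fun m => by
    have := (Γ.periodic i).sub_int_mul_eq m (x := t)
    rwa [mul_one] at this
  have f0 := Int.fract_nonneg (t - t₀)
  have f1 := Int.fract_lt_one (t - t₀)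
  have fe := Int.self_sub_floor (t - t₀)
  -- The parameter is shifted by an integer so that it lies near `t₀`; a fractional part close to
  -- `1` needs one period more. The remaining case would put the point in `K`.
  by_cases c1 : Int.fract (t - t₀) < ε
  · refine ⟨t - ⌊t - t₀⌋, ?_, (per _).symm⟩
    rw [abs_lt]; constructor <;> linarith
  by_cases c2 : 1 - ε < Int.fract (t - t₀)
  · refine ⟨t - (⌊t - t₀⌋ + 1 : ℤ), ?_, (per _).symm⟩
    rw [abs_lt]; push_cast; constructor <;> linarith
  · refine absurd (Or.inr ⟨t - ⌊t - t₀⌋, ⟨?_, ?_⟩, per _⟩) hnK <;> linarith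

/-- `δ` is a radius on which the collar map of the `j`-th curve straightens the boundary of `Ω`
near the parameter `t₀`. -/
structure IsChart (j : Fin n) (t₀ δ : ℝ) : Prop where
  pos : 0 < δ
  approx : ∀ w ∈ Metric.ball (t₀ : ℂ) δ, ∀ w' ∈ Metric.ball (t₀ : ℂ) δ,
    ‖collar (Γ.curve j) w - collar (Γ.curve j) w' - deriv (Γ.curve j) t₀ * (w - w')‖ ≤
      ‖deriv (Γ.curve j) t₀‖ / 2 * ‖w - w'‖
  mem_iff : ∀ w ∈ Metric.ball (t₀ : ℂ) δ, collar (Γ.curve j) w ∈ Ω ↔ 0 < w.im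
  frontier_iff : ∀ w ∈ Metric.ball (t₀ : ℂ) δ, collar (Γ.curve j) w ∈ frontier Ω ↔ w.im = 0

variable {Γ}

namespace IsChart

variable {j : Fin n} {t₀ δ : ℝ}

theorem mono (h : Γ.IsChart j t₀ δ) {δ' : ℝ} (h0 : 0 < δ') (hle : δ' ≤ δ) : Γ.IsChart j t₀ δ' where
  pos := h0
  approx w hw w' hw' := h.approx w (Metric.ball_subset_ball hle hw) w'
    (Metric.ball_subset_ball hle hw')
  mem_iff w hw := h.mem_iff w (Metric.ball_subset_ball hle hw)
  frontier_iff w hw := h.frontier_iff w (Metric.ball_subset_ball hle hw)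

theorem notMem_closure (h : Γ.IsChart j t₀ δ) {w : ℂ} (hw : w ∈ Metric.ball (t₀ : ℂ) δ)
    (him : w.im < 0) : collar (Γ.curve j) w ∉ closure Ω := by
  rw [closure_eq_self_union_frontier]
  rintro (h' | h')
  · exact absurd ((h.mem_iff w hw).1 h') (by linarith)
  · exact absurd ((h.frontier_iff w hw).1 h') (by linarith)

/-- The linear part expands by exactly `‖γ'(t₀)‖` and the error eats at most half of it. This lower
bound controls the denominators of the Cauchy kernels below. -/
theorem le_norm_sub (h : Γ.IsChart j t₀ δ) {w w' : ℂ} (hw : w ∈ Metric.ball (t₀ : ℂ) δ)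
    (hw' : w' ∈ Metric.ball (t₀ : ℂ) δ) : ‖deriv (Γ.curve j) t₀‖ / 2 * ‖w - w'‖ ≤
      ‖collar (Γ.curve j) w - collar (Γ.curve j) w'‖ := by
  have h1 := h.approx w hw w' hw'
  have h2 := norm_sub_norm_le (deriv (Γ.curve j) t₀ * (w - w'))
    (collar (Γ.curve j) w - collar (Γ.curve j) w')
  rw [norm_sub_rev (deriv (Γ.curve j) t₀ * (w - w')), norm_mul] at h2
  linarith

theorem injOn (h : Γ.IsChart j t₀ δ) :
    InjOn (collar (Γ.curve j)) (Metric.ball (t₀ : ℂ) δ) := by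
  intro w hw w' hw' he
  have h1 := h.le_norm_sub hw hw'
  rw [he, sub_self, norm_zero] at h1
  have h2 := norm_pos_iff.2 (Γ.regular j t₀)
  have : ‖w - w'‖ ≤ 0 := by
    by_contra hc
    push Not at hc
    have := mul_pos (half_pos h2) hc
    linarith
  simpa [sub_eq_zero] using this

/-- The collar map as a local homeomorphism. -/
theorem exists_openPartialHomeomorph (h : Γ.IsChart j t₀ δ) :
    ∃ e : OpenPartialHomeomorph ℂ ℂ, (e : ℂ → ℂ) = collar (Γ.curve j) ∧
      e.source = Metric.ball (t₀ : ℂ) δ := by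
  have hd := Γ.regular j t₀
  let L : ℂ ≃L[ℝ] ℂ := (ContinuousLinearEquiv.unitsEquivAut ℂ (Units.mk0 _ hd)).restrictScalars ℝ
  have hL : ∀ v, L v = deriv (Γ.curve j) t₀ * v := fun v => by
    simp [L, mul_comm]
  have hLs : ‖(L.symm : ℂ →L[ℝ] ℂ)‖ ≤ ‖deriv (Γ.curve j) t₀‖⁻¹ := by
    refine ContinuousLinearMap.opNorm_le_bound _ (by positivity) fun v => ?_
    have : v = deriv (Γ.curve j) t₀ * L.symm v := by rw [← hL]; simp
    conv_rhs => rw [this, norm_mul]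
    rw [← mul_assoc, inv_mul_cancel₀ (norm_ne_zero_iff.2 hd), one_mul]
    rfl
  have happ : ApproximatesLinearOn (collar (Γ.curve j)) (L : ℂ →L[ℝ] ℂ)
      (Metric.ball (t₀ : ℂ) δ) (‖deriv (Γ.curve j) t₀‖₊ / 2) := by
    intro w hw w' hw'
    have := h.approx w hw w' hw'
    simpa [hL] using this
  have hc : Subsingleton ℂ ∨ ‖deriv (Γ.curve j) t₀‖₊ / 2 < ‖(L.symm : ℂ →L[ℝ] ℂ)‖₊⁻¹ := by
    right
    have hpos : 0 < ‖(L.symm : ℂ →L[ℝ] ℂ)‖₊ := by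
      rcases L.subsingleton_or_nnnorm_symm_pos with h | h
      · exact absurd (h.elim 0 1) (by simp)
      · exact h
    have h2 : ‖deriv (Γ.curve j) t₀‖₊ ≤ ‖(L.symm : ℂ →L[ℝ] ℂ)‖₊⁻¹ := by
      rw [le_inv_comm₀ (by simpa using hd) hpos]
      exact_mod_cast hLs
    exact lt_of_lt_of_le (NNReal.half_lt_self (by simpa using hd)) h2
  exact ⟨happ.toOpenPartialHomeomorph _ _ hc Metric.isOpen_ball, rfl, rfl⟩

theorem isOpen_image (h : Γ.IsChart j t₀ δ) {s : Set ℂ} (hs : IsOpen s)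
    (hsub : s ⊆ Metric.ball (t₀ : ℂ) δ) : IsOpen (collar (Γ.curve j) '' s) := by
  obtain ⟨e, he, hsrc⟩ := h.exists_openPartialHomeomorph
  rw [← he]
  exact e.isOpen_image_of_subset_source hs (hsrc ▸ hsub)

end IsChart

/-- Every boundary point has a chart. -/
theorem exists_isChart (Γ : SmoothBoundary Ω n) (hopen : IsOpen Ω) (j : Fin n) (t₀ : ℝ) :
    ∃ δ, Γ.IsChart j t₀ δ := by
  have hd := norm_pos_iff.2 (Γ.regular j t₀)
  obtain ⟨δ₁, hδ₁, happ⟩ := exists_collar_approx (Γ.smooth j) t₀ (half_pos hd)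
  obtain ⟨ρ, hρ, hfar⟩ := Γ.frontier_near j t₀ hδ₁
  have hcont : ∀ᶠ w in 𝓝 (t₀ : ℂ), ‖collar (Γ.curve j) w - Γ.curve j t₀‖ < ρ := by
    have : Tendsto (collar (Γ.curve j)) (𝓝 (t₀ : ℂ)) (𝓝 (Γ.curve j t₀)) := by
      have := (continuous_collar (Γ.smooth j)).tendsto (t₀ : ℂ)
      rwa [collar_ofReal] at this
    filter_upwards [this (Metric.ball_mem_nhds _ hρ)] with w hw
    simpa [dist_eq_norm] using hw
  obtain ⟨δ₂, hδ₂, hball⟩ := Metric.eventually_nhds_iff_ball.1 hcont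
  set δ := min δ₁ δ₂
  have hδ : 0 < δ := lt_min hδ₁ hδ₂
  have hb1 : Metric.ball (t₀ : ℂ) δ ⊆ Metric.ball (t₀ : ℂ) δ₁ :=
    Metric.ball_subset_ball (min_le_left _ _)
  have hb2 : Metric.ball (t₀ : ℂ) δ ⊆ Metric.ball (t₀ : ℂ) δ₂ :=
    Metric.ball_subset_ball (min_le_right _ _)
  have hinj : ∀ w ∈ Metric.ball (t₀ : ℂ) δ₁, ∀ w' ∈ Metric.ball (t₀ : ℂ) δ₁,
      collar (Γ.curve j) w = collar (Γ.curve j) w' → w = w' := by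
    intro w hw w' hw' he
    have h1 := happ w hw w' hw'
    rw [he, sub_self, zero_sub, norm_neg, norm_mul] at h1
    have : ‖w - w'‖ ≤ 0 := by nlinarith [norm_nonneg (w - w')]
    simpa [sub_eq_zero] using this
  have hfr : ∀ w ∈ Metric.ball (t₀ : ℂ) δ, collar (Γ.curve j) w ∈ frontier Ω ↔ w.im = 0 := by
    intro w hw
    constructor
    · intro hf
      obtain ⟨τ, hτ, he⟩ := hfar _ hf (hball w (hb2 hw))
      have hτm : (τ : ℂ) ∈ Metric.ball (t₀ : ℂ) δ₁ := by
        rw [Metric.mem_ball, dist_eq_norm, ← Complex.ofReal_sub, Complex.norm_real]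
        exact hτ
      have := hinj w (hb1 hw) τ hτm (by rw [he, collar_ofReal])
      rw [this]; simp
    · intro h0
      have : w = (w.re : ℂ) := by apply Complex.ext <;> simp [h0]
      rw [this, collar_ofReal]
      exact Γ.curve_mem _ _
  have hsmall : ∀ᶠ s : ℝ in 𝓝[>] 0, s < δ := by
    filter_upwards [Ioo_mem_nhdsGT hδ] with s hs using hs.2
  -- The image of the upper half ball is connected and misses the frontier, so it lies in `Ω` as
  -- soon as one of its points does; `left_mem` gives a point on the vertical ray over `t₀`. The
  -- lower half uses `right_notMem` in the same way.
  have hup : ∀ w ∈ Metric.ball (t₀ : ℂ) δ, 0 < w.im → collar (Γ.curve j) w ∈ Ω := by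
    let B := Metric.ball (t₀ : ℂ) δ ∩ {w : ℂ | 0 < w.im}
    have hB : IsPreconnected (collar (Γ.curve j) '' B) :=
      (((convex_ball _ _).inter (convex_halfSpace_im_gt 0)).isPreconnected).image _
        (continuous_collar (Γ.smooth j)).continuousOn
    obtain ⟨s, hs1, hs2, hs3⟩ :=
      ((Γ.left_mem j t₀).and (hsmall.and self_mem_nhdsWithin)).exists
    have hsB : (t₀ : ℂ) + s * Complex.I ∈ B := by
      refine ⟨?_, by simpa using hs3⟩
      rw [Metric.mem_ball, dist_eq_norm]; simpa [abs_of_pos (show (0:ℝ) < s from hs3)] using hs2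
    have hsΩ : collar (Γ.curve j) ((t₀ : ℂ) + s * Complex.I) ∈ Ω := by
      have : collar (Γ.curve j) ((t₀ : ℂ) + s * Complex.I) =
          Γ.curve j t₀ + s * Complex.I * deriv (Γ.curve j) t₀ := by
        simp only [collar, Complex.add_re, Complex.sub_re, Complex.add_im, Complex.sub_im,
          Complex.re_ofReal_mul, Complex.im_ofReal_mul, Complex.I_re, Complex.I_im,
          Complex.ofReal_re, Complex.ofReal_im, mul_zero, add_zero, sub_zero, mul_one, zero_add,
          zero_sub, Complex.ofReal_neg]
        ring
      rwa [this]
    intro w hw him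
    refine hB.subset_of_disjoint_frontier hopen ⟨_, mem_image_of_mem _ hsB, hsΩ⟩ ?_
      (mem_image_of_mem _ (show w ∈ B from ⟨hw, him⟩))
    rw [Set.disjoint_left]
    rintro _ ⟨w', hw', rfl⟩ hz
    exact absurd ((hfr w' hw'.1).1 hz) hw'.2.ne'
  have hdown : ∀ w ∈ Metric.ball (t₀ : ℂ) δ, w.im < 0 → collar (Γ.curve j) w ∉ Ω := by
    let B := Metric.ball (t₀ : ℂ) δ ∩ {w : ℂ | w.im < 0}
    have hB : IsPreconnected (collar (Γ.curve j) '' B) :=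
      (((convex_ball _ _).inter (convex_halfSpace_im_lt 0)).isPreconnected).image _
        (continuous_collar (Γ.smooth j)).continuousOn
    obtain ⟨s, hs1, hs2, hs3⟩ :=
      ((Γ.right_notMem j t₀).and (hsmall.and self_mem_nhdsWithin)).exists
    have hsB : (t₀ : ℂ) - s * Complex.I ∈ B := by
      refine ⟨?_, by simpa using hs3⟩
      rw [Metric.mem_ball, dist_eq_norm]; simpa [abs_of_pos (show (0:ℝ) < s from hs3)] using hs2
    have hsΩ : collar (Γ.curve j) ((t₀ : ℂ) - s * Complex.I) ∉ Ω := by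
      have : collar (Γ.curve j) ((t₀ : ℂ) - s * Complex.I) =
          Γ.curve j t₀ - s * Complex.I * deriv (Γ.curve j) t₀ := by
        simp only [collar, Complex.add_re, Complex.sub_re, Complex.add_im, Complex.sub_im,
          Complex.re_ofReal_mul, Complex.im_ofReal_mul, Complex.I_re, Complex.I_im,
          Complex.ofReal_re, Complex.ofReal_im, mul_zero, add_zero, sub_zero, mul_one, zero_add,
          zero_sub, Complex.ofReal_neg]
        ring
      rw [this]; exact fun h => hs1 (subset_closure h)
    intro w hw him hn
    refine hsΩ (hB.subset_of_disjoint_frontier hopen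
      ⟨_, mem_image_of_mem _ (show w ∈ B from ⟨hw, him⟩), hn⟩ ?_ (mem_image_of_mem _ hsB))
    rw [Set.disjoint_left]
    rintro _ ⟨w', hw', rfl⟩ hz
    exact absurd ((hfr w' hw'.1).1 hz) hw'.2.ne
  refine ⟨δ, hδ, fun w hw w' hw' => happ w (hb1 hw) w' (hb1 hw'), fun w hw => ?_, hfr⟩
  refine ⟨fun hΩ => ?_, hup w hw⟩
  rcases lt_trichotomy w.im 0 with h | h | h
  · exact absurd hΩ (hdown w hw h)
  · have := (hfr w hw).2 h
    rw [hopen.frontier_eq] at this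
    exact absurd hΩ this.2
  · exact h

end SmoothBoundary

/-! ### Stokes' theorem in a curvilinear rectangle -/

/-- The function `i ∂χ/∂x - ∂χ/∂y`, which is `2 i` times the antiholomorphic derivative of `χ`. -/
noncomputable def dbarForm (χ : ℂ → ℂ) (z : ℂ) : ℂ :=
  fderiv ℝ χ z 1 * Complex.I - fderiv ℝ χ z Complex.I

theorem det_real_clm (L : ℂ →L[ℝ] ℂ) :
    L.det = (L 1).re * (L Complex.I).im - (L 1).im * (L Complex.I).re := by
  rw [ContinuousLinearMap.det, ← LinearMap.det_toMatrix Complex.basisOneI, Matrix.det_fin_two]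
  simp [LinearMap.toMatrix_apply]
  ring

theorem real_clm_apply (A : ℂ →L[ℝ] ℂ) (z : ℂ) : A z = z.re * A 1 + z.im * A Complex.I := by
  have : z = z.re • (1 : ℂ) + z.im • Complex.I := by
    conv_lhs => rw [← Complex.re_add_im z]
    simp
  conv_lhs => rw [this, map_add, map_smul, map_smul]
  simp

/-- The 2-form `A ∧ dz` evaluated on the pair `L 1`, `L i`: pulling back a 2-form of the plane
multiplies it by the determinant. -/
theorem pullback_form (A L : ℂ →L[ℝ] ℂ) :
    A (L 1) * L Complex.I - A (L Complex.I) * L 1 =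
      (L.det : ℂ) * (A 1 * Complex.I - A Complex.I) := by
  rw [det_real_clm, real_clm_apply A (L 1), real_clm_apply A (L Complex.I)]
  conv_lhs =>
    enter [1, 2]; rw [← Complex.re_add_im (L Complex.I)]
  conv_lhs =>
    enter [2, 2]; rw [← Complex.re_add_im (L 1)]
  push_cast
  ring

section Stokes

variable {Φ f χ : ℂ → ℂ} {a b c d : ℝ}

theorem setIntegral_reProdIm_eq (F : ℂ → ℂ) (a b c d : ℝ) :
    ∫ w in Ioo a b ×ℂ Ioo c d, F w = ∫ p in Icc (a, c) (b, d), F (p.1 + p.2 * Complex.I) := by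
  have h1 : (Icc (a, c) (b, d) : Set (ℝ × ℝ)) =ᵐ[volume] Ioo a b ×ˢ Ioo c d := by
    rw [← Icc_prod_Icc]
    exact (Measure.set_prod_ae_eq Ioo_ae_eq_Icc Ioo_ae_eq_Icc).symm
  rw [setIntegral_congr_set h1]
  have h2 := Complex.volume_preserving_equiv_real_prod.symm
  rw [← h2.setIntegral_preimage_emb (MeasurableEquiv.measurableEmbedding _)]
  have h3 : (Complex.measurableEquivRealProd.symm ⁻¹' (Ioo a b ×ℂ Ioo c d)) =
      Ioo a b ×ˢ Ioo c d := by
    ext ⟨x, y⟩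
    simp [Complex.mem_reProdIm, Complex.measurableEquivRealProd_symm_apply]
  rw [h3]
  refine setIntegral_congr_fun (measurableSet_Ioo.prod measurableSet_Ioo) fun p _ => ?_
  congr 1
  rw [Complex.measurableEquivRealProd_symm_apply]
  apply Complex.ext <;> simp

theorem hasFDerivAt_stokes_form (hΦ : ContDiff ℝ ∞ Φ) (hχ : ContDiff ℝ ∞ χ) {w : ℂ}
    (hf : DifferentiableAt ℂ f (Φ w)) (u : ℂ) :
    HasFDerivAt (fun w => χ (Φ w) * f (Φ w) * fderiv ℝ Φ w u)
      ((χ (Φ w) * f (Φ w)) • ((ContinuousLinearMap.apply ℝ ℂ u).comp (fderiv ℝ (fderiv ℝ Φ) w)) +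
        (fderiv ℝ Φ w u) • (χ (Φ w) • (deriv f (Φ w) • fderiv ℝ Φ w) +
          f (Φ w) • (fderiv ℝ χ (Φ w)).comp (fderiv ℝ Φ w))) w := by
  have h1 : HasFDerivAt Φ (fderiv ℝ Φ w) w := (hΦ.differentiable (by simp) w).hasFDerivAt
  have h2 : HasFDerivAt (fun w => χ (Φ w)) ((fderiv ℝ χ (Φ w)).comp (fderiv ℝ Φ w)) w :=
    ((hχ.differentiable (by simp) (Φ w)).hasFDerivAt).comp w h1
  have h3 : HasFDerivAt (fun w => f (Φ w)) (deriv f (Φ w) • fderiv ℝ Φ w) w := by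
    have := (hf.hasDerivAt.hasFDerivAt.restrictScalars ℝ).comp w h1
    refine this.congr_fderiv ?_
    ext v; simp [mul_comm]
  have h4 : HasFDerivAt (fun w => fderiv ℝ Φ w u)
      ((ContinuousLinearMap.apply ℝ ℂ u).comp (fderiv ℝ (fderiv ℝ Φ) w)) w := by
    have hd : DifferentiableAt ℝ (fderiv ℝ Φ) w :=
      ((contDiff_infty_iff_fderiv.1 hΦ).2.differentiable (by simp)) w
    exact (ContinuousLinearMap.apply ℝ ℂ u).hasFDerivAt.comp w hd.hasFDerivAt
  exact (h2.mul h3).mul h4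

/-- This is `d(χ f dz) = f dχ ∧ dz`, valid because `f dz` is closed for holomorphic `f`, pulled back
by `Φ` to a rectangle. Since `χ` vanishes on three sides, only the bottom side contributes.
Holomorphy is needed only in the open rectangle, and continuity on the closed one, so the bottom
side may lie on the boundary of the domain. -/
theorem stokes_rect (hΦ : ContDiff ℝ ∞ Φ) (hχ : ContDiff ℝ ∞ χ) (hab : a ≤ b) (hcd : c ≤ d)
    (hinj : InjOn Φ (Ioo a b ×ℂ Ioo c d))
    (hdet : ∀ w ∈ Ioo a b ×ℂ Ioo c d, 0 < (fderiv ℝ Φ w).det)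
    (hfc : ContinuousOn f (Φ '' (Icc a b ×ℂ Icc c d)))
    (hfd : ∀ w ∈ Ioo a b ×ℂ Ioo c d, DifferentiableAt ℂ f (Φ w))
    (hleft : ∀ y ∈ Icc c d, χ (Φ (a + y * Complex.I)) = 0)
    (hright : ∀ y ∈ Icc c d, χ (Φ (b + y * Complex.I)) = 0)
    (htop : ∀ x ∈ Icc a b, χ (Φ (x + d * Complex.I)) = 0) :
    ∫ z in Φ '' (Ioo a b ×ℂ Ioo c d), f z * dbarForm χ z =
      ∫ x in a..b, χ (Φ (x + c * Complex.I)) * f (Φ (x + c * Complex.I)) *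
        fderiv ℝ Φ (x + c * Complex.I) 1 := by
  have hmeas : MeasurableSet (Ioo a b ×ℂ Ioo c d) :=
    ((isOpen_Ioo).reProdIm isOpen_Ioo).measurableSet
  rw [integral_image_eq_integral_abs_det_fderiv_smul volume hmeas
    (fun w _ => ((hΦ.differentiable (by simp) w).hasFDerivAt).hasFDerivWithinAt) hinj]
  let D : ℂ → ℂ := fun w => f (Φ w) * (fderiv ℝ χ (Φ w) (fderiv ℝ Φ w 1) * fderiv ℝ Φ w Complex.I -
    fderiv ℝ χ (Φ w) (fderiv ℝ Φ w Complex.I) * fderiv ℝ Φ w 1)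
  have e1 : ∫ w in Ioo a b ×ℂ Ioo c d, |(fderiv ℝ Φ w).det| • (f (Φ w) * dbarForm χ (Φ w)) =
      ∫ w in Ioo a b ×ℂ Ioo c d, D w := by
    refine setIntegral_congr_fun hmeas fun w hw => ?_
    simp only [D]
    rw [pullback_form, abs_of_pos (hdet w hw), dbarForm, Complex.real_smul]
    ring
  rw [e1, setIntegral_reProdIm_eq]
  let κ : ℝ × ℝ →L[ℝ] ℂ := (Complex.equivRealProdCLM.symm : ℝ × ℝ →L[ℝ] ℂ)
  have hκ : ∀ p : ℝ × ℝ, κ p = p.1 + p.2 * Complex.I := fun p => by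
    apply Complex.ext <;> simp [κ]
  have hκ1 : κ (1, 0) = 1 := by rw [hκ]; simp
  have hκ2 : κ (0, 1) = Complex.I := by rw [hκ]; simp
  let G : ℂ → ℂ → ℂ := fun u w => χ (Φ w) * f (Φ w) * fderiv ℝ Φ w u
  let G' : ℂ → ℂ → ℂ →L[ℝ] ℂ := fun u w =>
    ((χ (Φ w) * f (Φ w)) • ((ContinuousLinearMap.apply ℝ ℂ u).comp (fderiv ℝ (fderiv ℝ Φ) w)) +
        (fderiv ℝ Φ w u) • (χ (Φ w) • (deriv f (Φ w) • fderiv ℝ Φ w) +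
          f (Φ w) • (fderiv ℝ χ (Φ w)).comp (fderiv ℝ Φ w)))
  have hmapc : MapsTo κ (Icc (a, c) (b, d)) (Icc a b ×ℂ Icc c d) := by
    intro p hp
    rw [← Icc_prod_Icc, Set.mem_prod] at hp
    rw [hκ, Complex.mem_reProdIm]
    simpa only [Complex.add_re, Complex.ofReal_re, Complex.re_ofReal_mul, Complex.I_re, mul_zero,
      add_zero, Complex.add_im, Complex.ofReal_im, Complex.im_ofReal_mul, Complex.I_im, mul_one,
      zero_add] using hp
  have hmapo : ∀ p ∈ Ioo a b ×ˢ Ioo c d, κ p ∈ Ioo a b ×ℂ Ioo c d := by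
    intro p hp
    rw [hκ, Complex.mem_reProdIm]
    simpa using hp
  have hcf : ContinuousOn (fun w => f (Φ w)) (Icc a b ×ℂ Icc c d) :=
    hfc.comp hΦ.continuous.continuousOn (mapsTo_image _ _)
  have hdΦ : ∀ u, Continuous fun w => fderiv ℝ Φ w u := fun u =>
    (hΦ.continuous_fderiv (by simp)).clm_apply continuous_const
  have hGc : ∀ u, ContinuousOn (G u) (Icc a b ×ℂ Icc c d) := fun u =>
    (((hχ.continuous.comp hΦ.continuous).continuousOn).mul hcf).mul (hdΦ u).continuousOn
  have hDc : ContinuousOn D (Icc a b ×ℂ Icc c d) := by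
    refine hcf.mul (Continuous.continuousOn ?_)
    have hk : Continuous fun w => fderiv ℝ χ (Φ w) :=
      (hχ.continuous_fderiv (by simp)).comp hΦ.continuous
    exact ((hk.clm_apply (hdΦ _)).mul (hdΦ _)).sub ((hk.clm_apply (hdΦ _)).mul (hdΦ _))
  -- In the divergence of the pulled back form, the terms with the second derivative of `Φ` cancel
  -- by symmetry and those with `f'` cancel by complex linearity. Only the derivative of `χ` is
  -- left, so the divergence is continuous up to the sides although `f'` need not be.
  have hkey : ∀ w ∈ Ioo a b ×ℂ Ioo c d, G' Complex.I w 1 + (-(G' 1 w)) Complex.I = D w := by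
    intro w hw
    have hsymm : fderiv ℝ (fderiv ℝ Φ) w 1 Complex.I = fderiv ℝ (fderiv ℝ Φ) w Complex.I 1 :=
      (hΦ.contDiffAt.isSymmSndFDerivAt
        (by simp only [minSmoothness_of_isRCLikeNormedField]; exact WithTop.coe_le_coe.2 le_top)) 1 Complex.I
    simp only [G', D, add_apply, smul_apply,
      ContinuousLinearMap.comp_apply, neg_apply, smul_eq_mul,
      ContinuousLinearMap.apply_apply, hsymm]
    ring
  have haeset : (Icc (a, c) (b, d) : Set (ℝ × ℝ)) =ᵐ[volume] Ioo a b ×ˢ Ioo c d := by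
    rw [← Icc_prod_Icc]
    exact (Measure.set_prod_ae_eq Ioo_ae_eq_Icc Ioo_ae_eq_Icc).symm
  have hint : IntegrableOn (fun p => D (κ p)) (Icc (a, c) (b, d)) :=
    (hDc.comp κ.continuous.continuousOn hmapc).integrableOn_compact isCompact_Icc
  have hae : (fun p => ((G' Complex.I (κ p)).comp κ) (1, 0) + ((-(G' 1 (κ p))).comp κ) (0, 1))
      =ᵐ[volume.restrict (Icc (a, c) (b, d))] fun p => D (κ p) := by
    rw [Measure.restrict_congr_set haeset]
    filter_upwards [ae_restrict_mem (measurableSet_Ioo.prod measurableSet_Ioo)] with p hp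
    rw [ContinuousLinearMap.comp_apply, ContinuousLinearMap.comp_apply, hκ1, hκ2]
    exact hkey _ (hmapo p hp)
  have hdiv := integral_divergence_prod_Icc_of_hasFDerivAt_of_le
    (fun p => G Complex.I (κ p)) (fun p => -G 1 (κ p))
    (fun p => (G' Complex.I (κ p)).comp κ) (fun p => (-(G' 1 (κ p))).comp κ) (a, c) (b, d)
    ⟨hab, hcd⟩ ((hGc _).comp κ.continuous.continuousOn hmapc)
    ((hGc _).comp κ.continuous.continuousOn hmapc).neg
    (fun p hp => (hasFDerivAt_stokes_form hΦ hχ (hfd _ (hmapo p hp)) _).comp p κ.hasFDerivAt)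
    (fun p hp => ((hasFDerivAt_stokes_form hΦ hχ (hfd _ (hmapo p hp)) _).neg).comp p
      κ.hasFDerivAt) (hint.congr_fun_ae hae.symm)
  rw [integral_congr_ae hae] at hdiv
  simp only [hκ] at hdiv
  rw [hdiv]
  have z1 : ∫ x in a..b, -G 1 (x + d * Complex.I) = 0 := by
    rw [intervalIntegral.integral_congr (g := fun _ => 0)]
    · simp
    · intro x hx
      rw [uIcc_of_le hab] at hx
      simp [G, htop x hx]
  have z2 : ∫ y in c..d, G Complex.I (b + y * Complex.I) = 0 := by
    rw [intervalIntegral.integral_congr (g := fun _ => 0)]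
    · simp
    · intro x hx
      rw [uIcc_of_le hcd] at hx
      simp [G, hright x hx]
  have z3 : ∫ y in c..d, G Complex.I (a + y * Complex.I) = 0 := by
    rw [intervalIntegral.integral_congr (g := fun _ => 0)]
    · simp
    · intro x hx
      rw [uIcc_of_le hcd] at hx
      simp [G, hleft x hx]
  simp only [z1, z2, z3]
  rw [intervalIntegral.integral_neg]
  simp [G]

end Stokes

/-! ### Integrals along the boundary -/

namespace SmoothBoundary

variable {Ω : Set ℂ} {n : ℕ} (Γ : SmoothBoundary Ω n)

theorem integrable_arcLength {F : ℂ → ℂ} (hF : ContinuousOn F (frontier Ω)) :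
    Integrable F Γ.arcLength :=
  memLp_one_iff_integrable.1 (Γ.memLp_arcLength hF 1)

theorem integral_arcLength {F : ℂ → ℂ} (hF : ContinuousOn F (frontier Ω)) :
    ∫ ζ, F ζ ∂Γ.arcLength =
      ∑ j, ∫ t in (0 : ℝ)..1, (‖deriv (Γ.curve j) t‖ : ℂ) * F (Γ.curve j t) := by
  have hI := Γ.integrable_arcLength hF
  have hI' : ∀ j : Fin n, Integrable F (((volume.restrict (Ico (0 : ℝ) 1)).withDensity
      fun t => ENNReal.ofReal ‖deriv (Γ.curve j) t‖).map (Γ.curve j)) := fun j =>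
    hI.mono_measure (Measure.le_sum (fun j : Fin n => ((volume.restrict (Ico (0 : ℝ) 1)).withDensity
      fun t => ENNReal.ofReal ‖deriv (Γ.curve j) t‖).map (Γ.curve j)) j)
  rw [arcLength, Measure.sum_fintype, integral_finsetSum_measure fun j _ => hI' j]
  refine Finset.sum_congr rfl fun j _ => ?_
  rw [integral_map (Γ.smooth j).continuous.aemeasurable (hI' j).1,
    integral_withDensity_eq_integral_toReal_smul
      (f := fun t => ENNReal.ofReal ‖deriv (Γ.curve j) t‖)
      (ENNReal.measurable_ofReal.comp (Γ.continuous_deriv j).norm.measurable)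
      (Eventually.of_forall fun _ => ENNReal.ofReal_lt_top),
    intervalIntegral.integral_of_le zero_le_one, ← integral_Ico_eq_integral_Ioc]
  refine integral_congr_ae (Eventually.of_forall fun t => ?_)
  simp only [ENNReal.toReal_ofReal (norm_nonneg _), Complex.real_smul]

theorem norm_mul_tangent (j : Fin n) (t : ℝ) :
    (‖deriv (Γ.curve j) t‖ : ℂ) * Γ.tangent (Γ.curve j t) = deriv (Γ.curve j) t := by
  rw [tangent_curve]
  have : (‖deriv (Γ.curve j) t‖ : ℂ) ≠ 0 := by simpa using Γ.regular j t
  field_simp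

theorem integral_tangent {F : ℂ → ℂ} (hF : ContinuousOn F (frontier Ω)) :
    ∫ ζ, F ζ * Γ.tangent ζ ∂Γ.arcLength =
      ∑ j, ∫ t in (0 : ℝ)..1, F (Γ.curve j t) * deriv (Γ.curve j) t := by
  rw [Γ.integral_arcLength (F := fun ζ => F ζ * Γ.tangent ζ) (hF.mul Γ.continuousOn_tangent)]
  refine Finset.sum_congr rfl fun j _ => intervalIntegral.integral_congr fun t _ => ?_
  rw [mul_left_comm, norm_mul_tangent]

theorem periodic_deriv (j : Fin n) : Function.Periodic (deriv (Γ.curve j)) 1 := by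
  intro x
  rw [← deriv_comp_add_const]
  congr 1
  funext y
  exact Γ.periodic j y

/-- An integrand supported on an arc shorter than one period reduces the boundary integral to a
single parameter interval, after moving the period to be centred at `t₀`. -/
theorem integral_tangent_of_support {F : ℂ → ℂ} (hF : ContinuousOn F (frontier Ω)) {j : Fin n}
    {t₀ r : ℝ} (hr : 0 ≤ r) (hr2 : r ≤ 1 / 2)
    (hsupp : ∀ ζ ∈ frontier Ω, F ζ ≠ 0 → ∃ τ : ℝ, |τ - t₀| < r ∧ ζ = Γ.curve j τ) :
    ∫ ζ, F ζ * Γ.tangent ζ ∂Γ.arcLength =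
      ∫ t in (t₀ - r)..(t₀ + r), F (Γ.curve j t) * deriv (Γ.curve j) t := by
  rw [Γ.integral_tangent hF, Finset.sum_eq_single j]
  · have hp : Function.Periodic (fun t => F (Γ.curve j t) * deriv (Γ.curve j) t) 1 := by
      intro t
      simp only [Γ.periodic j t, Γ.periodic_deriv j t]
    have hc : Continuous fun t => F (Γ.curve j t) * deriv (Γ.curve j) t :=
      (hF.comp_continuous (Γ.smooth j).continuous fun t => Γ.curve_mem j t).mul
        (Γ.continuous_deriv j)
    have h0 := hp.intervalIntegral_add_eq 0 (t₀ - 1 / 2)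
    rw [zero_add] at h0
    rw [h0]
    have hzero : ∀ t ∈ Icc (t₀ - 1 / 2) (t₀ + 1 / 2), r ≤ |t - t₀| →
        F (Γ.curve j t) * deriv (Γ.curve j) t = 0 := by
      intro t ht hrt
      by_contra hne
      have hF0 : F (Γ.curve j t) ≠ 0 := left_ne_zero_of_mul hne
      obtain ⟨τ, hτ, he⟩ := hsupp _ (Γ.curve_mem j t) hF0
      have hfr : Int.fract t = Int.fract τ := by
        apply Γ.simple j ⟨Int.fract_nonneg _, Int.fract_lt_one _⟩
          ⟨Int.fract_nonneg _, Int.fract_lt_one _⟩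
        rw [Γ.curve_fract, Γ.curve_fract]; exact he
      obtain ⟨m, hm⟩ := Int.fract_eq_fract.1 hfr
      have h1 := abs_lt.1 hτ
      have h2 := ht.1
      have h3 := ht.2
      have m0 : (-1 : ℝ) < m := by linarith
      have m1 : (m : ℝ) < 1 := by linarith
      have m0' : (-1 : ℤ) < m := by exact_mod_cast m0
      have m1' : m < (1 : ℤ) := by exact_mod_cast m1
      have : m = 0 := by omega
      subst this
      have : t = τ := by simpa [sub_eq_zero] using hm
      subst this
      linarith
    have hi : ∀ x y, IntervalIntegrable (fun t => F (Γ.curve j t) * deriv (Γ.curve j) t)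
        volume x y := fun x y => hc.intervalIntegrable x y
    have hz : ∀ x y, x ≤ y → t₀ - 1 / 2 ≤ x → y ≤ t₀ + 1 / 2 →
        (∀ t ∈ Icc x y, r ≤ |t - t₀|) →
        ∫ t in x..y, F (Γ.curve j t) * deriv (Γ.curve j) t = 0 := by
      intro x y hxy hx hy h
      rw [intervalIntegral.integral_congr (g := fun _ => 0)]
      · simp
      · intro t ht
        rw [uIcc_of_le hxy] at ht
        exact hzero t ⟨hx.trans ht.1, ht.2.trans hy⟩ (h t ht)
    have e : t₀ - 1 / 2 + 1 = t₀ + 1 / 2 := by ring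
    rw [e, ← intervalIntegral.integral_add_adjacent_intervals (hi _ (t₀ - r)) (hi (t₀ - r) _),
      ← intervalIntegral.integral_add_adjacent_intervals (hi (t₀ - r) (t₀ + r)) (hi (t₀ + r) _),
      hz (t₀ - 1 / 2) (t₀ - r) (by linarith) le_rfl (by linarith) ?_,
      hz (t₀ + r) (t₀ + 1 / 2) (by linarith) (by linarith) le_rfl ?_]
    · simp
    · intro t ht
      rw [le_abs]; left; linarith [ht.1]
    · intro t ht
      rw [le_abs]; right; linarith [ht.2]
  · intro i _ hij
    rw [intervalIntegral.integral_congr (g := fun _ => 0)]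
    · simp
    · intro t _
      by_contra hne
      obtain ⟨τ, -, he⟩ := hsupp _ (Γ.curve_mem i t) (left_ne_zero_of_mul hne)
      exact (Set.disjoint_left.1 (Γ.disjoint i j hij)) ⟨t, rfl⟩ ⟨τ, he.symm⟩
  · intro h; exact absurd (Finset.mem_univ j) h

end SmoothBoundary

/-! ### Cauchy's theorem on a smoothly bounded domain -/

theorem dbarForm_eq_zero_of_notMem {χ : ℂ → ℂ} {z : ℂ} (hz : z ∉ tsupport χ) :
    dbarForm χ z = 0 := by
  simp [dbarForm, fderiv_of_notMem_tsupport (𝕜 := ℝ) hz]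

theorem continuous_dbarForm {χ : ℂ → ℂ} (hχ : ContDiff ℝ ∞ χ) : Continuous (dbarForm χ) := by
  have h := hχ.continuous_fderiv (by simp)
  exact ((h.clm_apply continuous_const).mul continuous_const).sub (h.clm_apply continuous_const)

theorem fderiv_collar {γ : ℝ → ℂ} (hγ : ContDiff ℝ ∞ γ) (w : ℂ) :
    fderiv ℝ (collar γ) w = collarDeriv γ w := (hasFDerivAt_collar hγ w).fderiv

/-- On the axis the determinant is `‖γ'‖²`, and it is continuous. -/
theorem eventually_det_collar_pos {γ : ℝ → ℂ} (hγ : ContDiff ℝ ∞ γ) {t : ℝ}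
    (ht : deriv γ t ≠ 0) : ∀ᶠ w in 𝓝 (t : ℂ), 0 < (fderiv ℝ (collar γ) w).det := by
  have hc := (contDiff_collar hγ).continuous_fderiv (by simp)
  have hc1 := hc.clm_apply (continuous_const (y := (1 : ℂ)))
  have hc2 := hc.clm_apply (continuous_const (y := Complex.I))
  have hcont : Continuous fun w => (fderiv ℝ (collar γ) w).det := by
    simp only [det_real_clm]
    exact ((Complex.continuous_re.comp hc1).mul (Complex.continuous_im.comp hc2)).sub
      ((Complex.continuous_im.comp hc1).mul (Complex.continuous_re.comp hc2))
  have hpos : 0 < (fderiv ℝ (collar γ) (t : ℂ)).det := by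
    rw [det_real_clm, fderiv_collar hγ, collarDeriv_ofReal, collarDeriv_ofReal]
    have : 0 < Complex.normSq (deriv γ t) := Complex.normSq_pos.2 ht
    rw [Complex.normSq_apply] at this
    simpa using this
  exact hcont.continuousAt.eventually (lt_mem_nhds hpos)

namespace SmoothBoundary

variable {Ω : Set ℂ} {n : ℕ} (Γ : SmoothBoundary Ω n)

/-- Stokes' theorem holds for cut-off functions with support in a small neighbourhood of any point
of the closure. -/
theorem exists_stokes_nhds (hopen : IsOpen Ω) {z₀ : ℂ} (hz₀ : z₀ ∈ closure Ω) :
    ∃ V : Set ℂ, IsOpen V ∧ z₀ ∈ V ∧ ∀ χ : ℂ → ℂ, ContDiff ℝ ∞ χ → tsupport χ ⊆ V →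
      ∀ f : ℂ → ℂ, ContinuousOn f (closure Ω) → DifferentiableOn ℂ f Ω →
        ∫ z in Ω, f z * dbarForm χ z = ∫ ζ, χ ζ * f ζ * Γ.tangent ζ ∂Γ.arcLength := by
  rw [closure_eq_self_union_frontier] at hz₀
  rcases hz₀ with hz₀ | hz₀
  · obtain ⟨ε, hε, hball⟩ := Metric.isOpen_iff.1 hopen z₀ hz₀
    -- Points of the square of half side `r` are at distance at most `2 r < ε` from its centre. In
    -- the boundary case `δ / 3` plays the same part.
    set r := ε / 3 with hr
    have hr0 : 0 < r := by positivity
    have hR : Icc (z₀.re - r) (z₀.re + r) ×ℂ Icc (z₀.im - r) (z₀.im + r) ⊆ Ω := by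
      intro w hw
      apply hball
      rw [Complex.mem_reProdIm] at hw
      rw [Metric.mem_ball, dist_eq_norm]
      have h1 := Complex.norm_le_abs_re_add_abs_im (w - z₀)
      have h2 : |(w - z₀).re| ≤ r := by
        rw [Complex.sub_re, abs_le]; constructor <;> linarith [hw.1.1, hw.1.2]
      have h3 : |(w - z₀).im| ≤ r := by
        rw [Complex.sub_im, abs_le]; constructor <;> linarith [hw.2.1, hw.2.2]
      linarith
    set V := Ioo (z₀.re - r) (z₀.re + r) ×ℂ Ioo (z₀.im - r) (z₀.im + r) with hV
    have hVo : IsOpen V := isOpen_Ioo.reProdIm isOpen_Ioo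
    have hVR : V ⊆ Icc (z₀.re - r) (z₀.re + r) ×ℂ Icc (z₀.im - r) (z₀.im + r) :=
      fun w hw => ⟨Ioo_subset_Icc_self hw.1, Ioo_subset_Icc_self hw.2⟩
    refine ⟨V, hVo, ⟨⟨by linarith, by linarith⟩, ⟨by linarith, by linarith⟩⟩, ?_⟩
    intro χ hχ hsupp f hfc hfd
    have hχ0 : ∀ w, w ∉ V → χ w = 0 := fun w hw =>
      image_eq_zero_of_notMem_tsupport fun h => hw (hsupp h)
    have hrhs : ∫ ζ, χ ζ * f ζ * Γ.tangent ζ ∂Γ.arcLength = 0 := by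
      refine (integral_congr_ae (Γ.ae_mem_frontier.mono fun ζ hζ => ?_)).trans (integral_zero _ _)
      rw [hopen.frontier_eq] at hζ
      simp [hχ0 ζ fun h => hζ.2 (hR (hVR h))]
    have hlhs : ∫ z in Ω, f z * dbarForm χ z = ∫ z in V, f z * dbarForm χ z := by
      refine (setIntegral_eq_of_subset_of_forall_sdiff_eq_zero hopen.measurableSet
        (hVR.trans hR) fun z hz => ?_)
      rw [dbarForm_eq_zero_of_notMem fun h => hz.2 (hsupp h), mul_zero]
    have himg : (id : ℂ → ℂ) '' V = V := image_id V
    have := stokes_rect (Φ := id) (f := f) contDiff_id hχ (a := z₀.re - r) (b := z₀.re + r)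
      (c := z₀.im - r) (d := z₀.im + r) (by linarith) (by linarith) (injOn_id _)
      (fun w _ => by rw [det_real_clm]; simp)
      (by rw [image_id]; exact hfc.mono (hR.trans subset_closure))
      (fun w hw => (hfd w (hR (hVR hw))).differentiableAt (hopen.mem_nhds (hR (hVR hw))))
      (fun y _ => hχ0 _ fun h => by simpa using h.1.1)
      (fun y _ => hχ0 _ fun h => by simpa using h.1.2)
      (fun y _ => hχ0 _ fun h => by simpa using h.2.2)
    rw [← hV, himg] at this
    rw [hrhs, hlhs, this, intervalIntegral.integral_congr (g := fun _ => 0)]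
    · simp
    · intro x _
      simp only
      rw [hχ0 _ fun h => by simpa using h.2.1]
      simp
  · rw [Γ.frontier_eq] at hz₀
    obtain ⟨j, t₀, rfl⟩ := mem_iUnion.1 hz₀
    obtain ⟨δ₁, hchart₁⟩ := Γ.exists_isChart hopen j t₀
    obtain ⟨δ₂, hδ₂, hdet⟩ := Metric.eventually_nhds_iff_ball.1
      (eventually_det_collar_pos (Γ.smooth j) (Γ.regular j t₀))
    set δ := min (min δ₁ δ₂) 1 with hδ
    have hδ0 : 0 < δ := lt_min (lt_min hchart₁.pos hδ₂) one_pos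
    have hδ1 : δ ≤ 1 := min_le_right _ _
    have hchart := hchart₁.mono hδ0 ((min_le_left _ _).trans (min_le_left _ _))
    have hdetpos : ∀ w ∈ Metric.ball (t₀ : ℂ) δ, 0 < (fderiv ℝ (collar (Γ.curve j)) w).det :=
      fun w hw => hdet w (Metric.ball_subset_ball ((min_le_left _ _).trans (min_le_right _ _)) hw)
    set r := δ / 3 with hr
    have hr0 : 0 < r := by positivity
    have hR : Icc (t₀ - r) (t₀ + r) ×ℂ Icc (-r) r ⊆ Metric.ball (t₀ : ℂ) δ := by
      intro w hw
      rw [Complex.mem_reProdIm] at hw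
      rw [Metric.mem_ball, dist_eq_norm]
      have h1 := Complex.norm_le_abs_re_add_abs_im (w - t₀)
      have h2 : |(w - t₀).re| ≤ r := by
        rw [Complex.sub_re, abs_le, Complex.ofReal_re]; constructor <;> linarith [hw.1.1, hw.1.2]
      have h3 : |(w - t₀).im| ≤ r := by
        rw [Complex.sub_im, abs_le, Complex.ofReal_im]; constructor <;> linarith [hw.2.1, hw.2.2]
      linarith
    have hRo : Ioo (t₀ - r) (t₀ + r) ×ℂ Ioo (-r) r ⊆ Icc (t₀ - r) (t₀ + r) ×ℂ Icc (-r) r :=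
      fun w hw => ⟨Ioo_subset_Icc_self hw.1, Ioo_subset_Icc_self hw.2⟩
    have hRu : Icc (t₀ - r) (t₀ + r) ×ℂ Icc 0 r ⊆ Icc (t₀ - r) (t₀ + r) ×ℂ Icc (-r) r :=
      fun w hw => ⟨hw.1, Icc_subset_Icc (by linarith) le_rfl hw.2⟩
    have hRuo : Ioo (t₀ - r) (t₀ + r) ×ℂ Ioo 0 r ⊆ Ioo (t₀ - r) (t₀ + r) ×ℂ Ioo (-r) r :=
      fun w hw => ⟨hw.1, Ioo_subset_Ioo (by linarith) le_rfl hw.2⟩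
    set V := collar (Γ.curve j) '' (Ioo (t₀ - r) (t₀ + r) ×ℂ Ioo (-r) r) with hV
    have hVo : IsOpen V := hchart.isOpen_image (isOpen_Ioo.reProdIm isOpen_Ioo) (hRo.trans hR)
    refine ⟨V, hVo, ⟨t₀, ⟨by simp [hr0], by simp [hr0]⟩, by simp⟩, ?_⟩
    intro χ hχ hsupp f hfc hfd
    -- Injectivity of the chart turns the support condition on `χ` into vanishing on the sides of
    -- the rectangle in collar coordinates.
    have hχ0 : ∀ w ∈ Icc (t₀ - r) (t₀ + r) ×ℂ Icc (-r) r,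
        w ∉ Ioo (t₀ - r) (t₀ + r) ×ℂ Ioo (-r) r → χ (collar (Γ.curve j) w) = 0 := by
      intro w hw hwn
      refine image_eq_zero_of_notMem_tsupport fun h => ?_
      obtain ⟨w', hw', he⟩ := hsupp h
      rw [hchart.injOn (hR (hRo hw')) (hR hw) he] at hw'
      exact hwn hw'
    have hsubΩ : collar (Γ.curve j) '' (Ioo (t₀ - r) (t₀ + r) ×ℂ Ioo 0 r) ⊆ Ω := by
      rintro _ ⟨w, hw, rfl⟩
      exact (hchart.mem_iff w (hR (hRo (hRuo hw)))).2 hw.2.1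
    have hlhs : ∫ z in Ω, f z * dbarForm χ z =
        ∫ z in collar (Γ.curve j) '' (Ioo (t₀ - r) (t₀ + r) ×ℂ Ioo 0 r), f z * dbarForm χ z := by
      refine setIntegral_eq_of_subset_of_forall_sdiff_eq_zero hopen.measurableSet hsubΩ
        fun z hz => ?_
      rw [dbarForm_eq_zero_of_notMem, mul_zero]
      intro h
      obtain ⟨w, hw, rfl⟩ := hsupp h
      have h0 := (hchart.mem_iff w (hR (hRo hw))).1 hz.1
      exact hz.2 ⟨w, ⟨hw.1, h0, hw.2.2⟩, rfl⟩
    have hcl : collar (Γ.curve j) '' (Icc (t₀ - r) (t₀ + r) ×ℂ Icc 0 r) ⊆ closure Ω := by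
      rintro _ ⟨w, hw, rfl⟩
      rw [closure_eq_self_union_frontier]
      rcases hw.2.1.eq_or_lt with h | h
      · exact Or.inr ((hchart.frontier_iff w (hR (hRu hw))).2 h.symm)
      · exact Or.inl ((hchart.mem_iff w (hR (hRu hw))).2 h)
    have key := stokes_rect (Φ := collar (Γ.curve j)) (f := f) (contDiff_collar (Γ.smooth j)) hχ
      (a := t₀ - r) (b := t₀ + r) (c := 0) (d := r) (by linarith) hr0.le
      (hchart.injOn.mono (hRuo.trans (hRo.trans hR)))
      (fun w hw => hdetpos w (hR (hRo (hRuo hw)))) (hfc.mono hcl)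
      (fun w hw => (hfd _ (hsubΩ (mem_image_of_mem _ hw))).differentiableAt
        (hopen.mem_nhds (hsubΩ (mem_image_of_mem _ hw))))
      (fun y hy => hχ0 _ (hRu ⟨by simp; linarith, by simpa using hy⟩) fun h => by
        simpa using h.1.1)
      (fun y hy => hχ0 _ (hRu ⟨by simp; linarith, by simpa using hy⟩) fun h => by
        simpa using h.1.2)
      (fun x hx => hχ0 _ (hRu ⟨by simpa using hx, by simp [hr0.le]⟩) fun h => by
        simpa using h.2.2)
    have hfr : frontier Ω ⊆ closure Ω := frontier_subset_closure
    rw [hlhs, key, Γ.integral_tangent_of_support (F := fun ζ => χ ζ * f ζ)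
      (hχ.continuous.continuousOn.mul (hfc.mono hfr)) (j := j) (t₀ := t₀) hr0.le (by linarith)]
    · refine intervalIntegral.integral_congr fun x _ => ?_
      simp only [Complex.ofReal_zero, zero_mul, add_zero, collar_ofReal]
      rw [fderiv_collar (Γ.smooth j), collarDeriv_ofReal, mul_one]
    · intro ζ hζ hne
      have hζV : ζ ∈ tsupport χ := subset_tsupport _ (left_ne_zero_of_mul hne)
      obtain ⟨w, hw, rfl⟩ := hsupp hζV
      have him := (hchart.frontier_iff w (hR (hRo hw))).1 hζ
      have hw2 : w = (w.re : ℂ) := by apply Complex.ext <;> simp [him]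
      refine ⟨w.re, ?_, ?_⟩
      · rw [abs_lt]; constructor <;> linarith [hw.1.1, hw.1.2]
      · conv_lhs => rw [hw2]
        simp

/-- **Cauchy's theorem** for functions holomorphic in `Ω` and continuous up to the boundary. -/
theorem integral_mul_tangent_eq_zero (hopen : IsOpen Ω) (hbdd : Bornology.IsBounded Ω)
    {f : ℂ → ℂ} (hfc : ContinuousOn f (closure Ω)) (hfd : DifferentiableOn ℂ f Ω) :
    ∫ ζ, f ζ * Γ.tangent ζ ∂Γ.arcLength = 0 := by
  have hK : IsCompact (closure Ω) := hbdd.isCompact_closure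
  choose V hVo hVz hV using fun z : closure Ω => Γ.exists_stokes_nhds hopen z.2
  obtain ⟨p, hp⟩ := SmoothPartitionOfUnity.exists_isSubordinate (modelWithCornersSelf ℝ ℂ)
    isClosed_closure V hVo (fun z hz => mem_iUnion.2 ⟨⟨z, hz⟩, hVz _⟩)
  have hfin := p.locallyFinite.finite_nonempty_inter_compact hK
  let I := hfin.toFinset
  have hsum : ∀ z ∈ closure Ω, ∑ i ∈ I, (p i z : ℂ) = 1 := by
    intro z hz
    have h1 := p.sum_eq_one hz
    rw [finsum_eq_sum_of_support_subset (s := I)] at h1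
    · exact_mod_cast congrArg (fun x : ℝ => (x : ℂ)) h1
    · intro i hi
      simp only [I, Finite.coe_toFinset]
      exact ⟨z, hi, hz⟩
  have hsm : ∀ i, ContDiff ℝ ∞ fun z => (p i z : ℂ) := fun i =>
    Complex.ofRealCLM.contDiff.comp (p i).contMDiff.contDiff
  have hts : ∀ i, tsupport (fun z => (p i z : ℂ)) ⊆ V i := fun i =>
    (closure_mono fun z hz => by simpa using hz).trans (hp i)
  have hfr : frontier Ω ⊆ closure Ω := frontier_subset_closure
  have e1 : ∫ ζ, f ζ * Γ.tangent ζ ∂Γ.arcLength =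
      ∑ i ∈ I, ∫ ζ, (p i ζ : ℂ) * f ζ * Γ.tangent ζ ∂Γ.arcLength := by
    rw [← integral_finsetSum]
    · refine integral_congr_ae (Γ.ae_mem_frontier.mono fun ζ hζ => ?_)
      simp only [← Finset.sum_mul, hsum ζ (hfr hζ), one_mul]
    · intro i _
      exact Γ.integrable_arcLength (((hsm i).continuous.continuousOn.mul (hfc.mono hfr)).mul
        Γ.continuousOn_tangent)
  rw [e1]
  have e2 : ∀ i ∈ I, ∫ ζ, (p i ζ : ℂ) * f ζ * Γ.tangent ζ ∂Γ.arcLength =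
      ∫ z in Ω, f z * dbarForm (fun z => (p i z : ℂ)) z := fun i _ =>
    (hV i _ (hsm i) (hts i) f hfc hfd).symm
  rw [Finset.sum_congr rfl e2, ← integral_finsetSum]
  · refine (setIntegral_congr_fun hopen.measurableSet fun z hz => ?_).trans (integral_zero _ _)
    -- The partition sums to `1` near each point of `Ω`, so the derivatives of its members add up to
    -- zero, and with them the area integrals.
    have hev : (fun z => ∑ i ∈ I, (p i z : ℂ)) =ᶠ[𝓝 z] fun _ => 1 := by
      filter_upwards [hopen.mem_nhds hz] with w hw using hsum w (subset_closure hw)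
    have hd : ∑ i ∈ I, fderiv ℝ (fun z => (p i z : ℂ)) z = 0 := by
      rw [← fderiv_fun_sum fun i _ => (hsm i).differentiable (by simp) z, hev.fderiv_eq]
      simp
    have hd' : ∀ v, ∑ i ∈ I, fderiv ℝ (fun z => (p i z : ℂ)) z v = 0 := fun v => by
      have := congrArg (fun L => L v) hd
      simpa using this
    simp only [dbarForm, ← Finset.mul_sum, Finset.sum_sub_distrib, ← Finset.sum_mul, hd']
    simp
  · intro i _
    exact ((hfc.mul (continuous_dbarForm (hsm i)).continuousOn).integrableOn_compact hK).mono_set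
      subset_closure

end SmoothBoundary

/-! ### Boundary behaviour of conjugated Cauchy integrals -/

theorem exists_lipschitz_near {E : Type*} [NormedAddCommGroup E] [NormedSpace ℝ E] {g : ℝ → E}
    (hg : ContDiff ℝ ∞ g) (t₀ : ℝ) :
    ∃ K ≥ 0, ∃ δ > 0, ∀ s t, |s - t₀| < δ → |t - t₀| < δ → ‖g s - g t‖ ≤ K * |s - t| := by
  obtain ⟨K, S, hS, hL⟩ := (hg.of_le (m := 1) (by simp)).contDiffAt (x := t₀)
    |>.exists_lipschitzOnWith
  obtain ⟨δ, hδ, hsub⟩ := Metric.mem_nhds_iff.1 hS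
  refine ⟨K, K.2, δ, hδ, fun s t hs ht => ?_⟩
  have := hL.dist_le_mul s (hsub (by simpa [Real.dist_eq] using hs)) t
    (hsub (by simpa [Real.dist_eq] using ht))
  rwa [dist_eq_norm, Real.dist_eq] at this

theorem exists_taylor_near {γ : ℝ → ℂ} (hγ : ContDiff ℝ ∞ γ) (t₀ : ℝ) :
    ∃ K ≥ 0, ∃ δ > 0, ∀ s t, |s - t₀| < δ → |t - t₀| < δ →
      ‖γ s - γ t - deriv γ t * (s - t : ℝ)‖ ≤ K * |s - t| ^ 2 := by
  obtain ⟨K, hK, δ, hδ, h⟩ := exists_lipschitz_near (contDiff_deriv_curve hγ) t₀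
  refine ⟨K, hK, δ, hδ, fun s t hs ht => ?_⟩
  have hd : ∀ x ∈ uIcc t s, HasDerivWithinAt (fun x : ℝ => γ x - deriv γ t * (x : ℂ))
      (deriv γ x - deriv γ t * 1) (uIcc t s) x := fun x _ =>
    ((hasDerivAt_curve hγ x).sub ((Complex.ofRealCLM.hasDerivAt (x := x)).const_mul
      (deriv γ t))).hasDerivWithinAt
  have hb : ∀ x ∈ uIcc t s, ‖deriv γ x - deriv γ t * 1‖ ≤ K * |s - t| := by
    intro x hx
    have hx0 : |x - t| ≤ |s - t| := abs_sub_left_of_mem_uIcc hx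
    have hx1 : |x - t₀| < δ := by
      have := abs_sub_lt_iff.1 hs
      have := abs_sub_lt_iff.1 ht
      rw [abs_sub_lt_iff]
      rcases le_total t s with hts | hts
      · rw [uIcc_of_le hts] at hx; constructor <;> linarith [hx.1, hx.2]
      · rw [uIcc_of_ge hts] at hx; constructor <;> linarith [hx.1, hx.2]
    rw [mul_one]
    exact (h x t hx1 ht).trans (mul_le_mul_of_nonneg_left hx0 hK)
  have := (convex_uIcc t s).norm_image_sub_le_of_norm_hasDerivWithin_le hd hb
    left_mem_uIcc right_mem_uIcc
  rw [Real.norm_eq_abs] at this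
  calc ‖γ s - γ t - deriv γ t * (s - t : ℝ)‖
      = ‖γ s - deriv γ t * (s : ℂ) - (γ t - deriv γ t * (t : ℂ))‖ := by
        congr 1; push_cast; ring
    _ ≤ _ := this
    _ = _ := by ring

namespace SmoothBoundary

variable {Ω : Set ℂ} {n : ℕ} {Γ : SmoothBoundary Ω n}

/-- Limits from inside `Ω` become limits from the upper half plane in the collar parameter. -/
theorem IsChart.map_nhdsWithin {j : Fin n} {t₀ δ : ℝ} (h : Γ.IsChart j t₀ δ) {t : ℝ}
    (ht : (t : ℂ) ∈ Metric.ball (t₀ : ℂ) δ) :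
    map (collar (Γ.curve j)) (𝓝[{w : ℂ | 0 < w.im}] (t : ℂ)) = 𝓝[Ω] (Γ.curve j t) := by
  obtain ⟨e, he, hsrc⟩ := h.exists_openPartialHomeomorph
  have h1 := e.map_nhdsWithin_eq (x := (t : ℂ)) (hsrc ▸ ht) {w : ℂ | 0 < w.im}
  rw [he, collar_ofReal] at h1
  rw [h1]
  have h2 : collar (Γ.curve j) '' (e.source ∩ {w : ℂ | 0 < w.im}) =
      Ω ∩ collar (Γ.curve j) '' Metric.ball (t₀ : ℂ) δ := by
    rw [hsrc]
    ext z
    constructor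
    · rintro ⟨w, hw, rfl⟩
      exact ⟨(h.mem_iff w hw.1).2 hw.2, mem_image_of_mem _ hw.1⟩
    · rintro ⟨hz, w, hw, rfl⟩
      exact ⟨w, ⟨hw, (h.mem_iff w hw).1 hz⟩, rfl⟩
  rw [h2]
  refine nhdsWithin_inter_of_mem' (mem_nhdsWithin_of_mem_nhds ?_)
  refine (h.isOpen_image Metric.isOpen_ball Subset.rfl).mem_nhds ⟨t, ht, by simp⟩

/-- The reflected point `collar γ (conj w)` approaches the boundary from outside `closure Ω`. -/
theorem IsChart.tendsto_collar_lower {j : Fin n} {t₀ δ : ℝ} (h : Γ.IsChart j t₀ δ) :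
    Tendsto (fun w => collar (Γ.curve j) (conj w)) (𝓝[{w : ℂ | 0 < w.im}] (t₀ : ℂ))
      (𝓝[(closure Ω)ᶜ] (Γ.curve j t₀)) := by
  refine tendsto_nhdsWithin_iff.2 ⟨?_, ?_⟩
  · have : ContinuousAt (fun w => collar (Γ.curve j) (conj w)) (t₀ : ℂ) :=
      ((continuous_collar (Γ.smooth j)).comp Complex.continuous_conj).continuousAt
    have h2 := this.tendsto
    simp only [Complex.conj_ofReal, collar_ofReal] at h2
    exact h2.mono_left nhdsWithin_le_nhds
  · filter_upwards [self_mem_nhdsWithin,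
      mem_nhdsWithin_of_mem_nhds (Metric.ball_mem_nhds _ h.pos)] with w hw hb
    refine h.notMem_closure ?_ (by simpa using hw)
    rw [Metric.mem_ball, dist_eq_norm] at hb ⊢
    rwa [← Complex.conj_ofReal, ← map_sub, RCLike.norm_conj]

variable (Γ)

theorem arcLength_singleton (z : ℂ) : Γ.arcLength {z} = 0 := by
  rw [arcLength, Measure.sum_apply _ (measurableSet_singleton z), ENNReal.tsum_eq_zero]
  intro j
  rw [Measure.map_apply (Γ.smooth j).continuous.measurable (measurableSet_singleton z)]
  refine withDensity_absolutelyContinuous _ _ ?_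
  rw [Measure.restrict_apply ((Γ.smooth j).continuous.measurable (measurableSet_singleton z))]
  refine Set.Subsingleton.measure_zero ?_ _
  intro s hs t ht
  exact Γ.simple j hs.2 ht.2 (hs.1.trans ht.1.symm)

theorem integrable_mul_continuousOn {u g : ℂ → ℂ} (hu : Integrable u Γ.arcLength)
    (hg : ContinuousOn g (frontier Ω)) : Integrable (fun ζ => u ζ * g ζ) Γ.arcLength := by
  obtain ⟨C, hC⟩ := Γ.isCompact_frontier.exists_bound_of_continuousOn hg
  exact hu.mul_bdd (c := C) (Γ.integrable_arcLength hg).1 (Γ.ae_mem_frontier.mono hC)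

theorem contDiff_tangent_curve (j : Fin n) : ContDiff ℝ ∞ fun t => Γ.tangent (Γ.curve j t) := by
  simp only [tangent_curve]
  have h := contDiff_deriv_curve (Γ.smooth j)
  simp only [div_eq_mul_inv]
  exact h.mul ((Complex.ofRealCLM.contDiff.comp (h.norm ℝ (Γ.regular j))).inv
    fun t => by simpa using Γ.regular j t)

/-- Multiplication by `T²` after conjugation is the reflection that fixes the tangent line. This is
the cancellation behind the comparison of the conjugated and the reflected kernel. -/
theorem deriv_eq_tangent_sq (j : Fin n) (t : ℝ) : deriv (Γ.curve j) t =
    Γ.tangent (Γ.curve j t) * Γ.tangent (Γ.curve j t) * conj (deriv (Γ.curve j) t) := by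
  rw [← Γ.norm_mul_tangent, map_mul, Complex.conj_ofReal]
  have : Γ.tangent (Γ.curve j t) * conj (Γ.tangent (Γ.curve j t)) = 1 := by
    rw [Complex.mul_conj, Complex.normSq_eq_norm_sq, Γ.norm_tangent (Γ.curve_mem j t)]; simp
  linear_combination (-(‖deriv (Γ.curve j) t‖ : ℂ) * Γ.tangent (Γ.curve j t)) * this

/-- The kernel comparing `b / conj (ζ - z)` with a multiple of the Cauchy kernel at the reflected
point is bounded. -/
theorem exists_bound_reflected_kernel (hopen : IsOpen Ω) (j : Fin n) (t₀ : ℝ) {b : ℂ → ℝ}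
    (hb : ∀ j, ContDiff ℝ ∞ fun t => b (Γ.curve j t)) :
    ∃ C, ∀ᶠ w in 𝓝[{w : ℂ | 0 < w.im}] (t₀ : ℂ), ∀ ζ ∈ frontier Ω,
      ‖(b ζ : ℂ) / conj (ζ - collar (Γ.curve j) w) -
        (b (Γ.curve j w.re) : ℂ) * Γ.tangent (Γ.curve j w.re) *
          (Γ.tangent ζ / (ζ - collar (Γ.curve j) (conj w)))‖ ≤ C := by
  obtain ⟨δ₁, hc₁⟩ := Γ.exists_isChart hopen j t₀
  obtain ⟨K₁, hK₁, δ₂, hδ₂, hLb⟩ := exists_lipschitz_near (hb j) t₀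
  obtain ⟨K₂, hK₂, δ₃, hδ₃, hLT⟩ := exists_lipschitz_near (Γ.contDiff_tangent_curve j) t₀
  obtain ⟨K₃, hK₃, δ₄, hδ₄, hTa⟩ := exists_taylor_near (Γ.smooth j) t₀
  obtain ⟨B, hB⟩ := Γ.isCompact_frontier.exists_bound_of_continuousOn
    (Γ.continuousOn_frontier (g := b) fun i => (hb i).continuous)
  have hB0 : 0 ≤ B := (norm_nonneg _).trans (hB _ (Γ.curve_mem j t₀))
  set δ := min (min δ₁ δ₂) (min δ₃ δ₄) with hδdef
  have hδ : 0 < δ := lt_min (lt_min hc₁.pos hδ₂) (lt_min hδ₃ hδ₄)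
  have hd1 : δ ≤ δ₁ := (min_le_left _ _).trans (min_le_left _ _)
  have hd2 : δ ≤ δ₂ := (min_le_left _ _).trans (min_le_right _ _)
  have hd3 : δ ≤ δ₃ := (min_le_right _ _).trans (min_le_left _ _)
  have hd4 : δ ≤ δ₄ := (min_le_right _ _).trans (min_le_right _ _)
  have hc := hc₁.mono hδ hd1
  obtain ⟨ρ, hρ, hfar⟩ := Γ.frontier_near j t₀ hδ
  set m := ‖deriv (Γ.curve j) t₀‖ / 2 with hm
  have hm0 : 0 < m := half_pos (norm_pos_iff.2 (Γ.regular j t₀))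
  obtain ⟨D, hD⟩ : ∃ D, ∀ t : ℝ, |t - t₀| < δ → ‖deriv (Γ.curve j) t‖ ≤ D := by
    obtain ⟨D, hD⟩ := (isCompact_Icc (a := t₀ - δ) (b := t₀ + δ)).exists_bound_of_continuousOn
      (Γ.continuous_deriv j).continuousOn
    refine ⟨D, fun t ht => hD t ?_⟩
    have := abs_lt.1 ht
    constructor <;> linarith
  have hD0 : 0 ≤ D := (norm_nonneg _).trans (hD t₀ (by simpa using hδ))
  have hcoll : ∀ᶠ w in 𝓝[{w : ℂ | 0 < w.im}] (t₀ : ℂ),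
      ‖collar (Γ.curve j) w - Γ.curve j t₀‖ < ρ / 2 := by
    have h1 := (continuous_collar (Γ.smooth j)).tendsto (t₀ : ℂ)
    rw [collar_ofReal] at h1
    filter_upwards [nhdsWithin_le_nhds (h1 (Metric.ball_mem_nhds _ (half_pos hρ)))] with w hw
    simpa [dist_eq_norm] using hw
  have hcoll' : ∀ᶠ w in 𝓝[{w : ℂ | 0 < w.im}] (t₀ : ℂ),
      ‖collar (Γ.curve j) (conj w) - Γ.curve j t₀‖ < ρ / 2 := by
    have h1 := hc.tendsto_collar_lower.mono_right nhdsWithin_le_nhds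
    filter_upwards [h1 (Metric.ball_mem_nhds _ (half_pos hρ))] with w hw
    simpa [dist_eq_norm] using hw
  -- The first entry is for boundary points at distance at least `ρ` from the base point, where both
  -- kernels are bounded separately. The second comes from the near estimate: numerator over the
  -- product of two denominators that are each at least `m ‖x‖`.
  refine ⟨max (B / (ρ / 2) + B * (1 / (ρ / 2))) ((K₁ * D + B * K₂ * D + 2 * B * K₃) / m ^ 2), ?_⟩
  filter_upwards [self_mem_nhdsWithin, hcoll, hcoll',
    mem_nhdsWithin_of_mem_nhds (Metric.ball_mem_nhds _ hδ)] with w hw h1 h2 hwb ζ hζ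
  have hT1 : ‖Γ.tangent (Γ.curve j w.re)‖ = 1 := Γ.norm_tangent (Γ.curve_mem _ _)
  have hT2 : ‖Γ.tangent ζ‖ = 1 := Γ.norm_tangent hζ
  have hBζ : ‖(b ζ : ℂ)‖ ≤ B := by rw [Complex.norm_real]; exact hB ζ hζ
  have hBw : ‖(b (Γ.curve j w.re) : ℂ)‖ ≤ B := by
    rw [Complex.norm_real]; exact hB _ (Γ.curve_mem _ _)
  by_cases hnear : ‖ζ - Γ.curve j t₀‖ < ρ
  · refine le_trans ?_ (le_max_right _ _)
    obtain ⟨τ, hτ, rfl⟩ := hfar ζ hζ hnear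
    have hwre : |w.re - t₀| < δ := by
      rw [Metric.mem_ball, dist_eq_norm] at hwb
      have := Complex.abs_re_le_norm (w - t₀)
      simp only [Complex.sub_re, Complex.ofReal_re] at this
      linarith
    have hτb : (τ : ℂ) ∈ Metric.ball (t₀ : ℂ) δ := by
      rw [Metric.mem_ball, dist_eq_norm, ← Complex.ofReal_sub, Complex.norm_real]; exact hτ
    have hwb' : conj w ∈ Metric.ball (t₀ : ℂ) δ := by
      rw [Metric.mem_ball, dist_eq_norm] at hwb ⊢
      rwa [← Complex.conj_ofReal, ← map_sub, RCLike.norm_conj]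
    set x : ℂ := (τ - w.re : ℝ) + w.im * Complex.I with hx
    have hx1 : x = (τ : ℂ) - conj w := by
      apply Complex.ext <;> simp [hx]
    have hx2 : conj x = (τ : ℂ) - w := by rw [hx1]; simp
    have hxim : 0 < x.im := by simpa [hx] using hw
    have hxpos : 0 < ‖x‖ := norm_pos_iff.2 fun h => by rw [h] at hxim; simp at hxim
    have hxre : |τ - w.re| ≤ ‖x‖ := by
      have := Complex.abs_re_le_norm x
      simpa [hx] using this
    set q := Γ.curve j τ - collar (Γ.curve j) (conj w) with hq
    set p := conj (Γ.curve j τ - collar (Γ.curve j) w) with hp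
    have hqn : m * ‖x‖ ≤ ‖q‖ := by
      have := hc.le_norm_sub hτb hwb'
      rwa [← hx1, collar_ofReal] at this
    have hpn : m * ‖x‖ ≤ ‖p‖ := by
      have := hc.le_norm_sub hτb hwb
      rw [← hx2, collar_ofReal, RCLike.norm_conj] at this
      rwa [hp, RCLike.norm_conj]
    have hq0 : q ≠ 0 := norm_pos_iff.1 (lt_of_lt_of_le (mul_pos hm0 hxpos) hqn)
    have hp0 : p ≠ 0 := norm_pos_iff.1 (lt_of_lt_of_le (mul_pos hm0 hxpos) hpn)
    set R := Γ.curve j τ - Γ.curve j w.re - deriv (Γ.curve j) w.re * (τ - w.re : ℝ) with hR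
    have hRn : ‖R‖ ≤ K₃ * ‖x‖ ^ 2 := by
      refine (hTa τ w.re (hτ.trans_le hd4) (hwre.trans_le hd4)).trans ?_
      gcongr
    set d := deriv (Γ.curve j) w.re with hd
    have hqe : q = d * x + R := by
      simp only [hq, hx, hR, collar, Complex.conj_re, Complex.conj_im]
      push_cast
      ring
    have hpe : p = conj d * x + conj R := by
      have : Γ.curve j τ - collar (Γ.curve j) w = d * conj x + R := by
        simp only [hx, hR, collar, map_add, map_mul, Complex.conj_ofReal, Complex.conj_I]
        push_cast
        ring
      rw [hp, this, map_add, map_mul, Complex.conj_conj]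
    set T := Γ.tangent (Γ.curve j w.re) with hT
    set S := Γ.tangent (Γ.curve j τ) with hS
    set β : ℂ := (b (Γ.curve j w.re) : ℂ) with hβ
    set α : ℂ := (b (Γ.curve j τ) : ℂ) with hα
    -- To first order the denominators are `conj d * x` and `d * x`. The relation `d = T² conj d`
    -- removes the leading term, and what remains is of second order in `x` by the Lipschitz and
    -- Taylor bounds.
    have hnum : α * q - β * T * S * p = ((α - β) * d + β * T * (T - S) * conj d) * x +
        α * R - β * T * S * conj R := by
      have hdT : d = T * T * conj d := Γ.deriv_eq_tangent_sq j w.re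
      rw [hqe, hpe]
      linear_combination (β * x) * hdT
    have hαβ : ‖α - β‖ ≤ K₁ * ‖x‖ := by
      have := hLb τ w.re (hτ.trans_le hd2) (hwre.trans_le hd2)
      rw [hα, hβ, ← Complex.ofReal_sub, Complex.norm_real]
      exact this.trans (by gcongr)
    have hTS : ‖T - S‖ ≤ K₂ * ‖x‖ := by
      have := hLT τ w.re (hτ.trans_le hd3) (hwre.trans_le hd3)
      rw [norm_sub_rev]
      exact this.trans (by gcongr)
    have hdn : ‖d‖ ≤ D := hD _ hwre
    have hnumn : ‖α * q - β * T * S * p‖ ≤ (K₁ * D + B * K₂ * D + 2 * B * K₃) * ‖x‖ ^ 2 := by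
      rw [hnum]
      have e1 : ‖(α - β) * d * x‖ ≤ K₁ * ‖x‖ * D * ‖x‖ := by
        rw [norm_mul, norm_mul]; gcongr
      have e2 : ‖β * T * (T - S) * conj d * x‖ ≤ B * 1 * (K₂ * ‖x‖) * D * ‖x‖ := by
        rw [norm_mul, norm_mul, norm_mul, norm_mul, RCLike.norm_conj, hT1]; gcongr
      have e3 : ‖α * R‖ ≤ B * (K₃ * ‖x‖ ^ 2) := by
        rw [norm_mul]; gcongr
      have e4 : ‖β * T * S * conj R‖ ≤ B * 1 * 1 * (K₃ * ‖x‖ ^ 2) := by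
        rw [norm_mul, norm_mul, norm_mul, RCLike.norm_conj, hT1, hT2]; gcongr
      calc _ = ‖((α - β) * d * x + β * T * (T - S) * conj d * x + α * R) -
            β * T * S * conj R‖ := by congr 1; ring
        _ ≤ _ := norm_sub_le _ _
        _ ≤ ‖(α - β) * d * x‖ + ‖β * T * (T - S) * conj d * x‖ + ‖α * R‖ +
            ‖β * T * S * conj R‖ := by gcongr; exact norm_add₃_le
        _ ≤ _ := by linarith
    have : α / p - β * T * (S / q) = (α * q - β * T * S * p) / (p * q) := by
      field_simp
    rw [this, norm_div, norm_mul, div_le_div_iff₀ (by positivity) (by positivity)]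
    have hprod : (m * ‖x‖) * (m * ‖x‖) ≤ ‖p‖ * ‖q‖ := by gcongr
    have hC0 : 0 ≤ K₁ * D + B * K₂ * D + 2 * B * K₃ := by positivity
    calc _ ≤ (K₁ * D + B * K₂ * D + 2 * B * K₃) * ‖x‖ ^ 2 * m ^ 2 := by gcongr
      _ = (K₁ * D + B * K₂ * D + 2 * B * K₃) * ((m * ‖x‖) * (m * ‖x‖)) := by ring
      _ ≤ _ := by gcongr
  · refine le_trans ?_ (le_max_left _ _)
    push Not at hnear
    have d1 : ρ / 2 ≤ ‖ζ - collar (Γ.curve j) w‖ := by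
      have := norm_sub_le_norm_sub_add_norm_sub ζ (collar (Γ.curve j) w) (Γ.curve j t₀)
      linarith
    have d2 : ρ / 2 ≤ ‖ζ - collar (Γ.curve j) (conj w)‖ := by
      have := norm_sub_le_norm_sub_add_norm_sub ζ (collar (Γ.curve j) (conj w)) (Γ.curve j t₀)
      linarith
    refine (norm_sub_le _ _).trans (add_le_add ?_ ?_)
    · rw [norm_div, RCLike.norm_conj]
      gcongr
    · rw [norm_mul, norm_mul, norm_div, hT1, hT2, mul_one]
      gcongr

/-- If the Cauchy integral of `u` has a limit at a boundary point from outside, then the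
integral of `u b / conj (ζ - z)` has a limit from inside. -/
theorem exists_tendsto_conj_cauchy (hopen : IsOpen Ω) (j : Fin n) (t₀ : ℝ) {b : ℂ → ℝ}
    (hb : ∀ j, ContDiff ℝ ∞ fun t => b (Γ.curve j t)) {u : ℂ → ℂ} (hu : Integrable u Γ.arcLength)
    {e₀ : ℂ} (he : Tendsto (fun w => ∫ ζ, u ζ / (ζ - w) * Γ.tangent ζ ∂Γ.arcLength)
      (𝓝[(closure Ω)ᶜ] (Γ.curve j t₀)) (𝓝 e₀)) :
    ∃ A, Tendsto (fun z => ∫ ζ, u ζ * (b ζ / conj (ζ - z)) ∂Γ.arcLength)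
      (𝓝[Ω] (Γ.curve j t₀)) (𝓝 A) := by
  obtain ⟨δ, hc⟩ := Γ.exists_isChart hopen j t₀
  obtain ⟨C, hC⟩ := Γ.exists_bound_reflected_kernel hopen j t₀ hb
  have hbc : ContinuousOn b (frontier Ω) := Γ.continuousOn_frontier fun i => (hb i).continuous
  set k : ℂ → ℂ → ℂ := fun w ζ => (b ζ : ℂ) / conj (ζ - collar (Γ.curve j) w) -
        (b (Γ.curve j w.re) : ℂ) * Γ.tangent (Γ.curve j w.re) *
          (Γ.tangent ζ / (ζ - collar (Γ.curve j) (conj w))) with hk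
  have hmem : ∀ᶠ w in 𝓝[{w : ℂ | 0 < w.im}] (t₀ : ℂ), collar (Γ.curve j) w ∉ frontier Ω ∧
      collar (Γ.curve j) (conj w) ∉ frontier Ω := by
    filter_upwards [self_mem_nhdsWithin,
      mem_nhdsWithin_of_mem_nhds (Metric.ball_mem_nhds _ hc.pos)] with w hw hwb
    have hwb' : conj w ∈ Metric.ball (t₀ : ℂ) δ := by
      rw [Metric.mem_ball, dist_eq_norm] at hwb ⊢
      rwa [← Complex.conj_ofReal, ← map_sub, RCLike.norm_conj]
    rw [hc.frontier_iff w hwb, hc.frontier_iff _ hwb']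
    have : w.im ≠ 0 := (show 0 < w.im from hw).ne'
    simpa using this
  have hcont1 : ∀ z ∉ frontier Ω, ContinuousOn (fun ζ => (b ζ : ℂ) / conj (ζ - z))
      (frontier Ω) := fun z hz =>
    (Complex.continuous_ofReal.comp_continuousOn hbc).div
      (Complex.continuous_conj.comp_continuousOn (continuousOn_id.sub continuousOn_const))
      fun ζ hζ h0 => hz (by
        rw [map_eq_zero, sub_eq_zero] at h0; exact h0 ▸ hζ)
  have hcont2 : ∀ z ∉ frontier Ω, ContinuousOn (fun ζ => Γ.tangent ζ / (ζ - z))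
      (frontier Ω) := fun z hz =>
    Γ.continuousOn_tangent.div (continuousOn_id.sub continuousOn_const)
      fun ζ hζ h0 => hz (by
        have : ζ = z := by simpa [sub_eq_zero] using h0
        exact this ▸ hζ)
  have hcontk : ∀ w, collar (Γ.curve j) w ∉ frontier Ω →
      collar (Γ.curve j) (conj w) ∉ frontier Ω → ContinuousOn (k w) (frontier Ω) :=
    fun w h1 h2 => (hcont1 _ h1).sub (continuousOn_const.mul (hcont2 _ h2))
  -- The difference of the kernels is bounded and converges pointwise except at the base point,
  -- which is null for arc length. Dominated convergence therefore needs no more of `u` than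
  -- integrability.
  have hlim : Tendsto (fun w => ∫ ζ, u ζ * k w ζ ∂Γ.arcLength) (𝓝[{w : ℂ | 0 < w.im}] (t₀ : ℂ))
      (𝓝 (∫ ζ, u ζ * k t₀ ζ ∂Γ.arcLength)) := by
    refine tendsto_integral_filter_of_dominated_convergence (fun ζ => ‖u ζ‖ * C) ?_ ?_ ?_ ?_
    · filter_upwards [hmem] with w hw
      exact (Γ.integrable_mul_continuousOn hu (hcontk w hw.1 hw.2)).1
    · filter_upwards [hC] with w hw
      filter_upwards [Γ.ae_mem_frontier] with ζ hζ
      rw [norm_mul]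
      exact mul_le_mul_of_nonneg_left (hw ζ hζ) (norm_nonneg _)
    · exact hu.norm.mul_const C
    · have hne : ∀ᵐ ζ ∂Γ.arcLength, ζ ≠ Γ.curve j t₀ := by
        rw [ae_iff]; simpa using Γ.arcLength_singleton (Γ.curve j t₀)
      filter_upwards [hne] with ζ hζ
      refine Tendsto.const_mul _ (Tendsto.mono_left ?_ nhdsWithin_le_nhds)
      have hcc := continuous_collar (Γ.smooth j)
      have h1 : Continuous fun w : ℂ => conj (ζ - collar (Γ.curve j) w) :=
        Complex.continuous_conj.comp (continuous_const.sub hcc)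
      have h2 : Continuous fun w : ℂ => ζ - collar (Γ.curve j) (conj w) :=
        continuous_const.sub (hcc.comp Complex.continuous_conj)
      have h3 : Continuous fun w : ℂ => ((b (Γ.curve j w.re) : ℂ)) :=
        Complex.continuous_ofReal.comp ((hb j).continuous.comp Complex.continuous_re)
      have h4 : Continuous fun w : ℂ => Γ.tangent (Γ.curve j w.re) :=
        (Γ.contDiff_tangent_curve j).continuous.comp Complex.continuous_re
      have hz : ζ - Γ.curve j t₀ ≠ 0 := sub_ne_zero.2 hζ
      have : ContinuousAt (fun w => k w ζ) (t₀ : ℂ) := by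
        refine (continuousAt_const.div h1.continuousAt ?_).sub
          ((h3.mul h4).continuousAt.mul (continuousAt_const.div h2.continuousAt ?_))
        · rw [collar_ofReal]; exact (map_ne_zero _).2 hz
        · rw [Complex.conj_ofReal, collar_ofReal]; exact hz
      exact this.tendsto
  have hc0 : Tendsto (fun w : ℂ => (b (Γ.curve j w.re) : ℂ) * Γ.tangent (Γ.curve j w.re))
      (𝓝[{w : ℂ | 0 < w.im}] (t₀ : ℂ))
      (𝓝 ((b (Γ.curve j t₀) : ℂ) * Γ.tangent (Γ.curve j t₀))) := by
    have h3 : Continuous fun w : ℂ => ((b (Γ.curve j w.re) : ℂ)) :=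
      Complex.continuous_ofReal.comp ((hb j).continuous.comp Complex.continuous_re)
    have h4 : Continuous fun w : ℂ => Γ.tangent (Γ.curve j w.re) :=
      (Γ.contDiff_tangent_curve j).continuous.comp Complex.continuous_re
    exact ((h3.mul h4).tendsto (t₀ : ℂ)).mono_left nhdsWithin_le_nhds
  refine ⟨(∫ ζ, u ζ * k t₀ ζ ∂Γ.arcLength) +
    (b (Γ.curve j t₀) : ℂ) * Γ.tangent (Γ.curve j t₀) * e₀, ?_⟩
  rw [← hc.map_nhdsWithin (Metric.mem_ball_self hc.pos), tendsto_map'_iff]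
  refine (hlim.add (hc0.mul (he.comp hc.tendsto_collar_lower))).congr' ?_
  filter_upwards [hmem] with w hw
  simp only [Function.comp_apply]
  have hi1 := Γ.integrable_mul_continuousOn hu (hcontk w hw.1 hw.2)
  have hi2 := (Γ.integrable_mul_continuousOn hu (hcont2 _ hw.2)).const_mul
    ((b (Γ.curve j w.re) : ℂ) * Γ.tangent (Γ.curve j w.re))
  rw [← integral_const_mul, ← integral_add hi1 (hi2.congr ?_)]
  · refine integral_congr_ae (Eventually.of_forall fun ζ => ?_)
    simp only [hk]
    ring
  · exact Eventually.of_forall fun ζ => by simp only; ring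

end SmoothBoundary

/-! ### The jump of a Cauchy integral -/

theorem norm_ofReal_add_I (s : ℝ) : ‖(s : ℂ) + Complex.I‖ ^ 2 = 1 + s ^ 2 := by
  rw [← Complex.normSq_eq_norm_sq, Complex.normSq_apply]; simp; ring

theorem norm_ofReal_sub_I (s : ℝ) : ‖(s : ℂ) - Complex.I‖ ^ 2 = 1 + s ^ 2 := by
  rw [← Complex.normSq_eq_norm_sq, Complex.normSq_apply]; simp; ring

theorem collar_sub_collar_conj (γ : ℝ → ℂ) (t y : ℝ) :
    collar γ (t + y * Complex.I) - collar γ (t - y * Complex.I) =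
      2 * Complex.I * y * deriv γ t := by
  simp only [collar, Complex.add_re, Complex.sub_re, Complex.ofReal_re, Complex.re_ofReal_mul,
    Complex.I_re, mul_zero, add_zero, sub_zero, Complex.add_im, Complex.sub_im, Complex.ofReal_im,
    Complex.im_ofReal_mul, Complex.I_im, mul_one, zero_add, zero_sub, Complex.ofReal_neg]
  ring

theorem tendsto_slope_collar {γ : ℝ → ℂ} (hγ : ContDiff ℝ ∞ γ) (τ : ℝ) (c : ℂ) :
    Tendsto (fun y : ℝ => (collar γ (τ + y * c) - γ τ) / y) (𝓝[>] 0) (𝓝 (deriv γ τ * c)) := by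
  have h1 : HasDerivAt (fun y : ℝ => (τ : ℂ) + y * c) c 0 := by
    have := ((Complex.ofRealCLM.hasDerivAt (x := (0 : ℝ))).mul_const c).const_add (τ : ℂ)
    simpa using this
  have h0 : (τ : ℂ) + ((0 : ℝ) : ℂ) * c = τ := by simp
  have h2 := (h0.symm ▸ hasFDerivAt_collar hγ (τ : ℂ) :
    HasFDerivAt (collar γ) (collarDeriv γ τ) ((τ : ℂ) + ((0 : ℝ) : ℂ) * c)).comp_hasDerivAt 0 h1
  rw [collarDeriv_ofReal] at h2
  have h3 := (hasDerivAt_iff_tendsto_slope_zero.1 h2).mono_left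
    (nhdsWithin_mono 0 fun x (hx : 0 < x) => hx.ne')
  refine h3.congr fun y => ?_
  simp only [Function.comp_apply, zero_add, h0, collar_ofReal, Complex.real_smul,
    Complex.ofReal_inv]
  rw [div_eq_inv_mul]

/-- The difference of two Cauchy kernels at symmetric points of a collar. -/
noncomputable def jumpKernel (γ : ℝ → ℂ) (y : ℝ) (t : ℝ) (ζ : ℂ) : ℂ :=
  (ζ - collar γ (t + y * Complex.I))⁻¹ - (ζ - collar γ (t - y * Complex.I))⁻¹

theorem measurable_jumpKernel {γ : ℝ → ℂ} (hγ : ContDiff ℝ ∞ γ) (y : ℝ) :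
    Measurable fun p : ℂ × ℝ => jumpKernel γ y p.2 p.1 := by
  have hc := continuous_collar hγ
  have h1 : Continuous fun p : ℂ × ℝ => p.1 - collar γ (p.2 + y * Complex.I) :=
    continuous_fst.sub (hc.comp ((Complex.continuous_ofReal.comp continuous_snd).add
      continuous_const))
  have h2 : Continuous fun p : ℂ × ℝ => p.1 - collar γ (p.2 - y * Complex.I) :=
    continuous_fst.sub (hc.comp ((Complex.continuous_ofReal.comp continuous_snd).sub
      continuous_const))
  exact h1.measurable.inv.sub h2.measurable.inv

namespace SmoothBoundary

variable {Ω : Set ℂ} {n : ℕ} {Γ : SmoothBoundary Ω n}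

theorem IsChart.add_mem_ball {t₀ r t y : ℝ} (ht : |t - t₀| < r) (hy : |y| < r) :
    (t : ℂ) + y * Complex.I ∈ Metric.ball (t₀ : ℂ) (3 * r) := by
  rw [Metric.mem_ball, dist_eq_norm]
  have h1 := Complex.norm_le_abs_re_add_abs_im ((t : ℂ) + y * Complex.I - t₀)
  simp at h1
  have := abs_nonneg y
  linarith

theorem IsChart.sub_mem_ball {t₀ r t y : ℝ} (ht : |t - t₀| < r) (hy : |y| < r) :
    (t : ℂ) - y * Complex.I ∈ Metric.ball (t₀ : ℂ) (3 * r) := by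
  have := IsChart.add_mem_ball ht (y := -y) (by rwa [abs_neg])
  simpa [sub_eq_add_neg] using this

/-- The substitution `t = τ + y s`, which brings the kernel to unit scale. -/
theorem integral_jumpKernel_eq {γ : ℝ → ℂ} (G : ℝ → ℂ) (τ : ℝ) {y : ℝ} (hy : 0 < y) (ζ : ℂ) :
    ∫ t, G t * jumpKernel γ y t ζ =
      ∫ s : ℝ, y * (G (τ + y * s) * jumpKernel γ y (τ + y * s) ζ) := by
  have h1 := integral_add_left_eq_self (μ := volume) (fun t => G t * jumpKernel γ y t ζ) τ
  have h2 := Measure.integral_comp_mul_left (fun s => G (τ + s) * jumpKernel γ y (τ + s) ζ) y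
  rw [h1] at h2
  rw [integral_const_mul, h2, abs_of_pos (inv_pos.2 hy), Complex.real_smul, ← mul_assoc,
    ← Complex.ofReal_mul, mul_inv_cancel₀ hy.ne', Complex.ofReal_one, one_mul]

/-- The two poles are `2 y ‖γ'‖` apart, while each denominator is at least `m y ‖s + i‖`. So the
kernel has Poisson decay, uniformly in `y` after rescaling. -/
theorem IsChart.norm_jumpKernel_le {j : Fin n} {t₀ r : ℝ} (hc : Γ.IsChart j t₀ (3 * r))
    {D : ℝ} (hD : ∀ t : ℝ, |t - t₀| < r → ‖deriv (Γ.curve j) t‖ ≤ D)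
    {τ y s : ℝ} (hτ : |τ - t₀| < r) (hy : 0 < y) (hyr : y < r) (hs : |τ + y * s - t₀| < r) :
    ‖jumpKernel (Γ.curve j) y (τ + y * s) (Γ.curve j τ)‖ ≤
      2 * D / (‖deriv (Γ.curve j) t₀‖ / 2) ^ 2 / y * (1 + s ^ 2)⁻¹ := by
  set m := ‖deriv (Γ.curve j) t₀‖ / 2 with hm
  have hm0 : 0 < m := half_pos (norm_pos_iff.2 (Γ.regular j t₀))
  have hyr' : |y| < r := by rwa [abs_of_pos hy]
  have hτb : (τ : ℂ) ∈ Metric.ball (t₀ : ℂ) (3 * r) := by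
    have := IsChart.add_mem_ball hτ (y := 0) (by simpa using hy.trans hyr)
    simpa using this
  have hn1 : 0 < ‖(s : ℂ) + Complex.I‖ := by
    have := norm_ofReal_add_I s
    by_contra h
    have h0 : ‖(s : ℂ) + Complex.I‖ = 0 := le_antisymm (not_lt.1 h) (norm_nonneg _)
    rw [h0] at this; nlinarith [sq_nonneg s]
  have hn2 : ‖(s : ℂ) - Complex.I‖ = ‖(s : ℂ) + Complex.I‖ := by
    have h1 := norm_ofReal_add_I s
    rw [← norm_ofReal_sub_I s] at h1
    exact ((pow_left_inj₀ (norm_nonneg _) (norm_nonneg _) two_ne_zero).1 h1).symm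
  have h1 : m * (y * ‖(s : ℂ) + Complex.I‖) ≤
      ‖Γ.curve j τ - collar (Γ.curve j) ((τ + y * s : ℝ) + y * Complex.I)‖ := by
    have := hc.le_norm_sub hτb (IsChart.add_mem_ball hs hyr')
    rw [collar_ofReal] at this
    convert this using 2
    rw [show (τ : ℂ) - ((τ + y * s : ℝ) + y * Complex.I) = -(y * (s + Complex.I)) by
      push_cast; ring, norm_neg, norm_mul, Complex.norm_real, Real.norm_of_nonneg hy.le]
  have h2 : m * (y * ‖(s : ℂ) + Complex.I‖) ≤
      ‖Γ.curve j τ - collar (Γ.curve j) ((τ + y * s : ℝ) - y * Complex.I)‖ := by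
    have := hc.le_norm_sub hτb (IsChart.sub_mem_ball hs hyr')
    rw [collar_ofReal] at this
    convert this using 2
    rw [show (τ : ℂ) - ((τ + y * s : ℝ) - y * Complex.I) = -(y * (s - Complex.I)) by
      push_cast; ring, norm_neg, norm_mul, Complex.norm_real, Real.norm_of_nonneg hy.le, hn2]
  have hp : 0 < m * (y * ‖(s : ℂ) + Complex.I‖) := by positivity
  have hD0 : 0 ≤ D := (norm_nonneg _).trans (hD _ hs)
  have z1 := norm_pos_iff.1 (hp.trans_le h1)
  have z2 := norm_pos_iff.1 (hp.trans_le h2)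
  have hsub := collar_sub_collar_conj (Γ.curve j) (τ + y * s) y
  have hN : ‖collar (Γ.curve j) ((τ + y * s : ℝ) + y * Complex.I) -
      collar (Γ.curve j) ((τ + y * s : ℝ) - y * Complex.I)‖ ≤ 2 * y * D := by
    rw [hsub, norm_mul, norm_mul, norm_mul, Complex.norm_I, Complex.norm_real,
      Real.norm_of_nonneg hy.le]
    simp only [Complex.norm_ofNat, mul_one]
    exact mul_le_mul_of_nonneg_left (hD _ hs) (by positivity)
  rw [jumpKernel, inv_sub_inv z1 z2, norm_div, norm_mul]
  have e : Γ.curve j τ - collar (Γ.curve j) ((τ + y * s : ℝ) - y * Complex.I) -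
      (Γ.curve j τ - collar (Γ.curve j) ((τ + y * s : ℝ) + y * Complex.I)) =
      collar (Γ.curve j) ((τ + y * s : ℝ) + y * Complex.I) -
      collar (Γ.curve j) ((τ + y * s : ℝ) - y * Complex.I) := by ring
  rw [e]
  calc _ ≤ 2 * y * D / ((m * (y * ‖(s : ℂ) + Complex.I‖)) *
        (m * (y * ‖(s : ℂ) + Complex.I‖))) := by gcongr
    _ = 2 * y * D / (m ^ 2 * y ^ 2 * ‖(s : ℂ) + Complex.I‖ ^ 2) := by ring
    _ = _ := by
      rw [norm_ofReal_add_I]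
      have : 1 + s ^ 2 ≠ 0 := by positivity
      field_simp

theorem IsChart.norm_integrand_le {j : Fin n} {t₀ r : ℝ} (hc : Γ.IsChart j t₀ (3 * r))
    {D M : ℝ} (hD : ∀ t : ℝ, |t - t₀| < r → ‖deriv (Γ.curve j) t‖ ≤ D) {G : ℝ → ℂ}
    (hG0 : ∀ t, r ≤ |t - t₀| → G t = 0) (hGM : ∀ t, ‖G t‖ ≤ M)
    {τ y : ℝ} (hτ : |τ - t₀| < r) (hy : 0 < y) (hyr : y < r) (s : ℝ) :
    ‖(y : ℂ) * (G (τ + y * s) * jumpKernel (Γ.curve j) y (τ + y * s) (Γ.curve j τ))‖ ≤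
      M * (2 * D / (‖deriv (Γ.curve j) t₀‖ / 2) ^ 2) * (1 + s ^ 2)⁻¹ := by
  have hM : 0 ≤ M := (norm_nonneg _).trans (hGM 0)
  have hD0 : 0 ≤ D := (norm_nonneg _).trans (hD τ hτ)
  rcases lt_or_ge |τ + y * s - t₀| r with hs | hs
  · rw [norm_mul, norm_mul, Complex.norm_real, Real.norm_of_nonneg hy.le]
    have := hc.norm_jumpKernel_le hD hτ hy hyr hs
    calc _ ≤ y * (M * (2 * D / (‖deriv (Γ.curve j) t₀‖ / 2) ^ 2 / y * (1 + s ^ 2)⁻¹)) := by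
          gcongr; exact hGM _
      _ = _ := by field_simp
  · rw [hG0 _ hs]; simp only [zero_mul, mul_zero, norm_zero]
    positivity

theorem IsChart.norm_integral_jumpKernel_le {j : Fin n} {t₀ r : ℝ} (hc : Γ.IsChart j t₀ (3 * r))
    {D M : ℝ} (hD : ∀ t : ℝ, |t - t₀| < r → ‖deriv (Γ.curve j) t‖ ≤ D) {G : ℝ → ℂ}
    (hG0 : ∀ t, r ≤ |t - t₀| → G t = 0) (hGM : ∀ t, ‖G t‖ ≤ M)
    {τ y : ℝ} (hτ : |τ - t₀| < r) (hy : 0 < y) (hyr : y < r) :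
    ‖∫ t, G t * jumpKernel (Γ.curve j) y t (Γ.curve j τ)‖ ≤
      M * (2 * D / (‖deriv (Γ.curve j) t₀‖ / 2) ^ 2) * Real.pi := by
  rw [integral_jumpKernel_eq G τ hy]
  refine (norm_integral_le_of_norm_le (integrable_inv_one_add_sq.const_mul _)
    (Eventually.of_forall (hc.norm_integrand_le hD hG0 hGM hτ hy hyr))).trans ?_
  rw [integral_const_mul, integral_univ_inv_one_add_sq]

/-- At unit scale the kernel tends to `2 i / (γ'(τ) (1 + s²))`, and the total integral of `1 / (1 +
s²)` is `π`. The jump kernel is thus `2 π i / γ'(τ)` times an approximate identity. -/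
theorem IsChart.tendsto_integral_jumpKernel {j : Fin n} {t₀ r : ℝ}
    (hc : Γ.IsChart j t₀ (3 * r)) {D M : ℝ}
    (hD : ∀ t : ℝ, |t - t₀| < r → ‖deriv (Γ.curve j) t‖ ≤ D) {G : ℝ → ℂ} (hGm : Measurable G)
    (hG0 : ∀ t, r ≤ |t - t₀| → G t = 0) (hGM : ∀ t, ‖G t‖ ≤ M)
    {τ : ℝ} (hτ : |τ - t₀| < r) (hGc : ContinuousAt G τ) :
    Tendsto (fun y => ∫ t, G t * jumpKernel (Γ.curve j) y t (Γ.curve j τ)) (𝓝[>] 0)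
      (𝓝 (2 * Real.pi * Complex.I * (G τ / deriv (Γ.curve j) τ))) := by
  have hr : 0 < r := by have := hc.pos; linarith
  have hval : 2 * Real.pi * Complex.I * (G τ / deriv (Γ.curve j) τ) =
      ∫ s : ℝ, G τ * ((-(deriv (Γ.curve j) τ * (s + Complex.I)))⁻¹ -
        (-(deriv (Γ.curve j) τ * (s - Complex.I)))⁻¹) := by
    have hpt : ∀ s : ℝ, G τ * ((-(deriv (Γ.curve j) τ * (s + Complex.I)))⁻¹ -
        (-(deriv (Γ.curve j) τ * (s - Complex.I)))⁻¹) =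
        (2 * Complex.I * (G τ / deriv (Γ.curve j) τ)) * (((1 + s ^ 2)⁻¹ : ℝ) : ℂ) := by
      intro s
      have hd := Γ.regular j τ
      have h1 : ((s : ℂ) + Complex.I) ≠ 0 := fun h => by
        have := congrArg Complex.im h; simp at this
      have h2 : ((s : ℂ) - Complex.I) ≠ 0 := fun h => by
        have := congrArg Complex.im h; simp at this
      have h3 : (1 + (s : ℂ) ^ 2) = (s + Complex.I) * (s - Complex.I) := by
        linear_combination Complex.I_sq
      push_cast
      rw [h3]
      field_simp
      ring
    simp only [hpt]
    rw [integral_const_mul, integral_complex_ofReal, integral_univ_inv_one_add_sq]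
    ring
  rw [hval]
  have heq : (fun y : ℝ => ∫ t, G t * jumpKernel (Γ.curve j) y t (Γ.curve j τ)) =ᶠ[𝓝[>] 0]
      fun y => ∫ s : ℝ, y * (G (τ + y * s) *
        jumpKernel (Γ.curve j) y (τ + y * s) (Γ.curve j τ)) := by
    filter_upwards [self_mem_nhdsWithin] with y hy using integral_jumpKernel_eq G τ hy _
  refine Tendsto.congr' heq.symm ?_
  refine tendsto_integral_filter_of_dominated_convergence
    (fun s => M * (2 * D / (‖deriv (Γ.curve j) t₀‖ / 2) ^ 2) * (1 + s ^ 2)⁻¹) ?_ ?_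
    (integrable_inv_one_add_sq.const_mul _) ?_
  · refine Eventually.of_forall fun y => ?_
    have hm : Measurable fun s : ℝ => τ + y * s := by fun_prop
    exact (((hGm.comp hm).mul ((measurable_jumpKernel (Γ.smooth j) y).comp
      (measurable_const.prodMk hm))).const_mul _).aestronglyMeasurable
  · filter_upwards [Ioo_mem_nhdsGT hr] with y hy
    exact Eventually.of_forall (hc.norm_integrand_le hD hG0 hGM hτ hy.1 hy.2)
  · refine Eventually.of_forall fun s => ?_
    have hG : Tendsto (fun y : ℝ => G (τ + y * s)) (𝓝[>] 0) (𝓝 (G τ)) := by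
      have : Tendsto (fun y : ℝ => τ + y * s) (𝓝[>] 0) (𝓝 τ) := by
        have hcont : Continuous fun y : ℝ => τ + y * s := by fun_prop
        have := hcont.tendsto 0
        simp only [zero_mul, add_zero] at this
        exact this.mono_left nhdsWithin_le_nhds
      exact hGc.tendsto.comp this
    have hd := Γ.regular j τ
    have n1 : ((s : ℂ) + Complex.I) ≠ 0 := fun h => by
      have := congrArg Complex.im h; simp at this
    have n2 : ((s : ℂ) - Complex.I) ≠ 0 := fun h => by
      have := congrArg Complex.im h; simp at this
    have h1 := ((tendsto_slope_collar (Γ.smooth j) τ (s + Complex.I)).neg).inv₀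
      (neg_ne_zero.2 (mul_ne_zero hd n1))
    have h2 := ((tendsto_slope_collar (Γ.smooth j) τ (s - Complex.I)).neg).inv₀
      (neg_ne_zero.2 (mul_ne_zero hd n2))
    refine (hG.mul (h1.sub h2)).congr' ?_
    filter_upwards [self_mem_nhdsWithin] with y hy
    have hy0 : (y : ℂ) ≠ 0 := by simpa using (show (0 : ℝ) < y from hy).ne'
    have a1 : ((τ + y * s : ℝ) : ℂ) + y * Complex.I = τ + y * (s + Complex.I) := by
      push_cast; ring
    have a2 : ((τ + y * s : ℝ) : ℂ) - y * Complex.I = τ + y * (s - Complex.I) := by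
      push_cast; ring
    have b : ∀ x : ℂ, (-((x - Γ.curve j τ) / y))⁻¹ = y * (Γ.curve j τ - x)⁻¹ := by
      intro x
      rw [← neg_div, neg_sub, inv_div, div_eq_mul_inv]
    rw [jumpKernel, a1, a2, b, b]
    ring

end SmoothBoundary

theorem collar_add (γ : ℝ → ℂ) (t y : ℝ) :
    collar γ (t + y * Complex.I) = γ t + Complex.I * y * deriv γ t := by
  simp [collar]

theorem collar_sub (γ : ℝ → ℂ) (t y : ℝ) :
    collar γ (t - y * Complex.I) = γ t - Complex.I * y * deriv γ t := by
  simp [collar, sub_eq_add_neg]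

namespace SmoothBoundary

variable {Ω : Set ℂ} {n : ℕ} {Γ : SmoothBoundary Ω n}

theorem integral_mul_tangent_div_eq_cauchy (Γ : SmoothBoundary Ω n) (u : ℂ → ℂ) (z : ℂ) :
    ∫ ζ, u ζ / (ζ - z) * Γ.tangent ζ ∂Γ.arcLength = 2 * Real.pi * Complex.I * Γ.cauchy u z := by
  rw [cauchy, mul_inv_cancel_left₀]
  simp [Real.pi_ne_zero]

theorem integrable_div_sub {u : ℂ → ℂ} (hu : Integrable u Γ.arcLength) {z : ℂ}
    (hz : z ∉ frontier Ω) :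
    Integrable (fun ζ => u ζ / (ζ - z) * Γ.tangent ζ) Γ.arcLength := by
  have h : ContinuousOn (fun ζ => (ζ - z)⁻¹ * Γ.tangent ζ) (frontier Ω) :=
    ((continuousOn_id.sub continuousOn_const).inv₀
      fun ζ hζ h => hz (sub_eq_zero.1 (show ζ - z = 0 from h) ▸ hζ)).mul Γ.continuousOn_tangent
  refine (Γ.integrable_mul_continuousOn hu h).congr (Eventually.of_forall fun ζ => ?_)
  simp only [div_eq_mul_inv]; ring

theorem IsChart.integral_jump_eq {j : Fin n} {t₀ r : ℝ} (hc : Γ.IsChart j t₀ (3 * r))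
    {u : ℂ → ℂ} (hu : Integrable u Γ.arcLength) {t y : ℝ} (ht : |t - t₀| < r) (hy : 0 < y)
    (hyr : y < r) :
    ∫ ζ, u ζ * Γ.tangent ζ * jumpKernel (Γ.curve j) y t ζ ∂Γ.arcLength =
      2 * Real.pi * Complex.I * (Γ.cauchy u (collar (Γ.curve j) (t + y * Complex.I)) -
        Γ.cauchy u (collar (Γ.curve j) (t - y * Complex.I))) := by
  have hyr' : |y| < r := by rwa [abs_of_pos hy]
  have n1 : collar (Γ.curve j) (t + y * Complex.I) ∉ frontier Ω := fun h => by
    have := (hc.frontier_iff _ (IsChart.add_mem_ball ht hyr')).1 h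
    simp at this; linarith
  have n2 : collar (Γ.curve j) (t - y * Complex.I) ∉ frontier Ω := fun h => by
    have := (hc.frontier_iff _ (IsChart.sub_mem_ball ht hyr')).1 h
    simp at this; linarith
  rw [mul_sub, ← integral_mul_tangent_div_eq_cauchy, ← integral_mul_tangent_div_eq_cauchy,
    ← integral_sub (integrable_div_sub hu n1) (integrable_div_sub hu n2)]
  congr 1; funext ζ
  rw [jumpKernel]; ring

/-- Fubini moves the test function onto the kernel, so that only its jump, and no boundary limit of
the Cauchy integral of an integrable `u`, has to be controlled. -/
theorem IsChart.integral_integral_jumpKernel {j : Fin n} {t₀ r : ℝ}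
    (hc : Γ.IsChart j t₀ (3 * r)) {u : ℂ → ℂ} (hu : Integrable u Γ.arcLength) {G : ℝ → ℂ}
    (hG : Integrable G) (hG0 : ∀ t, r ≤ |t - t₀| → G t = 0) {y : ℝ} (hy : 0 < y) (hyr : y < r) :
    ∫ ζ, u ζ * Γ.tangent ζ * (∫ t, G t * jumpKernel (Γ.curve j) y t ζ) ∂Γ.arcLength =
      ∫ t, G t * (2 * Real.pi * Complex.I *
        (Γ.cauchy u (collar (Γ.curve j) (t + y * Complex.I)) -
        Γ.cauchy u (collar (Γ.curve j) (t - y * Complex.I)))) := by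
  have hyr' : |y| < r := by rwa [abs_of_pos hy]
  have hyp : |y| < r * (3 / 2) := by linarith
  set J := jumpKernel (Γ.curve j) y
  have hb : ∃ C, ∀ p ∈ frontier Ω ×ˢ Icc (t₀ - r) (t₀ + r), ‖J p.2 p.1‖ ≤ C := by
    refine (Γ.isCompact_frontier.prod isCompact_Icc).exists_bound_of_continuousOn
      (f := fun p : ℂ × ℝ => J p.2 p.1) ?_
    have hcc := continuous_collar (Γ.smooth j)
    have m : ∀ p ∈ frontier Ω ×ˢ Icc (t₀ - r) (t₀ + r), |p.2 - t₀| < r * (3 / 2) := by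
      rintro p ⟨-, h1, h2⟩
      rw [abs_lt]; constructor <;> linarith
    have e : r * (3 / 2) + r * (3 / 2) = 3 * r := by ring
    refine ContinuousOn.sub (ContinuousOn.inv₀ (Continuous.continuousOn ?_) ?_)
      (ContinuousOn.inv₀ (Continuous.continuousOn ?_) ?_)
    · exact continuous_fst.sub (hcc.comp ((Complex.continuous_ofReal.comp
        continuous_snd).add continuous_const))
    · rintro p hp h
      have hm : (p.2 : ℂ) + y * Complex.I ∈ Metric.ball (t₀ : ℂ) (3 * r) := by
        rw [Metric.mem_ball, dist_eq_norm, ← e]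
        refine (Complex.norm_le_abs_re_add_abs_im _).trans_lt ?_
        have := m p hp
        simp; linarith
      have := (hc.frontier_iff _ hm).1 (by rw [← sub_eq_zero.1 h]; exact hp.1)
      simp at this; linarith
    · exact continuous_fst.sub (hcc.comp ((Complex.continuous_ofReal.comp
        continuous_snd).sub continuous_const))
    · rintro p hp h
      have hm : (p.2 : ℂ) - y * Complex.I ∈ Metric.ball (t₀ : ℂ) (3 * r) := by
        rw [Metric.mem_ball, dist_eq_norm, ← e]
        refine (Complex.norm_le_abs_re_add_abs_im _).trans_lt ?_
        have := m p hp
        simp; linarith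
      have := (hc.frontier_iff _ hm).1 (by rw [← sub_eq_zero.1 h]; exact hp.1)
      simp at this; linarith
  obtain ⟨C, hC⟩ := hb
  have huT := Γ.integrable_mul_continuousOn hu Γ.continuousOn_tangent
  have hint : Integrable (fun p : ℂ × ℝ => u p.1 * Γ.tangent p.1 * (G p.2 * J p.2 p.1))
      (Γ.arcLength.prod volume) := by
    have h1 := huT.mul_prod hG
    -- The kernel is bounded only for parameters in the chart. Cutting it off there changes nothing,
    -- since `G` vanishes elsewhere.
    have hm : Measurable ((univ ×ˢ Icc (t₀ - r) (t₀ + r)).indicator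
        fun p : ℂ × ℝ => J p.2 p.1) :=
      (measurable_jumpKernel (Γ.smooth j) y).indicator (MeasurableSet.univ.prod measurableSet_Icc)
    have hf : ∀ᵐ p ∂(Γ.arcLength.prod (volume : Measure ℝ)), p.1 ∈ frontier Ω :=
      Measure.quasiMeasurePreserving_fst.ae Γ.ae_mem_frontier
    refine (h1.mul_bdd (c := max C 0) hm.aestronglyMeasurable (hf.mono fun p hp => ?_)).congr
      (Eventually.of_forall fun p => ?_)
    · by_cases h : p ∈ (univ : Set ℂ) ×ˢ Icc (t₀ - r) (t₀ + r)
      · rw [indicator_of_mem h]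
        exact (hC p ⟨hp, h.2⟩).trans (le_max_left _ _)
      · rw [indicator_of_notMem h, norm_zero]; exact le_max_right _ _
    · by_cases h : p ∈ (univ : Set ℂ) ×ˢ Icc (t₀ - r) (t₀ + r)
      · simp only [indicator_of_mem h]; ring
      · simp only [indicator_of_notMem h]
        rw [hG0 p.2]
        · simp
        · by_contra hlt
          rw [not_le, abs_lt] at hlt
          exact h ⟨trivial, by linarith [hlt.1], by linarith [hlt.2]⟩
  calc _ = ∫ ζ, (∫ t, u ζ * Γ.tangent ζ * (G t * J t ζ)) ∂Γ.arcLength := by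
        congr 1; funext ζ; rw [integral_const_mul]
    _ = ∫ t, ∫ ζ, u ζ * Γ.tangent ζ * (G t * J t ζ) ∂Γ.arcLength := integral_integral_swap hint
    _ = _ := by
      congr 1; funext t
      rcases lt_or_ge |t - t₀| r with ht | ht
      · rw [← hc.integral_jump_eq hu ht hy hyr, ← integral_const_mul]
        congr 1; funext ζ; ring
      · rw [hG0 t ht]; simp

/-- Away from the support of `G` both denominators are bounded below while the numerator is of order
`y`. -/
theorem IsChart.norm_integral_jumpKernel_le_of_far {j : Fin n} {t₀ r : ℝ}
    (hc : Γ.IsChart j t₀ (3 * r)) {D M d : ℝ}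
    (hD : ∀ t : ℝ, |t - t₀| < r → ‖deriv (Γ.curve j) t‖ ≤ D) {G : ℝ → ℂ}
    (hG0 : ∀ t, r ≤ |t - t₀| → G t = 0) (hGM : ∀ t, ‖G t‖ ≤ M) {ζ : ℂ} (hd : 0 < d)
    (hζ : ∀ t, G t ≠ 0 → d ≤ ‖ζ - Γ.curve j t‖)
    {y : ℝ} (hy : 0 < y) (hyd : y * D ≤ d / 2) :
    ‖∫ t, G t * jumpKernel (Γ.curve j) y t ζ‖ ≤ M * (2 * y * D / (d / 2) ^ 2) * (2 * r) := by
  have hr : 0 < r := by have := hc.pos; linarith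
  have hM : 0 ≤ M := (norm_nonneg _).trans (hGM 0)
  have hD0 : 0 ≤ D := (norm_nonneg _).trans (hD t₀ (by simpa using hr))
  have hsub : ∫ t, G t * jumpKernel (Γ.curve j) y t ζ =
      ∫ t in Icc (t₀ - r) (t₀ + r), G t * jumpKernel (Γ.curve j) y t ζ := by
    refine (setIntegral_eq_integral_of_forall_compl_eq_zero fun t ht => ?_).symm
    rw [hG0 t, zero_mul]
    by_contra hlt
    rw [not_le, abs_lt] at hlt
    exact ht ⟨by linarith [hlt.1], by linarith [hlt.2]⟩
  rw [hsub]
  refine (norm_setIntegral_le_of_norm_le_const (C := M * (2 * y * D / (d / 2) ^ 2)) (by simp)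
    fun t _ => ?_).trans ?_
  · by_cases hGt : G t = 0
    · rw [hGt, zero_mul, norm_zero]; positivity
    have ht : |t - t₀| < r := by
      by_contra h; exact hGt (hG0 t (not_lt.1 h))
    have hz := hζ t hGt
    have hDt := hD t ht
    have key : ∀ c : ℂ, ‖c‖ = 1 → d / 2 ≤ ‖ζ - (Γ.curve j t + y * c * deriv (Γ.curve j) t)‖ := by
      intro c hc1
      have h1 : ‖(y : ℂ) * c * deriv (Γ.curve j) t‖ ≤ d / 2 := by
        rw [norm_mul, norm_mul, hc1, Complex.norm_real, Real.norm_of_nonneg hy.le, mul_one]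
        exact (mul_le_mul_of_nonneg_left hDt hy.le).trans hyd
      have h2 := norm_sub_norm_le (ζ - Γ.curve j t) (y * c * deriv (Γ.curve j) t)
      rw [← sub_sub]
      linarith
    have e1 : collar (Γ.curve j) (t + y * Complex.I) =
        Γ.curve j t + y * Complex.I * deriv (Γ.curve j) t := by
      simp only [collar_add, collar_sub]; ring
    have e2 : collar (Γ.curve j) (t - y * Complex.I) =
        Γ.curve j t + y * (-Complex.I) * deriv (Γ.curve j) t := by
      simp only [collar_add, collar_sub]; ring
    have k1 := key Complex.I Complex.norm_I
    have k2 := key (-Complex.I) (by rw [norm_neg, Complex.norm_I])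
    rw [← e1] at k1
    rw [← e2] at k2
    have hd2 : 0 < d / 2 := half_pos hd
    rw [norm_mul, jumpKernel, inv_sub_inv (norm_pos_iff.1 (hd2.trans_le k1))
      (norm_pos_iff.1 (hd2.trans_le k2)), norm_div, norm_mul, sub_sub_sub_cancel_left,
      collar_sub_collar_conj, norm_mul, norm_mul, norm_mul, Complex.norm_I, Complex.norm_real,
      Real.norm_of_nonneg hy.le]
    simp only [Complex.norm_ofNat, mul_one]
    rw [sq]
    gcongr
    exact hGM t
  · rw [measureReal_def, Real.volume_Icc, ENNReal.toReal_ofReal (by linarith)]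
    apply le_of_eq; ring

/-- The jump formula tested against a smooth `g`. As `y` tends to `0`, integrating `g` against the
jump of the Cauchy integral gives `∫ g u dz` if Fubini is applied first, and `∫ g U dz` if the
assumed values on both sides are inserted, up to the common factor `2 π i`. Since `g` is arbitrary,
`u = U` almost everywhere. -/
theorem IsChart.ae_eq_of_cauchy {j : Fin n} {t₀ r : ℝ} (hc : Γ.IsChart j t₀ (3 * r))
    (hr2 : r ≤ 1 / 2) {u U : ℂ → ℂ} (hu : Integrable u Γ.arcLength)
    (hU : ContinuousOn U (closure Ω)) (hin : ∀ z ∈ Ω, Γ.cauchy u z = U z)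
    (hout : ∀ z ∉ closure Ω, Γ.cauchy u z = 0) :
    ∀ᵐ ζ ∂Γ.arcLength, ζ ∈ collar (Γ.curve j) '' Metric.ball (t₀ : ℂ) r →
      (u ζ - U ζ) * Γ.tangent ζ = 0 := by
  have hr : 0 < r := by have := hc.pos; linarith
  have hr3 : r ≤ 3 * r := by linarith
  have hUf : ContinuousOn U (frontier Ω) := hU.mono frontier_subset_closure
  have huT := Γ.integrable_mul_continuousOn hu Γ.continuousOn_tangent
  have hUi : Integrable U Γ.arcLength := memLp_one_iff_integrable.1 (Γ.memLp_arcLength hUf 1)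
  have hUT := Γ.integrable_mul_continuousOn hUi Γ.continuousOn_tangent
  have hreal : ∀ τ : ℝ, |τ - t₀| < r → (τ : ℂ) ∈ Metric.ball (t₀ : ℂ) r := fun τ hτ => by
    rwa [Metric.mem_ball, dist_eq_norm, ← Complex.ofReal_sub, Complex.norm_real,
      Real.norm_eq_abs]
  have hV : ∀ ζ ∈ frontier Ω, ζ ∈ collar (Γ.curve j) '' Metric.ball (t₀ : ℂ) r →
      ∃ τ : ℝ, |τ - t₀| < r ∧ ζ = Γ.curve j τ := by
    rintro _ hf ⟨w, hw, rfl⟩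
    have him := (hc.frontier_iff w (Metric.ball_subset_ball hr3 hw)).1 hf
    have hwe : w = (w.re : ℂ) := Complex.ext rfl (by simpa using him)
    refine ⟨w.re, ?_, by rw [hwe, collar_ofReal, Complex.ofReal_re]⟩
    rw [hwe, Metric.mem_ball, dist_eq_norm, ← Complex.ofReal_sub, Complex.norm_real] at hw
    exact hw
  refine (hc.isOpen_image Metric.isOpen_ball (Metric.ball_subset_ball
    hr3)).ae_eq_zero_of_integral_contDiff_smul_eq_zero ?_ ?_
  · simp only [sub_mul]
    exact (huT.sub hUT).locallyIntegrable.locallyIntegrableOn _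
  intro g hg hgc hgs
  set V := collar (Γ.curve j) '' Metric.ball (t₀ : ℂ) r with hVdef
  have hVo : IsOpen V := hc.isOpen_image Metric.isOpen_ball (Metric.ball_subset_ball hr3)
  obtain ⟨Mg, hMg⟩ := hgc.exists_bound_of_continuous hg.continuous
  obtain ⟨D, hD'⟩ := (isCompact_Icc (a := t₀ - r) (b := t₀ + r)).exists_bound_of_continuousOn
    (Γ.continuous_deriv j).continuousOn
  have hIcc : ∀ t, |t - t₀| < r → t ∈ Icc (t₀ - r) (t₀ + r) := fun t ht => by
    rw [abs_lt] at ht; constructor <;> linarith [ht.1, ht.2]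
  have hD : ∀ t, |t - t₀| < r → ‖deriv (Γ.curve j) t‖ ≤ D := fun t ht => hD' t (hIcc t ht)
  have hD0 : 0 ≤ D := (norm_nonneg _).trans (hD t₀ (by simpa using hr))
  have hMg0 : 0 ≤ Mg := (norm_nonneg _).trans (hMg 0)
  set A : Set ℝ := {t | |t - t₀| < r} with hA
  have hAo : IsOpen A := isOpen_lt (by fun_prop) continuous_const
  set g₁ : ℝ → ℂ := fun t => g (Γ.curve j t) * deriv (Γ.curve j) t with hg₁
  have hg₁c : Continuous g₁ := (Complex.continuous_ofReal.comp (hg.continuous.comp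
    (Γ.smooth j).continuous)).mul (Γ.continuous_deriv j)
  -- The function `g ∘ γ` is periodic, so it is restricted to the single window that belongs to this
  -- chart.
  set G : ℝ → ℂ := A.indicator g₁ with hGdef
  have hGm : Measurable G := hg₁c.measurable.indicator hAo.measurableSet
  have hG0 : ∀ t, r ≤ |t - t₀| → G t = 0 := fun t ht =>
    indicator_of_notMem (show t ∉ A from not_lt.2 ht) _
  have hG1 : ∀ t, |t - t₀| < r → G t = g₁ t := fun t ht => indicator_of_mem (show t ∈ A from ht) _
  have hGM : ∀ t, ‖G t‖ ≤ Mg * D := by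
    intro t
    rcases lt_or_ge |t - t₀| r with ht | ht
    · rw [hG1 t ht, hg₁, norm_mul, Complex.norm_real]
      exact mul_le_mul (hMg _) (hD t ht) (norm_nonneg _) hMg0
    · rw [hG0 t ht, norm_zero]; positivity
  have hGi : Integrable G := by
    rw [hGdef, integrable_indicator_iff hAo.measurableSet]
    exact (hg₁c.continuousOn.integrableOn_Icc).mono_set hIcc
  have hGc : ∀ τ, |τ - t₀| < r → ContinuousAt G τ := fun τ hτ =>
    hg₁c.continuousAt.congr (by
      filter_upwards [hAo.mem_nhds (show τ ∈ A from hτ)] with t ht using (hG1 t ht).symm)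
  -- The support of `g` is compact in the open set `V`, so it has a positive distance from every
  -- point outside `V`.
  obtain ⟨d, hd, hdist⟩ : ∃ d > 0, ∀ ζ ∉ V, ∀ t, G t ≠ 0 → d ≤ ‖ζ - Γ.curve j t‖ := by
    obtain ⟨d, hd, hsub⟩ := hgc.isCompact.exists_thickening_subset_open hVo hgs
    refine ⟨d, hd, fun ζ hζ t ht => ?_⟩
    by_contra hlt
    refine hζ (hsub (Metric.mem_thickening_iff.2 ⟨Γ.curve j t, ?_, ?_⟩))
    · refine subset_tsupport _ fun h0 => ht ?_
      rcases lt_or_ge |t - t₀| r with h | h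
      · rw [hG1 t h, hg₁]; simp [h0]
      · exact hG0 t h
    · rw [dist_eq_norm]; exact not_le.1 hlt
  set K : ℝ → ℂ → ℂ := fun y ζ => ∫ t, G t * jumpKernel (Γ.curve j) y t ζ with hK
  set B : ℝ := max (Mg * D * (2 * D / (‖deriv (Γ.curve j) t₀‖ / 2) ^ 2) * Real.pi)
    (Mg * D * (d / (d / 2) ^ 2) * (2 * r))
  have hsmall : ∀ᶠ y : ℝ in 𝓝[>] 0, 0 < y ∧ y < r ∧ y * D ≤ d / 2 := by
    have : ∀ᶠ y : ℝ in 𝓝[>] 0, y * D < d / 2 := by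
      have h : Tendsto (fun y : ℝ => y * D) (𝓝[>] 0) (𝓝 0) := by
        have := (continuous_mul_const D).tendsto (0 : ℝ)
        rw [zero_mul] at this
        exact this.mono_left nhdsWithin_le_nhds
      exact h.eventually_lt_const (half_pos hd)
    filter_upwards [Ioo_mem_nhdsGT hr, this] with y hy hyd using ⟨hy.1, hy.2, hyd.le⟩
  have hKb : ∀ᶠ y in 𝓝[>] 0, ∀ᵐ ζ ∂Γ.arcLength, ‖u ζ * Γ.tangent ζ * K y ζ‖ ≤
      ‖u ζ * Γ.tangent ζ‖ * B := by
    filter_upwards [hsmall] with y ⟨hy, hyr, hyd⟩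
    filter_upwards [Γ.ae_mem_frontier] with ζ hζ
    rw [norm_mul]
    refine mul_le_mul_of_nonneg_left ?_ (norm_nonneg _)
    by_cases hζV : ζ ∈ V
    · obtain ⟨τ, hτ, rfl⟩ := hV ζ hζ hζV
      exact (hc.norm_integral_jumpKernel_le hD hG0 hGM hτ hy hyr).trans (le_max_left _ _)
    · refine (hc.norm_integral_jumpKernel_le_of_far hD hG0 hGM hd (hdist ζ hζV) hy hyd).trans
        (le_trans ?_ (le_max_right _ _))
      gcongr
      linarith
  have hKlim : ∀ᵐ ζ ∂Γ.arcLength, Tendsto (fun y => u ζ * Γ.tangent ζ * K y ζ) (𝓝[>] 0)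
      (𝓝 (u ζ * Γ.tangent ζ * (2 * Real.pi * Complex.I * g ζ))) := by
    filter_upwards [Γ.ae_mem_frontier] with ζ hζ
    refine Tendsto.const_mul _ ?_
    by_cases hζV : ζ ∈ V
    · obtain ⟨τ, hτ, rfl⟩ := hV ζ hζ hζV
      have := hc.tendsto_integral_jumpKernel hD hGm hG0 hGM hτ (hGc τ hτ)
      rwa [hG1 τ hτ, hg₁, mul_div_cancel_right₀ _ (Γ.regular j τ)] at this
    · have hg0 : g ζ = 0 := by
        by_contra h; exact hζV (hgs (subset_tsupport _ h))
      rw [hg0, Complex.ofReal_zero, mul_zero]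
      have hb : Tendsto (fun y : ℝ => Mg * D * (2 * y * D / (d / 2) ^ 2) * (2 * r)) (𝓝[>] 0)
          (𝓝 0) := by
        have : Continuous fun y : ℝ => Mg * D * (2 * y * D / (d / 2) ^ 2) * (2 * r) := by
          fun_prop
        have := this.tendsto 0
        simp only [mul_zero, zero_mul, zero_div] at this
        exact this.mono_left nhdsWithin_le_nhds
      refine squeeze_zero_norm' ?_ hb
      filter_upwards [hsmall] with y ⟨hy, hyr, hyd⟩
      exact hc.norm_integral_jumpKernel_le_of_far hD hG0 hGM hd (hdist ζ hζV) hy hyd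
  have lim1 := tendsto_integral_filter_of_dominated_convergence (l := 𝓝[>] (0 : ℝ)) (F := fun y ζ =>
    u ζ * Γ.tangent ζ * K y ζ) (fun ζ => ‖u ζ * Γ.tangent ζ‖ * B) (Eventually.of_forall fun y =>
      huT.aestronglyMeasurable.mul
        (((hGm.comp measurable_snd).mul (measurable_jumpKernel (Γ.smooth j)
          y)).stronglyMeasurable.integral_prod_right'.aestronglyMeasurable))
    hKb (huT.norm.mul_const _) hKlim
  have hUc : ∀ t, |t - t₀| < r → Tendsto (fun y : ℝ => U (collar (Γ.curve j) (t + y * Complex.I)))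
      (𝓝[>] 0) (𝓝 (U (Γ.curve j t))) := by
    intro t ht
    have h1 := (hU (Γ.curve j t) (frontier_subset_closure (Γ.curve_mem j t))).tendsto
    refine h1.comp (tendsto_nhdsWithin_iff.2 ⟨?_, ?_⟩)
    · have : Continuous fun y : ℝ => collar (Γ.curve j) (t + y * Complex.I) :=
        (continuous_collar (Γ.smooth j)).comp (by fun_prop)
      have := this.tendsto 0
      simp only [Complex.ofReal_zero, zero_mul, add_zero, collar_ofReal] at this
      exact this.mono_left nhdsWithin_le_nhds
    · filter_upwards [Ioo_mem_nhdsGT hr] with y hy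
      refine subset_closure ((hc.mem_iff _ (IsChart.add_mem_ball ht ?_)).2 ?_)
      · rw [abs_of_pos hy.1]; exact hy.2
      · simpa using hy.1
  have hΩb : ∃ C, ∀ t y, |t - t₀| < r → 0 < y → y < r →
      ‖U (collar (Γ.curve j) (t + y * Complex.I))‖ ≤ C := by
    have hcomp : IsCompact (collar (Γ.curve j) '' (Icc (t₀ - r) (t₀ + r) ×ℂ Icc 0 r)) :=
      (isCompact_Icc.reProdIm isCompact_Icc).image (continuous_collar (Γ.smooth j))
    obtain ⟨C, hC⟩ := (hcomp.inter_right isClosed_closure).exists_bound_of_continuousOn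
      (hU.mono (inter_subset_right))
    refine ⟨C, fun t y ht hy hyr => hC _ ⟨⟨_, ?_, rfl⟩, subset_closure
      ((hc.mem_iff _ (IsChart.add_mem_ball ht ?_)).2 ?_)⟩⟩
    · have := hIcc t ht
      refine Complex.mem_reProdIm.2 ⟨by simpa using this, by simpa using ⟨hy.le, hyr.le⟩⟩
    · rwa [abs_of_pos hy]
    · simpa using hy
  obtain ⟨C, hC⟩ := hΩb
  have lim2 : Tendsto (fun y : ℝ => ∫ t, G t * (2 * Real.pi * Complex.I *
      (Γ.cauchy u (collar (Γ.curve j) (t + y * Complex.I)) -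
        Γ.cauchy u (collar (Γ.curve j) (t - y * Complex.I))))) (𝓝[>] 0)
      (𝓝 (∫ t, G t * (2 * Real.pi * Complex.I * U (Γ.curve j t)))) := by
    have hev : ∀ᶠ y : ℝ in 𝓝[>] 0, ∀ t, G t * (2 * Real.pi * Complex.I *
        (Γ.cauchy u (collar (Γ.curve j) (t + y * Complex.I)) -
        Γ.cauchy u (collar (Γ.curve j) (t - y * Complex.I)))) =
        G t * (2 * Real.pi * Complex.I *
          (closure Ω).indicator U (collar (Γ.curve j) (t + y * Complex.I))) := by
      filter_upwards [hsmall] with y ⟨hy, hyr, hyd⟩ t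
      rcases lt_or_ge |t - t₀| r with ht | ht
      · have hyr' : |y| < r := by rwa [abs_of_pos hy]
        have hmem : collar (Γ.curve j) (t + y * Complex.I) ∈ Ω :=
          (hc.mem_iff _ (IsChart.add_mem_ball ht hyr')).2 (by simpa using hy)
        rw [hin _ hmem, hout _ (hc.notMem_closure (IsChart.sub_mem_ball ht hyr')
          (by simpa using hy)), sub_zero, indicator_of_mem (subset_closure hmem)]
      · rw [hG0 t ht, zero_mul, zero_mul]
    refine Tendsto.congr' (f₁ := fun y : ℝ => ∫ t, G t * (2 * Real.pi * Complex.I *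
          (closure Ω).indicator U (collar (Γ.curve j) (t + y * Complex.I)))) ?_ ?_
    · filter_upwards [hev] with y hy
      congr 1; funext t; exact (hy t).symm
    have hind : ∀ t y, |t - t₀| < r → 0 < y → y < r →
        (closure Ω).indicator U (collar (Γ.curve j) (t + y * Complex.I)) =
          U (collar (Γ.curve j) (t + y * Complex.I)) := fun t y ht hy hyr =>
      indicator_of_mem (subset_closure ((hc.mem_iff _ (IsChart.add_mem_ball ht
        (by rwa [abs_of_pos hy]))).2 (by simpa using hy))) _
    refine tendsto_integral_filter_of_dominated_convergence
      (fun t => ‖G t‖ * (2 * Real.pi * C)) ?_ ?_ (hGi.norm.mul_const _) ?_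
    · have hUm : Measurable ((closure Ω).indicator U) := by
        classical
        rw [← piecewise_eq_indicator]
        exact hU.measurable_piecewise continuousOn_const isClosed_closure.measurableSet
      refine Eventually.of_forall fun y => Measurable.aestronglyMeasurable ?_
      exact hGm.mul ((hUm.comp ((continuous_collar (Γ.smooth j)).comp
        (by fun_prop : Continuous fun t : ℝ => (t : ℂ) + y * Complex.I)).measurable).const_mul _)
    · filter_upwards [hsmall] with y ⟨hy, hyr, hyd⟩
      refine Eventually.of_forall fun t => ?_
      rcases lt_or_ge |t - t₀| r with ht | ht
      · rw [hind t y ht hy hyr, norm_mul, norm_mul]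
        have : ‖(2 * Real.pi * Complex.I : ℂ)‖ = 2 * Real.pi := by
          simp [Real.pi_pos.le]
        rw [this]
        have := hC t y ht hy hyr
        have := Real.pi_pos
        gcongr
      · rw [hG0 t ht]; simp
    · refine Eventually.of_forall fun t => ?_
      rcases lt_or_ge |t - t₀| r with ht | ht
      · refine Tendsto.const_mul _ (Tendsto.const_mul _ ((hUc t ht).congr' ?_))
        filter_upwards [hsmall] with y ⟨hy, hyr, hyd⟩ using (hind t y ht hy hyr).symm
      · simp only [hG0 t ht, zero_mul]; exact tendsto_const_nhds
  have hlim := tendsto_nhds_unique_of_eventuallyEq lim1 lim2 (by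
    filter_upwards [hsmall] with y ⟨hy, hyr, hyd⟩
      using hc.integral_integral_jumpKernel hu hGi hG0 hy hyr)
  have hgU : ContinuousOn (fun ζ => (g ζ : ℂ) * U ζ) (frontier Ω) :=
    (Complex.continuous_ofReal.comp hg.continuous).continuousOn.mul hUf
  have h3 := Γ.integral_tangent_of_support (j := j) (t₀ := t₀) hgU hr.le hr2 fun ζ hζ h0 =>
    hV ζ hζ (hgs (subset_tsupport _ fun h => h0 (by simp [h])))
  have h4 : ∫ t, G t * (2 * Real.pi * Complex.I * U (Γ.curve j t)) =
      2 * Real.pi * Complex.I * ∫ ζ, g ζ * U ζ * Γ.tangent ζ ∂Γ.arcLength := by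
    rw [h3, intervalIntegral.integral_of_le (by linarith), integral_Ioc_eq_integral_Ioo,
      ← integral_const_mul, ← integral_indicator measurableSet_Ioo]
    congr 1; funext t
    by_cases ht : |t - t₀| < r
    · rw [indicator_of_mem, hG1 t ht, hg₁]
      · ring
      · rw [abs_lt] at ht; constructor <;> linarith [ht.1, ht.2]
    · rw [indicator_of_notMem, hG0 t (not_lt.1 ht), zero_mul]
      rintro ⟨h1, h2⟩
      exact ht (abs_lt.2 ⟨by linarith, by linarith⟩)
  have h5 : ∫ ζ, u ζ * Γ.tangent ζ * (2 * Real.pi * Complex.I * g ζ) ∂Γ.arcLength =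
      2 * Real.pi * Complex.I * ∫ ζ, g ζ * u ζ * Γ.tangent ζ ∂Γ.arcLength := by
    rw [← integral_const_mul]
    congr 1; funext ζ; ring
  rw [h4, h5] at hlim
  have h6 := mul_left_cancel₀ (by simp [Real.pi_ne_zero]) hlim
  have i1 : Integrable (fun ζ => g ζ * u ζ * Γ.tangent ζ) Γ.arcLength :=
    (Γ.integrable_mul_continuousOn huT (Complex.continuous_ofReal.comp
      hg.continuous).continuousOn).congr (Eventually.of_forall fun ζ => by simp; ring)
  have i2 : Integrable (fun ζ => g ζ * U ζ * Γ.tangent ζ) Γ.arcLength :=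
    (Γ.integrable_mul_continuousOn hUT (Complex.continuous_ofReal.comp
      hg.continuous).continuousOn).congr (Eventually.of_forall fun ζ => by simp; ring)
  rw [← sub_eq_zero, ← integral_sub i1 i2] at h6
  rw [← h6]
  congr 1; funext ζ
  rw [Complex.real_smul]; ring

/-- An integrable function whose Cauchy integral vanishes outside `Ω` and extends continuously to
the boundary from inside is the boundary value of its Cauchy integral. -/
theorem ae_eq_of_cauchy (hopen : IsOpen Ω) {u U : ℂ → ℂ} (hu : Integrable u Γ.arcLength)
    (hU : ContinuousOn U (closure Ω)) (hin : ∀ z ∈ Ω, Γ.cauchy u z = U z)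
    (hout : ∀ z ∉ closure Ω, Γ.cauchy u z = 0) : u =ᵐ[Γ.arcLength] U := by
  have hloc : ∀ ζ ∈ frontier Ω, ∃ V ∈ 𝓝[frontier Ω] ζ, ∀ᵐ z ∂Γ.arcLength, z ∈ V →
      (u z - U z) * Γ.tangent z = 0 := by
    intro ζ hζ
    rw [Γ.frontier_eq] at hζ
    obtain ⟨j, t₀, rfl⟩ := mem_iUnion.1 hζ
    obtain ⟨δ, hδ⟩ := Γ.exists_isChart hopen j t₀
    have hδ0 := hδ.pos
    set r := min (δ / 3) (1 / 2)
    have hr0 : 0 < r := lt_min (by linarith) (by norm_num)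
    have hr : 3 * r ≤ δ := by linarith [min_le_left (δ / 3) (1 / 2)]
    have hc := hδ.mono (by linarith) hr
    refine ⟨_, mem_nhdsWithin_of_mem_nhds ((hc.isOpen_image Metric.isOpen_ball
      (Metric.ball_subset_ball (by linarith : r ≤ 3 * r))).mem_nhds
      ⟨t₀, Metric.mem_ball_self hr0, collar_ofReal _ _⟩),
      hc.ae_eq_of_cauchy (min_le_right _ _) hu hU hin hout⟩
  choose! V hV hVae using hloc
  obtain ⟨s, hs, hcov⟩ := Γ.isCompact_frontier.elim_nhdsWithin_subcover V hV
  have hall : ∀ᵐ z ∂Γ.arcLength, ∀ ζ ∈ s, z ∈ V ζ → (u z - U z) * Γ.tangent z = 0 :=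
    (Finset.eventually_all s).2 fun ζ hζ => hVae ζ (hs ζ hζ)
  filter_upwards [hall, Γ.ae_mem_frontier] with z hz hzf
  obtain ⟨ζ, hζ, hzV⟩ := mem_iUnion₂.1 (hcov hzf)
  have h0 : Γ.tangent z ≠ 0 := norm_pos_iff.1 (by rw [Γ.norm_tangent hzf]; norm_num)
  exact sub_eq_zero.1 ((mul_eq_zero.1 (hz ζ hζ hzV)).resolve_right h0)

end SmoothBoundary

namespace SmoothBoundary

variable {Ω : Set ℂ} {n : ℕ} {Γ : SmoothBoundary Ω n}

/-! ### Cauchy integrals off the boundary -/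

/-- Along each curve arc length has a positive density with respect to the parameter, so continuous
functions that agree almost everywhere agree. -/
theorem eqOn_frontier_of_ae_eq {f g : ℂ → ℂ} (hf : ContinuousOn f (frontier Ω))
    (hg : ContinuousOn g (frontier Ω)) (h : f =ᵐ[Γ.arcLength] g) : EqOn f g (frontier Ω) := by
  intro z hz
  rw [Γ.frontier_eq] at hz
  obtain ⟨j, t, rfl⟩ := mem_iUnion.1 hz
  have hd : ContinuousOn (fun z => ‖f z - g z‖) (frontier Ω) := (hf.sub hg).norm
  have hz : ∀ᵐ z ∂Γ.arcLength, z ∈ frontier Ω ∩ (fun z => ‖f z - g z‖) ⁻¹' {0} := by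
    filter_upwards [h, Γ.ae_mem_frontier] with z hz hzf
    exact ⟨hzf, by simp [hz]⟩
  have hcl : IsClosed (frontier Ω ∩ (fun z => ‖f z - g z‖) ⁻¹' {0}) :=
    hd.preimage_isClosed_of_isClosed isClosed_frontier isClosed_singleton
  have h1 := (Measure.ae_sum_iff' hcl.measurableSet).1 hz j
  have h2 := (ae_map_iff (Γ.smooth j).continuous.aemeasurable hcl.measurableSet).1 h1
  rw [ae_withDensity_iff (Γ.continuous_deriv j).norm.measurable.ennreal_ofReal] at h2
  have hmem : ∀ t, Γ.curve j t ∈ frontier Ω := Γ.curve_mem j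
  have hc : ∀ f : ℂ → ℂ, ContinuousOn f (frontier Ω) → Continuous fun t => f (Γ.curve j t) :=
    fun f hf => hf.comp_continuous (Γ.smooth j).continuous hmem
  have h3 : (fun t => f (Γ.curve j t)) =ᵐ[volume.restrict (Ico 0 1)]
      fun t => g (Γ.curve j t) := by
    filter_upwards [h2] with t ht
    have := (ht (by simpa using Γ.regular j t)).2
    simpa [sub_eq_zero] using this
  have h4 := Measure.eqOn_Ico_of_ae_eq _ h3 (hc f hf).continuousOn (hc g hg).continuousOn
    (show Int.fract t ∈ Ico (0 : ℝ) 1 from ⟨Int.fract_nonneg _, Int.fract_lt_one _⟩)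
  simpa only [Γ.curve_fract] using h4

theorem hasDerivAt_cauchy {u : ℂ → ℂ} (hu : Integrable u Γ.arcLength) {z : ℂ}
    (hz : z ∉ frontier Ω) :
    HasDerivAt (Γ.cauchy u) ((2 * Real.pi * Complex.I)⁻¹ *
      ∫ ζ, u ζ / (ζ - z) ^ 2 * Γ.tangent ζ ∂Γ.arcLength) z := by
  obtain ⟨d, hd, hball⟩ := Metric.isOpen_iff.1 isClosed_frontier.isOpen_compl z hz
  have hfar : ∀ ζ ∈ frontier Ω, ∀ x ∈ Metric.ball z (d / 2), d / 2 ≤ ‖ζ - x‖ := by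
    intro ζ hζ x hx
    have h1 : d ≤ ‖ζ - z‖ := by
      by_contra h
      exact hball (by rw [Metric.mem_ball, dist_eq_norm]; exact not_le.1 h) hζ
    rw [Metric.mem_ball, dist_eq_norm] at hx
    have := norm_sub_le_norm_sub_add_norm_sub ζ x z
    linarith
  have hnf : ∀ x ∈ Metric.ball z (d / 2), x ∉ frontier Ω := fun x hx hxf =>
    hball (Metric.ball_subset_ball (by linarith) hx) hxf
  have hz' : z ∈ Metric.ball z (d / 2) := Metric.mem_ball_self (half_pos hd)
  have hne : ∀ ζ ∈ frontier Ω, ∀ x ∈ Metric.ball z (d / 2), ζ - x ≠ 0 := fun ζ hζ x hx =>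
    norm_pos_iff.1 ((half_pos hd).trans_le (hfar ζ hζ x hx))
  have hF' : Integrable (fun ζ => u ζ / (ζ - z) ^ 2 * Γ.tangent ζ) Γ.arcLength := by
    have h : ContinuousOn (fun ζ => ((ζ - z) ^ 2)⁻¹ * Γ.tangent ζ) (frontier Ω) :=
      (((continuousOn_id.sub continuousOn_const).pow 2).inv₀
        fun ζ hζ => pow_ne_zero 2 (hne ζ hζ z hz')).mul Γ.continuousOn_tangent
    refine (Γ.integrable_mul_continuousOn hu h).congr (Eventually.of_forall fun ζ => ?_)
    simp only [div_eq_mul_inv]; ring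
  refine (hasDerivAt_integral_of_dominated_loc_of_deriv_le (μ := Γ.arcLength)
    (F := fun x ζ => u ζ / (ζ - x) * Γ.tangent ζ)
    (F' := fun x ζ => u ζ / (ζ - x) ^ 2 * Γ.tangent ζ) (x₀ := z)
    (bound := fun ζ => ‖u ζ‖ * ((d / 2) ^ 2)⁻¹) (Metric.ball_mem_nhds z (half_pos hd))
    ?_ (integrable_div_sub hu hz) hF'.aestronglyMeasurable ?_ (hu.norm.mul_const _) ?_).2.const_mul _
  · filter_upwards [Metric.ball_mem_nhds z (half_pos hd)] with x hx
    exact (integrable_div_sub hu (hnf x hx)).aestronglyMeasurable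
  · filter_upwards [Γ.ae_mem_frontier] with ζ hζ x hx
    rw [norm_mul, Γ.norm_tangent hζ, mul_one, norm_div, norm_pow, div_eq_mul_inv]
    have := hfar ζ hζ x hx
    gcongr
  · filter_upwards [Γ.ae_mem_frontier] with ζ hζ x hx
    have h1 := (((hasDerivAt_id x).const_sub ζ).inv (hne ζ hζ x hx)).const_mul (u ζ)
    have h2 := h1.mul_const (Γ.tangent ζ)
    simp only [id, neg_neg] at h2
    have e : (fun x => u ζ / (ζ - x) * Γ.tangent ζ) = fun x => u ζ * (ζ - x)⁻¹ * Γ.tangent ζ := by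
      simp only [div_eq_mul_inv]
    rw [e]
    exact h2.congr_deriv (by rw [mul_one_div])

/-- The integrand is the derivative of `-1 / (γ - z)`, and the curves are closed. -/
theorem integral_tangent_div_sq (Γ : SmoothBoundary Ω n) {z : ℂ} (hz : z ∉ frontier Ω) :
    ∫ ζ, 1 / (ζ - z) ^ 2 * Γ.tangent ζ ∂Γ.arcLength = 0 := by
  have hne : ∀ ζ ∈ frontier Ω, ζ - z ≠ 0 := fun ζ hζ h => hz (sub_eq_zero.1 h ▸ hζ)
  rw [Γ.integral_tangent (F := fun ζ => 1 / (ζ - z) ^ 2) (continuousOn_const.div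
    ((continuousOn_id.sub continuousOn_const).pow 2) fun ζ hζ => pow_ne_zero 2 (hne ζ hζ))]
  refine Finset.sum_eq_zero fun j _ => ?_
  have hn : ∀ t, Γ.curve j t - z ≠ 0 := fun t => hne _ (Γ.curve_mem j t)
  have hd : ∀ t, HasDerivAt (fun t => -(Γ.curve j t - z)⁻¹)
      (1 / (Γ.curve j t - z) ^ 2 * deriv (Γ.curve j) t) t := fun t => by
    have := (((hasDerivAt_curve (Γ.smooth j) t).sub_const z).inv (hn t)).neg
    exact this.congr_deriv (by rw [neg_div, neg_neg, div_eq_mul_one_div, mul_comm])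
  rw [intervalIntegral.integral_eq_sub_of_hasDerivAt (fun t _ => hd t)]
  · have := Γ.periodic j 0
    rw [zero_add] at this
    rw [this, sub_self]
  · refine Continuous.intervalIntegrable ?_ _ _
    exact (continuous_const.div (((Γ.smooth j).continuous.sub continuous_const).pow 2)
      fun t => pow_ne_zero 2 (hn t)).mul (Γ.continuous_deriv j)

theorem memAInfty_inv_sub {w : ℂ} (hw : w ∉ closure Ω) : MemAInfty Ω fun ζ => 1 / (ζ - w) where
  holo := fun ζ hζ => (((differentiableAt_const _).div (differentiableAt_id.sub_const w)
    fun h => hw (subset_closure (sub_eq_zero.1 h ▸ hζ)))).differentiableWithinAt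
  smooth := by
    have h : ContDiffOn ℝ ∞ (fun ζ => ζ - w) (closure Ω) := contDiffOn_id.sub contDiffOn_const
    simp only [one_div]
    exact h.inv fun ζ hζ h => hw (sub_eq_zero.1 h ▸ hζ)

theorem integral_div_sub_tangent_eq_zero (hopen : IsOpen Ω) (hbdd : Bornology.IsBounded Ω)
    {f : ℂ → ℂ} (hf : MemAInfty Ω f) {w : ℂ} (hw : w ∉ closure Ω) :
    ∫ ζ, f ζ / (ζ - w) * Γ.tangent ζ ∂Γ.arcLength = 0 := by
  have h := memAInfty_inv_sub hw
  have := Γ.integral_mul_tangent_eq_zero hopen hbdd (f := fun ζ => f ζ * (1 / (ζ - w)))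
    (hf.smooth.continuousOn.mul h.smooth.continuousOn) (hf.holo.mul h.holo)
  simpa only [mul_one_div] using this

theorem memAInfty_one : MemAInfty Ω fun _ => 1 := ⟨differentiableOn_const _, contDiffOn_const⟩

theorem cauchy_one_of_notMem_closure (hopen : IsOpen Ω) (hbdd : Bornology.IsBounded Ω) {w : ℂ}
    (hw : w ∉ closure Ω) : Γ.cauchy (fun _ => 1) w = 0 := by
  rw [cauchy, integral_div_sub_tangent_eq_zero hopen hbdd memAInfty_one hw, mul_zero]

theorem frontier_nonempty (hconn : IsConnected Ω) (hbdd : Bornology.IsBounded Ω) :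
    (frontier Ω).Nonempty := by
  rw [nonempty_iff_ne_empty]
  intro h
  rcases frontier_eq_empty_iff.1 h with h | h
  · exact hconn.nonempty.ne_empty h
  · rw [h] at hbdd
    exact NormedSpace.unbounded_univ ℝ ℂ hbdd

/-- The winding number, left unevaluated. It is constant on the connected set `Ω` because its
derivative integrates an exact form. It is not zero, for otherwise the jump formula would give `1 =
0` on a nonempty boundary. Nothing below needs its value. -/
theorem exists_cauchy_one (hopen : IsOpen Ω) (hconn : IsConnected Ω)
    (hbdd : Bornology.IsBounded Ω) (Γ : SmoothBoundary Ω n) :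
    ∃ c : ℂ, c ≠ 0 ∧ ∀ z ∈ Ω, Γ.cauchy (fun _ => 1) z = c := by
  have hi : Integrable (fun _ : ℂ => (1 : ℂ)) Γ.arcLength := integrable_const _
  have hnf : ∀ z ∈ Ω, z ∉ frontier Ω := fun z hz hf =>
    (disjoint_frontier_iff_isOpen.2 hopen).le_bot ⟨hf, hz⟩
  obtain ⟨c, hc⟩ := hopen.exists_is_const_of_deriv_eq_zero hconn.isPreconnected
    (fun z hz => (hasDerivAt_cauchy hi (hnf z hz)).differentiableAt.differentiableWithinAt)
    (fun z hz => by
      rw [(hasDerivAt_cauchy hi (hnf z hz)).deriv, Γ.integral_tangent_div_sq (hnf z hz), mul_zero]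
      rfl)
  refine ⟨c, ?_, hc⟩
  rintro rfl
  obtain ⟨z, hz⟩ := frontier_nonempty hconn hbdd
  have h1 := ae_eq_of_cauchy hopen (U := fun _ => 0) hi continuousOn_const hc
    fun w hw => cauchy_one_of_notMem_closure hopen hbdd hw
  exact one_ne_zero (eqOn_frontier_of_ae_eq continuousOn_const continuousOn_const h1 hz)

/-- Partial fractions. For `z` in the same component as `a` the two terms cancel; for `z` outside
only the one at `a` is left. -/
theorem cauchy_inv_sub {a z : ℂ} (ha : a ∉ frontier Ω) (hz : z ∉ frontier Ω) (hza : z ≠ a) :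
    Γ.cauchy (fun ζ => 1 / (ζ - a)) z =
      (Γ.cauchy (fun _ => 1) z - Γ.cauchy (fun _ => 1) a) / (z - a) := by
  have hi : Integrable (fun _ : ℂ => (1 : ℂ)) Γ.arcLength := integrable_const _
  rw [cauchy, cauchy, cauchy, ← mul_sub, ← integral_sub (integrable_div_sub hi hz)
    (integrable_div_sub hi ha), mul_div_assoc, ← integral_div]
  congr 1
  refine integral_congr_ae (Γ.ae_mem_frontier.mono fun ζ hζ => ?_)
  have h1 : ζ - a ≠ 0 := fun h => ha (sub_eq_zero.1 h ▸ hζ)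
  have h2 : ζ - z ≠ 0 := fun h => hz (sub_eq_zero.1 h ▸ hζ)
  have h3 := sub_ne_zero.2 hza
  simp only
  field_simp
  ring

/-! ### The boundary kernels -/

variable {φ : ℂ → ℝ}

theorem IsWeight.arcLength_absolutelyContinuous (hφ : Γ.IsWeight φ) :
    Γ.arcLength ≪ Γ.weightedArc φ := by
  have hm : AEMeasurable φ Γ.arcLength :=
    (Γ.memLp_arcLength hφ.continuousOn 1).1.aemeasurable
  refine withDensity_absolutelyContinuous' hm.ennreal_ofReal ?_
  filter_upwards [Γ.ae_mem_frontier] with z hz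
  simpa using hφ.pos z hz

theorem IsWeight.continuousOn_inv (hφ : Γ.IsWeight φ) :
    ContinuousOn (fun z => (φ z : ℂ)⁻¹) (frontier Ω) :=
  (Complex.continuous_ofReal.comp_continuousOn hφ.continuousOn).inv₀
      fun z hz => by simpa using (hφ.pos z hz).ne'

theorem IsWeight.integrable (hφ : Γ.IsWeight φ) (u : Γ.L2 φ) : Integrable u Γ.arcLength := by
  have := hφ.isFiniteMeasure
  have hm : AEMeasurable φ Γ.arcLength :=
    (Γ.memLp_arcLength hφ.continuousOn 1).1.aemeasurable
  have h1 : Integrable (fun z => u z) (Γ.arcLength.withDensity fun z => ENNReal.ofReal (φ z)) :=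
    (Lp.memLp u).integrable (by norm_num)
  rw [integrable_withDensity_iff_integrable_smul₀' hm.ennreal_ofReal
    (Eventually.of_forall fun _ => ENNReal.ofReal_lt_top)] at h1
  refine (Γ.integrable_mul_continuousOn h1 hφ.continuousOn_inv).congr ?_
  filter_upwards [Γ.ae_mem_frontier] with z hz
  have hz0 : (φ z : ℂ) ≠ 0 := by simpa using (hφ.pos z hz).ne'
  rw [ENNReal.toReal_ofReal (hφ.pos z hz).le, Complex.real_smul]
  field_simp

/-- Off the boundary the Cauchy kernel is bounded, so evaluation of the Cauchy integral is a
continuous functional on the whole of `L²`. -/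
theorem IsWeight.exists_inner_eq_cauchy (hφ : Γ.IsWeight φ) {w : ℂ} (hw : w ∉ frontier Ω) :
    ∃ k : Γ.L2 φ, ∀ h : Γ.L2 φ, Γ.cauchy h w = inner ℂ k h := by
  have hk := hφ.memLp (hφ.continuousOn_inv.mul (continuousOn_cauchyKernel (Γ := Γ) hw)) 2
  refine ⟨hk.toLp, fun h => ?_⟩
  rw [L2.inner_def, cauchy, ← integral_const_mul]
  have : ∫ z, inner ℂ (hk.toLp _ z) (h z) ∂Γ.weightedArc φ =
      ∫ z, inner ℂ ((φ z : ℂ)⁻¹ * Γ.cauchyKernel w z) (h z) ∂Γ.weightedArc φ :=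
    integral_congr_ae (hk.coeFn_toLp.mono fun z hz => by simp only [hz, Pi.mul_apply])
  rw [this, hφ.integral]
  refine integral_congr_ae (Γ.ae_mem_frontier.mono fun z hz => ?_)
  have hz0 : (φ z : ℂ) ≠ 0 := by simpa using (hφ.pos z hz).ne'
  simp only [RCLike.inner_apply, cauchyKernel, map_mul, map_inv₀, Complex.conj_ofReal,
    Complex.conj_conj]
  field_simp

/-- Cauchy's theorem on the dense subspace, and continuity of the functional on its closure. -/
theorem IsWeight.cauchy_eq_zero_of_mem_hardy (hφ : Γ.IsWeight φ) (hopen : IsOpen Ω)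
    (hbdd : Bornology.IsBounded Ω) {h : Γ.L2 φ} (hh : h ∈ Γ.hardy φ) {w : ℂ}
    (hw : w ∉ closure Ω) : Γ.cauchy h w = 0 := by
  obtain ⟨k, hk⟩ := hφ.exists_inner_eq_cauchy fun h => hw (frontier_subset_closure h)
  rw [hk]
  have hcl : IsClosed {h : Γ.L2 φ | inner ℂ k h = 0} :=
    isClosed_eq (continuous_const.inner continuous_id) continuous_const
  refine closure_minimal (s := (Γ.boundaryAInfty φ : Set (Γ.L2 φ))) ?_ hcl hh
  rintro u ⟨f, hf, huf⟩
  have huf' : ∀ᵐ z ∂Γ.arcLength, u z = f z := hφ.arcLength_absolutelyContinuous.ae_le huf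
  change inner ℂ k u = 0
  rw [← hk, cauchy, integral_congr_ae (g := fun ζ => f ζ / (ζ - w) * Γ.tangent ζ)
    (huf'.mono fun z hz => by simp only [hz]), integral_div_sub_tangent_eq_zero hopen hbdd hf hw,
    mul_zero]

theorem IsWeight.coe_mem_boundaryAInfty (hφ : Γ.IsWeight φ) {f : ℂ → ℂ} (hf : MemAInfty Ω f) :
    ∃ u : Γ.L2 φ, u ∈ Γ.hardy φ ∧ u =ᵐ[Γ.weightedArc φ] f := by
  have hm := hφ.memLp (hf.smooth.continuousOn.mono frontier_subset_closure) 2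
  exact ⟨hm.toLp, subset_closure ⟨f, hf, hm.coeFn_toLp⟩, hm.coeFn_toLp⟩

theorem IsWeight.integrable_garabedianAux (hφ : Γ.IsWeight φ) {a : ℂ} (ha : a ∉ frontier Ω) :
    Integrable (Γ.garabedianAux φ a) Γ.arcLength := by
  have h1 := Γ.integrable_arcLength (continuousOn_cauchyKernel (Γ := Γ) ha)
  have h2 := Γ.integrable_mul_continuousOn (hφ.integrable (Γ.szegoBoundary φ a))
    (Complex.continuous_ofReal.comp_continuousOn hφ.continuousOn)
  have h3 := Γ.integrable_mul_continuousOn (h1.sub h2) Γ.continuousOn_tangent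
  refine (Complex.conjCLE.toContinuousLinearMap.integrable_comp h3).congr
    (Eventually.of_forall fun z => ?_)
  simp only [garabedianAux, Function.comp_apply, Pi.sub_apply]
  simp only [ContinuousLinearEquiv.coe_coe, Complex.conjCLE_apply]
  congr 1; ring

/-- The reproducing property of the Szegő kernel and the Cauchy formula represent the same value at
`a`. Their difference is the pairing with `φ⁻¹ conj (H_a T)`, which is therefore orthogonal to the
Hardy space; undoing the conjugation gives the integral of `H_a f dz`. -/
theorem IsWeight.integral_garabedianAux_mul (hφ : Γ.IsWeight φ) {a : ℂ} (ha : a ∉ frontier Ω)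
    {f : ℂ → ℂ} (hf : MemAInfty Ω f) :
    ∫ ζ, Γ.garabedianAux φ a ζ * f ζ * Γ.tangent ζ ∂Γ.arcLength = 0 := by
  obtain ⟨u, hu, huf⟩ := hφ.coe_mem_boundaryAInfty hf
  have huf' : ∀ᵐ z ∂Γ.arcLength, u z = f z := hφ.arcLength_absolutelyContinuous.ae_le huf
  have h1 := (isSzego_szegoBoundary hφ ha).2 u hu
  have hfc := hf.smooth.continuousOn.mono frontier_subset_closure
  have hfi := Γ.integrable_arcLength hfc
  rw [L2.inner_def, hφ.integral, cauchy, ← integral_const_mul, ← sub_eq_zero,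
    ← integral_sub] at h1
  · rw [← h1]
    refine integral_congr_ae ?_
    filter_upwards [huf', Γ.ae_mem_frontier] with ζ hζ hζf
    have hT : Γ.tangent ζ * conj (Γ.tangent ζ) = 1 := by
      rw [Complex.mul_conj, Complex.normSq_eq_norm_sq, Γ.norm_tangent hζf]; simp
    simp only [garabedianAux, cauchyKernel, hζ, RCLike.inner_apply, map_mul, map_sub,
      Complex.conj_conj, Complex.conj_ofReal]
    linear_combination ((2 * Real.pi * Complex.I)⁻¹ * (Γ.tangent ζ / (ζ - a)) -
      φ ζ * conj (Γ.szegoBoundary φ a ζ)) * f ζ * hT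
  · refine ((integrable_div_sub hfi ha).const_mul (2 * Real.pi * Complex.I)⁻¹).congr (huf'.mono fun ζ hζ => ?_)
    simp only [hζ]
  · have h2 := Complex.conjCLE.toContinuousLinearMap.integrable_comp
      (hφ.integrable (Γ.szegoBoundary φ a))
    refine (Γ.integrable_mul_continuousOn h2 ((Complex.continuous_ofReal.comp_continuousOn
      hφ.continuousOn).mul hfc)).congr (huf'.mono fun ζ hζ => ?_)
    simp only [hζ, RCLike.inner_apply, ContinuousLinearEquiv.coe_coe, Complex.conjCLE_apply,
      Function.comp_apply, Pi.mul_apply]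
    ring

theorem IsWeight.cauchy_garabedianAux (hφ : Γ.IsWeight φ) {a : ℂ} (ha : a ∉ frontier Ω) {w : ℂ}
    (hw : w ∉ closure Ω) : Γ.cauchy (Γ.garabedianAux φ a) w = 0 := by
  have := hφ.integral_garabedianAux_mul ha (memAInfty_inv_sub hw)
  simp only [mul_one_div] at this
  rw [cauchy, this, mul_zero]

end SmoothBoundary

/-! ### Continuous boundary values of the Szegő and Garabedian kernels -/

namespace SmoothBoundary

variable {Ω : Set ℂ} {n : ℕ} {Γ : SmoothBoundary Ω n} {φ : ℂ → ℝ}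

/-- The boundary values of the Garabedian kernel. -/
noncomputable def garabedianBoundary (Γ : SmoothBoundary Ω n) (φ : ℂ → ℝ) (a ζ : ℂ) : ℂ :=
  1 / (2 * Real.pi) * (1 / (ζ - a)) - Complex.I * Γ.garabedianAux φ a ζ

theorem inv_two_pi_I : (2 * Real.pi * Complex.I : ℂ)⁻¹ = -Complex.I * (1 / (2 * Real.pi)) := by
  rw [mul_inv, Complex.inv_I]; ring

/-- The conjugated orthogonal decomposition, multiplied out with `T conj T = 1`. It yields both the
modulus of the quotient on the boundary and the reality of `i S L T`. -/
theorem mul_conj_szegoBoundary {ζ a : ℂ} (hζ : ζ ∈ frontier Ω) :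
    φ ζ * conj (Γ.szegoBoundary φ a ζ) =
      -Complex.I * Γ.tangent ζ * Γ.garabedianBoundary φ a ζ := by
  have hT : Γ.tangent ζ * conj (Γ.tangent ζ) = 1 := by
    rw [Complex.mul_conj, Complex.normSq_eq_norm_sq, Γ.norm_tangent hζ]; simp
  simp only [garabedianBoundary, garabedianAux, cauchyKernel, map_mul, map_sub, Complex.conj_conj,
    Complex.conj_ofReal, inv_two_pi_I, mul_sub, div_eq_mul_inv]
  linear_combination
    (Complex.I * (1 * (2 * Real.pi)⁻¹) * (Γ.tangent ζ * (ζ - a)⁻¹) +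
      φ ζ * conj (Γ.szegoBoundary φ a ζ)) * (Complex.I ^ 2 * hT + Complex.I_sq)

theorem IsWeight.integrable_garabedianBoundary (hφ : Γ.IsWeight φ) {a : ℂ}
    (ha : a ∉ frontier Ω) : Integrable (Γ.garabedianBoundary φ a) Γ.arcLength := by
  have h : ContinuousOn (fun ζ => 1 / (ζ - a)) (frontier Ω) :=
    continuousOn_const.div (continuousOn_id.sub continuousOn_const)
      fun ζ hζ h => ha (sub_eq_zero.1 (show ζ - a = 0 from h) ▸ hζ)
  exact ((Γ.integrable_arcLength h).const_mul _).sub ((hφ.integrable_garabedianAux ha).const_mul _)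

theorem IsWeight.cauchy_garabedianBoundary (hφ : Γ.IsWeight φ) {a z : ℂ} (ha : a ∉ frontier Ω)
    (hz : z ∉ frontier Ω) (hza : z ≠ a) : Γ.cauchy (Γ.garabedianBoundary φ a) z =
      1 / (2 * Real.pi) * ((Γ.cauchy (fun _ => 1) z - Γ.cauchy (fun _ => 1) a) / (z - a)) -
        Complex.I * Γ.cauchy (Γ.garabedianAux φ a) z := by
  have h : ContinuousOn (fun ζ => 1 / (ζ - a)) (frontier Ω) :=
    continuousOn_const.div (continuousOn_id.sub continuousOn_const)
      fun ζ hζ h => ha (sub_eq_zero.1 (show ζ - a = 0 from h) ▸ hζ)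
  have i1 := (integrable_div_sub (Γ.integrable_arcLength h) hz).const_mul
    ((2 * Real.pi * Complex.I)⁻¹ * (1 / (2 * Real.pi)))
  have i2 := (integrable_div_sub (hφ.integrable_garabedianAux ha) hz).const_mul
    ((2 * Real.pi * Complex.I)⁻¹ * Complex.I)
  rw [← cauchy_inv_sub ha hz hza]
  simp only [cauchy]
  rw [← mul_assoc, ← mul_assoc, mul_comm (1 / (2 * Real.pi : ℂ)), mul_comm Complex.I,
    ← integral_const_mul, ← integral_const_mul, ← integral_const_mul, ← integral_sub i1 i2]
  congr 1; funext ζ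
  simp only [garabedianBoundary, sub_div]
  ring

/-- The boundary identity trades the Szegő function for the Garabedian function, and the tangent
factors cancel. The resulting kernel with `conj (ζ - z)` is the one to which the comparison by
reflection applies. -/
theorem IsWeight.conj_cauchy_szegoBoundary (a z : ℂ) (hφ : Γ.IsWeight φ) :
    conj (Γ.cauchy (Γ.szegoBoundary φ a) z) = 1 / (2 * Real.pi) *
      ∫ ζ, Γ.garabedianBoundary φ a ζ * (((φ ζ)⁻¹ : ℝ) / conj (ζ - z)) ∂Γ.arcLength := by
  rw [cauchy, map_mul, ← integral_conj, inv_two_pi_I, ← integral_const_mul, ← integral_const_mul]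
  refine integral_congr_ae (Γ.ae_mem_frontier.mono fun ζ hζ => ?_)
  have hT : Γ.tangent ζ * conj (Γ.tangent ζ) = 1 := by
    rw [Complex.mul_conj, Complex.normSq_eq_norm_sq, Γ.norm_tangent hζ]; simp
  have hz0 : (φ ζ : ℂ) ≠ 0 := by simpa using (hφ.pos ζ hζ).ne'
  have hs : conj (Γ.szegoBoundary φ a ζ) =
      (φ ζ : ℂ)⁻¹ * (-Complex.I * Γ.tangent ζ * Γ.garabedianBoundary φ a ζ) := by
    rw [← mul_conj_szegoBoundary hζ, inv_mul_cancel_left₀ hz0]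
  simp only [map_mul, map_div₀, map_neg, Complex.conj_I, Complex.conj_ofReal, hs, map_one, neg_neg,
    map_ofNat, Complex.ofReal_inv, div_eq_mul_inv, map_inv₀]
  linear_combination (-Complex.I ^ 2 * (1 * (2 * Real.pi : ℂ)⁻¹) * (φ ζ : ℂ)⁻¹ *
    Γ.garabedianBoundary φ a ζ * (conj (ζ - z))⁻¹) * hT - ((1 * (2 * Real.pi : ℂ)⁻¹) *
    (φ ζ : ℂ)⁻¹ * Γ.garabedianBoundary φ a ζ * (conj (ζ - z))⁻¹) * Complex.I_sq

theorem conj_cauchy_garabedianBoundary (a z : ℂ) :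
    conj (Γ.cauchy (Γ.garabedianBoundary φ a) z) = 1 / (2 * Real.pi) *
      ∫ ζ, Γ.szegoBoundary φ a ζ * (φ ζ / conj (ζ - z)) ∂Γ.arcLength := by
  rw [cauchy, map_mul, ← integral_conj, inv_two_pi_I, ← integral_const_mul, ← integral_const_mul]
  refine integral_congr_ae (Γ.ae_mem_frontier.mono fun ζ hζ => ?_)
  have hs := congrArg conj (mul_conj_szegoBoundary (Γ := Γ) (φ := φ) (a := a) hζ)
  simp only [map_mul, map_neg, Complex.conj_conj, Complex.conj_ofReal, Complex.conj_I, neg_neg]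
    at hs
  simp only [map_mul, map_div₀, map_neg, Complex.conj_I, Complex.conj_ofReal, map_one, neg_neg,
    map_ofNat, div_eq_mul_inv, map_inv₀]
  linear_combination (-(1 * (2 * Real.pi : ℂ)⁻¹) * (conj (ζ - z))⁻¹) * hs

theorem IsWeight.exists_tendsto_szego (hφ : Γ.IsWeight φ) (hopen : IsOpen Ω)
    (hconn : IsConnected Ω) (hbdd : Bornology.IsBounded Ω) {a : ℂ} (ha : a ∈ Ω) {z₀ : ℂ}
    (hz₀ : z₀ ∈ frontier Ω) :
    ∃ y, Tendsto (Γ.cauchy (Γ.szegoBoundary φ a)) (𝓝[Ω] z₀) (𝓝 y) := by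
  have hnf : ∀ z ∈ Ω, z ∉ frontier Ω := fun z hz hf =>
    (disjoint_frontier_iff_isOpen.2 hopen).le_bot ⟨hf, hz⟩
  have hz₀' := hz₀
  rw [Γ.frontier_eq] at hz₀'
  obtain ⟨j, t₀, rfl⟩ := mem_iUnion.1 hz₀'
  obtain ⟨c, -, hc⟩ := exists_cauchy_one hopen hconn hbdd Γ
  have hne : Γ.curve j t₀ - a ≠ 0 := fun h => hnf a ha (sub_eq_zero.1 h ▸ hz₀)
  obtain ⟨A, hA⟩ := Γ.exists_tendsto_conj_cauchy hopen j t₀ (b := fun z => (φ z)⁻¹)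
    (fun i => (hφ.smooth i).inv fun t => (hφ.pos _ (Γ.curve_mem i t)).ne')
    (hφ.integrable_garabedianBoundary (hnf a ha))
    -- Outside `closure Ω` the Cauchy integrals of `1` and of `H_a` vanish, so only the pole at `a`
    -- contributes, through the value `c` of the Cauchy integral of `1` in `Ω`.
    (e₀ := 2 * Real.pi * Complex.I * (1 / (2 * Real.pi) * (-c / (Γ.curve j t₀ - a)))) (by
      have hlim : Tendsto (fun w => 2 * Real.pi * Complex.I * (1 / (2 * Real.pi) *
          (-c / (w - a)))) (𝓝[(closure Ω)ᶜ] (Γ.curve j t₀))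
          (𝓝 (2 * Real.pi * Complex.I * (1 / (2 * Real.pi) * (-c / (Γ.curve j t₀ - a))))) := by
        refine Tendsto.const_mul _ (Tendsto.const_mul _ (Tendsto.div tendsto_const_nhds ?_ hne))
        exact ((continuous_id.sub continuous_const).tendsto _).mono_left nhdsWithin_le_nhds
      refine hlim.congr' ?_
      filter_upwards [self_mem_nhdsWithin] with w hw
      have hwf : w ∉ frontier Ω := fun h => hw (frontier_subset_closure h)
      rw [integral_mul_tangent_div_eq_cauchy, hφ.cauchy_garabedianBoundary (hnf a ha) hwf
        (fun h => hw (h ▸ subset_closure ha)), cauchy_one_of_notMem_closure hopen hbdd hw,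
        hc a ha, hφ.cauchy_garabedianAux (hnf a ha) hw]
      ring)
  refine ⟨conj (1 / (2 * Real.pi) * A), ?_⟩
  have := (Complex.continuous_conj.tendsto _).comp (hA.const_mul (1 / (2 * Real.pi : ℂ)))
  refine this.congr fun z => ?_
  rw [Function.comp_apply, ← hφ.conj_cauchy_szegoBoundary, Complex.conj_conj]

theorem IsWeight.exists_tendsto_garabedianAux (hφ : Γ.IsWeight φ) (hopen : IsOpen Ω)
    (hconn : IsConnected Ω) (hbdd : Bornology.IsBounded Ω) {a : ℂ} (ha : a ∈ Ω) {z₀ : ℂ}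
    (hz₀ : z₀ ∈ frontier Ω) :
    ∃ y, Tendsto (Γ.cauchy (Γ.garabedianAux φ a)) (𝓝[Ω] z₀) (𝓝 y) := by
  have hnf : ∀ z ∈ Ω, z ∉ frontier Ω := fun z hz hf =>
    (disjoint_frontier_iff_isOpen.2 hopen).le_bot ⟨hf, hz⟩
  have hz₀' := hz₀
  rw [Γ.frontier_eq] at hz₀'
  obtain ⟨j, t₀, rfl⟩ := mem_iUnion.1 hz₀'
  obtain ⟨c, -, hc⟩ := exists_cauchy_one hopen hconn hbdd Γ
  have hne : Γ.curve j t₀ ≠ a := fun h => hnf a ha (h ▸ hz₀)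
  obtain ⟨A, hA⟩ := Γ.exists_tendsto_conj_cauchy hopen j t₀ hφ.smooth
    (hφ.integrable (Γ.szegoBoundary φ a)) (e₀ := 0) (by
      refine tendsto_const_nhds.congr' ?_
      filter_upwards [self_mem_nhdsWithin] with w hw
      rw [integral_mul_tangent_div_eq_cauchy, hφ.cauchy_eq_zero_of_mem_hardy hopen hbdd
        (isSzego_szegoBoundary hφ (hnf a ha)).1 hw, mul_zero])
  -- Inside `Ω` the polar part of the Garabedian function contributes `(c - c) / (z - a) = 0`. Its
  -- Cauchy integral is therefore `-i` times that of `H_a`, and the factor `i` recovers the latter.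
  refine ⟨Complex.I * conj (1 / (2 * Real.pi) * A), ?_⟩
  have := ((Complex.continuous_conj.tendsto _).comp
    (hA.const_mul (1 / (2 * Real.pi : ℂ)))).const_mul Complex.I
  refine this.congr' ?_
  filter_upwards [self_mem_nhdsWithin, mem_nhdsWithin_of_mem_nhds
    (isOpen_ne.mem_nhds hne)] with z hz hza
  rw [Function.comp_apply, ← conj_cauchy_garabedianBoundary, Complex.conj_conj,
    hφ.cauchy_garabedianBoundary (hnf a ha) (hnf z hz) hza, hc z hz, hc a ha]
  linear_combination (-Γ.cauchy (Γ.garabedianAux φ a) z) * Complex.I_sq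

/-- The value is the squared norm of the Szegő element. If that element were zero, the Cauchy
integral of the constant `1` would vanish at `a`. -/
theorem IsWeight.szego_self_ne_zero (hφ : Γ.IsWeight φ) (hopen : IsOpen Ω)
    (hconn : IsConnected Ω) (hbdd : Bornology.IsBounded Ω) {a : ℂ} (ha : a ∈ Ω) :
    Γ.szego φ a a ≠ 0 := by
  have haf : a ∉ frontier Ω := fun hf => (disjoint_frontier_iff_isOpen.2 hopen).le_bot ⟨hf, ha⟩
  obtain ⟨hs, hrep⟩ := isSzego_szegoBoundary hφ haf
  rw [szego, hrep _ hs, inner_self_ne_zero]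
  intro h0
  obtain ⟨c, hc0, hc⟩ := exists_cauchy_one hopen hconn hbdd Γ
  obtain ⟨u, hu, huf⟩ := hφ.coe_mem_boundaryAInfty memAInfty_one
  have huf' : ∀ᵐ z ∂Γ.arcLength, u z = 1 := hφ.arcLength_absolutelyContinuous.ae_le huf
  have h1 := hrep u hu
  rw [h0, inner_zero_left] at h1
  refine hc0 ?_
  rw [← hc a ha, ← h1, cauchy, cauchy]
  congr 1
  exact integral_congr_ae (huf'.mono fun z hz => by simp only [hz])

/-- A limit at each boundary point suffices: the extension by limits of a continuous function into a
regular space is continuous. The jump formula then recognizes `u` as its boundary function. -/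
theorem exists_continuous_extension (hopen : IsOpen Ω) {u : ℂ → ℂ} (hu : Integrable u Γ.arcLength)
    (hlim : ∀ z ∈ frontier Ω, ∃ y, Tendsto (Γ.cauchy u) (𝓝[Ω] z) (𝓝 y))
    (hout : ∀ z ∉ closure Ω, Γ.cauchy u z = 0) :
    ∃ U : ℂ → ℂ, ContinuousOn U (closure Ω) ∧ DifferentiableOn ℂ U Ω ∧
      (∀ z ∈ Ω, Γ.cauchy u z = U z) ∧ u =ᵐ[Γ.arcLength] U := by
  have hnf : ∀ z ∈ Ω, z ∉ frontier Ω := fun z hz hf =>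
    (disjoint_frontier_iff_isOpen.2 hopen).le_bot ⟨hf, hz⟩
  have hin : ∀ z ∈ Ω, Tendsto (Γ.cauchy u) (𝓝[Ω] z) (𝓝 (Γ.cauchy u z)) := fun z hz =>
    (hasDerivAt_cauchy hu (hnf z hz)).continuousAt.tendsto.mono_left nhdsWithin_le_nhds
  have heq : ∀ z ∈ Ω, Γ.cauchy u z = extendFrom Ω (Γ.cauchy u) z := fun z hz =>
    (extendFrom_eq (subset_closure hz) (hin z hz)).symm
  have hcont : ContinuousOn (extendFrom Ω (Γ.cauchy u)) (closure Ω) := by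
    refine continuousOn_extendFrom Subset.rfl fun z hz => ?_
    rw [closure_eq_self_union_frontier] at hz
    rcases hz with hz | hz
    · exact ⟨_, hin z hz⟩
    · exact hlim z hz
  refine ⟨extendFrom Ω (Γ.cauchy u), hcont, ?_, heq, ae_eq_of_cauchy hopen hu hcont heq hout⟩
  intro z hz
  exact ((hasDerivAt_cauchy hu (hnf z hz)).differentiableAt.differentiableWithinAt).congr
    (fun w hw => (heq w hw).symm) (heq z hz).symm

/-- The Szegő and Garabedian kernels extend continuously to the boundary, where they are
conjugate to each other. -/
theorem IsWeight.exists_kernels (hφ : Γ.IsWeight φ) (hopen : IsOpen Ω) (hconn : IsConnected Ω)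
    (hbdd : Bornology.IsBounded Ω) {a : ℂ} (ha : a ∈ Ω) :
    ∃ S H : ℂ → ℂ, ContinuousOn S (closure Ω) ∧ DifferentiableOn ℂ S Ω ∧
      ContinuousOn H (closure Ω) ∧ DifferentiableOn ℂ H Ω ∧
      (∀ z ∈ Ω, Γ.szego φ z a = S z) ∧
      (∀ z ∈ Ω, Γ.garabedian φ z a = 1 / (2 * Real.pi) * (1 / (z - a)) - Complex.I * H z) ∧
      S a ≠ 0 ∧ ∀ z ∈ frontier Ω, φ z * conj (S z) =
        -Complex.I * Γ.tangent z * (1 / (2 * Real.pi) * (1 / (z - a)) - Complex.I * H z) := by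
  have haf : a ∉ frontier Ω := fun hf => (disjoint_frontier_iff_isOpen.2 hopen).le_bot ⟨hf, ha⟩
  obtain ⟨S, hSc, hSd, hS, hSae⟩ := exists_continuous_extension hopen
    (hφ.integrable (Γ.szegoBoundary φ a))
    (fun z hz => hφ.exists_tendsto_szego hopen hconn hbdd ha hz)
    (fun z hz => hφ.cauchy_eq_zero_of_mem_hardy hopen hbdd (isSzego_szegoBoundary hφ haf).1 hz)
  obtain ⟨H, hHc, hHd, hH, hHae⟩ := exists_continuous_extension hopen
    (hφ.integrable_garabedianAux haf)
    (fun z hz => hφ.exists_tendsto_garabedianAux hopen hconn hbdd ha hz)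
    (fun z hz => hφ.cauchy_garabedianAux haf hz)
  refine ⟨S, H, hSc, hSd, hHc, hHd, hS, fun z hz => by rw [garabedian, hH z hz],
    hS a ha ▸ hφ.szego_self_ne_zero hopen hconn hbdd ha, ?_⟩
  have hsub : frontier Ω ⊆ closure Ω := frontier_subset_closure
  refine eqOn_frontier_of_ae_eq (Γ := Γ) ?_ ?_ ?_
  · exact (Complex.continuous_ofReal.comp_continuousOn hφ.continuousOn).mul
      (Complex.continuous_conj.comp_continuousOn (hSc.mono hsub))
  · refine (continuousOn_const.mul Γ.continuousOn_tangent).mul ((continuousOn_const.mul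
      (continuousOn_const.div (continuousOn_id.sub continuousOn_const) ?_)).sub
      (continuousOn_const.mul (hHc.mono hsub)))
    exact fun ζ hζ h => haf (sub_eq_zero.1 (show ζ - a = 0 from h) ▸ hζ)
  · filter_upwards [hSae, hHae, Γ.ae_mem_frontier] with z hz1 hz2 hzf
    rw [← hz1, ← hz2]
    exact mul_conj_szegoBoundary hzf

end SmoothBoundary

/-! ### An integral equation of the second kind -/

/-- A Lipschitz solution of a Fredholm equation with small kernel. -/
theorem exists_lipschitz_solution {a b B L K : ℝ} (hab : a ≤ b) {κ : ℝ → ℝ → ℝ} {ψ : ℝ → ℝ}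
    (hκc : ∀ x ∈ Icc a b, ContinuousOn (κ x) (Icc a b))
    (hκB : ∀ x ∈ Icc a b, ∀ t ∈ Icc a b, |κ x t| ≤ B)
    (hκL : ∀ x ∈ Icc a b, ∀ x' ∈ Icc a b, ∀ t ∈ Icc a b, |κ x t - κ x' t| ≤ L * |x - x'|)
    (hψ : ∀ x ∈ Icc a b, ∀ x' ∈ Icc a b, |ψ x - ψ x'| ≤ K * |x - x'|)
    (hB0 : 0 ≤ B) (hL0 : 0 ≤ L) (hB : B * (b - a) < 1) :
    ∃ μ : ℝ → ℝ, Continuous μ ∧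
      (∃ C ≥ 0, ∀ x ∈ Icc a b, ∀ x' ∈ Icc a b, |μ x - μ x'| ≤ C * |x - x'|) ∧
      ∀ x ∈ Icc a b, μ x + ∫ t in a..b, κ x t * μ t = ψ x := by
  have hba : 0 ≤ b - a := sub_nonneg.2 hab
  have hsub : Ioc a b ⊆ Icc a b := Ioc_subset_Icc_self
  have hint : ∀ x ∈ Icc a b, ∀ m : ℝ → ℝ, Continuous m →
      IntervalIntegrable (fun t => κ x t * m t) volume a b := fun x hx m hm =>
    ContinuousOn.intervalIntegrable (by
      rw [uIcc_of_le hab]; exact (hκc x hx).mul hm.continuousOn)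
  have hLip : ∀ m : ℝ → ℝ, Continuous m → ∀ M, (∀ t, |m t| ≤ M) → ∀ x ∈ Icc a b,
      ∀ x' ∈ Icc a b, |(ψ x - ∫ t in a..b, κ x t * m t) - (ψ x' - ∫ t in a..b, κ x' t * m t)| ≤
        (K + L * M * (b - a)) * |x - x'| := by
    intro m hm M hM x hx x' hx'
    have h1 : (ψ x - ∫ t in a..b, κ x t * m t) - (ψ x' - ∫ t in a..b, κ x' t * m t) =
        (ψ x - ψ x') - ∫ t in a..b, (κ x t * m t - κ x' t * m t) := by
      rw [intervalIntegral.integral_sub (hint x hx m hm) (hint x' hx' m hm)]; ring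
    have h2 : ‖∫ t in a..b, (κ x t * m t - κ x' t * m t)‖ ≤ L * |x - x'| * M * |b - a| := by
      refine intervalIntegral.norm_integral_le_of_norm_le_const fun t ht => ?_
      rw [uIoc_of_le hab] at ht
      rw [← sub_mul, Real.norm_eq_abs, abs_mul]
      exact mul_le_mul (hκL x hx x' hx' t (hsub ht)) (hM t) (abs_nonneg _) (by positivity)
    rw [abs_of_nonneg hba, Real.norm_eq_abs] at h2
    rw [h1]
    calc _ ≤ |ψ x - ψ x'| + |∫ t in a..b, (κ x t * m t - κ x' t * m t)| := abs_sub _ _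
      _ ≤ K * |x - x'| + L * |x - x'| * M * (b - a) := add_le_add (hψ x hx x' hx') h2
      _ = _ := by ring
  have hext : ∀ m : C(Icc a b, ℝ), ∀ t, |ContinuousMap.IccExtend hab m t| ≤ ‖m‖ := fun m t =>
    m.norm_coe_le_norm _
  have hTc : ∀ m : C(Icc a b, ℝ), Continuous fun x : Icc a b =>
      ψ x - ∫ t in a..b, κ x t * ContinuousMap.IccExtend hab m t := by
    intro m
    have := hLip _ (ContinuousMap.IccExtend hab m).continuous ‖m‖ (hext m)
    refine (LipschitzWith.of_dist_le_mul (K := (K + L * ‖m‖ * (b - a)).toNNReal)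
      fun x y => ?_).continuous
    rw [Real.dist_eq]
    refine (this x x.2 y y.2).trans ?_
    rw [Subtype.dist_eq, Real.dist_eq]
    exact mul_le_mul_of_nonneg_right (Real.le_coe_toNNReal _) (abs_nonneg _)
  -- The map `m ↦ ψ - ∫ κ m` contracts the sup norm by the factor `B (b - a)`. Its fixed point
  -- inherits a Lipschitz bound, since each integral operator value depends on `x` only through `ψ`
  -- and `κ`.
  let T : C(Icc a b, ℝ) → C(Icc a b, ℝ) := fun m => ⟨_, hTc m⟩
  have hT : ContractingWith (B * (b - a)).toNNReal T := by
    refine ⟨by rw [← NNReal.coe_lt_coe, Real.coe_toNNReal _ (by positivity)]; exact_mod_cast hB,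
      LipschitzWith.of_dist_le_mul fun m m' => ?_⟩
    rw [Real.coe_toNNReal _ (by positivity), ContinuousMap.dist_le (by positivity)]
    intro x
    have hm := (ContinuousMap.IccExtend hab m).continuous
    have hm' := (ContinuousMap.IccExtend hab m').continuous
    have h1 : T m x - T m' x = -∫ t in a..b, (κ x t * ContinuousMap.IccExtend hab m t -
        κ x t * ContinuousMap.IccExtend hab m' t) := by
      rw [intervalIntegral.integral_sub (hint x x.2 _ hm) (hint x x.2 _ hm')]
      simp only [T, ContinuousMap.coe_mk]; ring
    rw [Real.dist_eq, h1, abs_neg, ← Real.norm_eq_abs]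
    have h2 := intervalIntegral.norm_integral_le_of_norm_le_const (a := a) (b := b)
      (C := B * dist m m') (f := fun t => κ x t * ContinuousMap.IccExtend hab m t -
        κ x t * ContinuousMap.IccExtend hab m' t) fun t ht => by
      rw [uIoc_of_le hab] at ht
      rw [← mul_sub, Real.norm_eq_abs, abs_mul]
      exact mul_le_mul (hκB x x.2 t (hsub ht)) (by
          rw [← Real.dist_eq]
          exact ContinuousMap.dist_apply_le_dist (f := m) (g := m') (projIcc a b hab t))
        (abs_nonneg _) hB0
    rw [abs_of_nonneg hba] at h2
    linarith
  have : Nonempty (Icc a b) := ⟨⟨a, left_mem_Icc.2 hab⟩⟩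
  set m := ContractingWith.fixedPoint T hT
  have hfix : T m = m := hT.fixedPoint_isFixedPt
  set μ := ContinuousMap.IccExtend hab m
  have hμ : ∀ x ∈ Icc a b, μ x = ψ x - ∫ t in a..b, κ x t * μ t := by
    intro x hx
    have h1 : μ x = m ⟨x, hx⟩ := Set.IccExtend_of_mem hab m hx
    rw [h1, ← hfix]; rfl
  refine ⟨μ, μ.continuous, ⟨max 0 (K + L * ‖m‖ * (b - a)), le_max_left _ _, fun x hx x' hx' => ?_⟩,
    fun x hx => by rw [hμ x hx]; ring⟩
  rw [hμ x hx, hμ x' hx']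
  exact (hLip μ μ.continuous ‖m‖ (hext m) x hx x' hx').trans
    (mul_le_mul_of_nonneg_right (le_max_right _ _) (abs_nonneg _))

/-! ### The Cauchy integral of a Lipschitz density on a segment -/

theorem sub_ne_zero_of_im_pos {w : ℂ} (hw : 0 < w.im) (t : ℝ) : (t : ℂ) - w ≠ 0 := fun h => by
  have := congrArg Complex.im h
  simp at this
  linarith

/-- For `w` in the upper half plane `t - w` stays in the lower half plane, where the principal
logarithm is holomorphic. -/
theorem integral_inv_sub {a b : ℝ} {w : ℂ} (hw : 0 < w.im) :
    ∫ t in a..b, ((t : ℂ) - w)⁻¹ = Complex.log (b - w) - Complex.log (a - w) := by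
  have hd : ∀ t : ℝ, HasDerivAt (fun t : ℝ => Complex.log (t - w)) ((t - w : ℂ)⁻¹) t := fun t => by
    have h1 : HasDerivAt (fun t : ℝ => (t : ℂ) - w) 1 t := by
      simpa using (Complex.ofRealCLM.hasDerivAt (x := t)).sub_const w
    simpa using h1.clog_real (Or.inr (by simp; linarith))
  rw [intervalIntegral.integral_eq_sub_of_hasDerivAt fun t _ => hd t]
  refine Continuous.intervalIntegrable ?_ _ _
  exact (Complex.continuous_ofReal.sub continuous_const).inv₀ fun t => sub_ne_zero_of_im_pos hw t

/-- As `w` descends to `x`, the number `a - w` approaches the negative axis from below, so its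
argument tends to `-π`. This is the source of the jump term. -/
theorem tendsto_integral_inv_sub {a b x : ℝ} (hx : x ∈ Ioo a b) :
    Tendsto (fun w : ℂ => ∫ t in a..b, ((t : ℂ) - w)⁻¹) (𝓝[{w | 0 < w.im}] (x : ℂ))
      (𝓝 (Real.log (b - x) - (Real.log (x - a) - Real.pi * Complex.I))) := by
  have h1 : Tendsto (fun w : ℂ => Complex.log (b - w)) (𝓝[{w | 0 < w.im}] (x : ℂ))
      (𝓝 (Real.log (b - x))) := by
    rw [Complex.ofReal_log (by linarith [hx.2])]
    have : ContinuousAt (fun w : ℂ => Complex.log (b - w)) x :=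
      (continuousAt_const.sub continuousAt_id).clog (Or.inl (by simpa using hx.2))
    rw [Complex.ofReal_sub]
    exact this.tendsto.mono_left nhdsWithin_le_nhds
  have h2 : Tendsto (fun w : ℂ => Complex.log (a - w)) (𝓝[{w | 0 < w.im}] (x : ℂ))
      (𝓝 (Real.log (x - a) - Real.pi * Complex.I)) := by
    have h := Complex.tendsto_log_nhdsWithin_im_neg_of_re_neg_of_im_zero (z := (a - x : ℂ))
      (by simpa using hx.1) (by simp)
    have hn : ‖(a - x : ℂ)‖ = x - a := by
      rw [← Complex.ofReal_sub, Complex.norm_real, Real.norm_eq_abs, abs_sub_comm,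
        abs_of_pos (by linarith [hx.1])]
    rw [hn] at h
    refine h.comp (tendsto_nhdsWithin_iff.2 ⟨?_, ?_⟩)
    · exact ((continuous_const.sub continuous_id).tendsto _).mono_left nhdsWithin_le_nhds
    · filter_upwards [self_mem_nhdsWithin] with w hw
      simpa using hw
  refine (h1.sub h2).congr' ?_
  filter_upwards [self_mem_nhdsWithin] with w hw using (integral_inv_sub hw).symm

/-- Boundary values from above of a Cauchy integral over a segment. -/
theorem exists_tendsto_integral_div_sub {a b C x : ℝ} {μ : ℝ → ℝ} (hμ : Continuous μ)
    (hL : ∀ x ∈ Icc a b, ∀ x' ∈ Icc a b, |μ x - μ x'| ≤ C * |x - x'|) (hx : x ∈ Ioo a b) :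
    ∃ y : ℂ, Tendsto (fun w : ℂ => ∫ t in a..b, (μ t : ℂ) * ((t : ℂ) - w)⁻¹)
      (𝓝[{w | 0 < w.im}] (x : ℂ)) (𝓝 y) ∧ y.im = Real.pi * μ x := by
  have hab : a ≤ b := (hx.1.trans hx.2).le
  have hre : Tendsto (fun w : ℂ => w.re) (𝓝[{w | 0 < w.im}] (x : ℂ)) (𝓝 x) :=
    (Complex.continuous_re.tendsto (x : ℂ)).mono_left nhdsWithin_le_nhds
  have hmem : ∀ᶠ w : ℂ in 𝓝[{w | 0 < w.im}] (x : ℂ), w.re ∈ Icc a b :=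
    hre.eventually (Icc_mem_nhds hx.1 hx.2)
  have hid : Tendsto (fun w : ℂ => w) (𝓝[{w | 0 < w.im}] (x : ℂ)) (𝓝 (x : ℂ)) := nhdsWithin_le_nhds
  have hC : 0 ≤ C := by
    have := (abs_nonneg _).trans (hL a (left_mem_Icc.2 hab) b (right_mem_Icc.2 hab))
    have h2 : 0 < |a - b| := abs_pos.2 (by linarith [hx.1, hx.2])
    exact nonneg_of_mul_nonneg_left this h2
  have hc : ∀ w : ℂ, 0 < w.im → Continuous fun t : ℝ => ((t : ℂ) - w)⁻¹ := fun w hw =>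
    (Complex.continuous_ofReal.sub continuous_const).inv₀ fun t => sub_ne_zero_of_im_pos hw t
  -- Subtracting `μ (Re w)` makes the integrand bounded by the Lipschitz constant, because `|t - Re
  -- w| ≤ ‖t - w‖`. The limit is real, so the imaginary part comes from the subtracted term alone.
  have h1 : Tendsto (fun w : ℂ => ∫ t in a..b, ((μ t - μ w.re : ℝ) : ℂ) * ((t : ℂ) - w)⁻¹)
      (𝓝[{w | 0 < w.im}] (x : ℂ))
      (𝓝 (∫ t in a..b, (((μ t - μ x) * (t - x)⁻¹ : ℝ) : ℂ))) := by
    refine intervalIntegral.tendsto_integral_filter_of_dominated_convergence (fun _ => C) ?_ ?_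
      intervalIntegrable_const ?_
    · filter_upwards [self_mem_nhdsWithin] with w hw
      exact ((Complex.continuous_ofReal.comp (hμ.sub continuous_const)).mul
        (hc w hw)).aestronglyMeasurable
    · filter_upwards [self_mem_nhdsWithin, hmem] with w hw hwm
      refine Eventually.of_forall fun t ht => ?_
      rw [uIoc_of_le hab] at ht
      rw [norm_mul, norm_inv, Complex.norm_real, Real.norm_eq_abs, ← div_eq_mul_inv,
        div_le_iff₀ (norm_pos_iff.2 (sub_ne_zero_of_im_pos hw t))]
      refine (hL t (Ioc_subset_Icc_self ht) _ hwm).trans (mul_le_mul_of_nonneg_left ?_ hC)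
      simpa using Complex.abs_re_le_norm ((t : ℂ) - w)
    · have hne : ∀ᵐ t : ℝ, t ≠ x := by simp [ae_iff, measure_singleton]
      filter_upwards [hne] with t ht _
      have hne' : (t : ℂ) - x ≠ 0 := by
        rw [sub_ne_zero]; exact_mod_cast ht
      rw [Complex.ofReal_mul, Complex.ofReal_inv, Complex.ofReal_sub t x]
      refine Tendsto.mul ?_ ((tendsto_const_nhds.sub hid).inv₀ hne')
      exact (Complex.continuous_ofReal.tendsto _).comp
        (tendsto_const_nhds.sub ((hμ.tendsto x).comp hre))
  have h2 := (((Complex.continuous_ofReal.tendsto _).comp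
    ((hμ.tendsto x).comp hre))).mul (tendsto_integral_inv_sub hx)
  refine ⟨_, (h1.add h2).congr' ?_, ?_⟩
  · filter_upwards [self_mem_nhdsWithin] with w hw
    have i1 := hc w hw
    simp only [Function.comp_apply]
    rw [← intervalIntegral.integral_const_mul, ← intervalIntegral.integral_add]
    · refine intervalIntegral.integral_congr fun t _ => ?_
      push_cast; ring
    · exact ((Complex.continuous_ofReal.comp (hμ.sub continuous_const)).mul
        i1).intervalIntegrable _ _
    · exact (continuous_const.mul i1).intervalIntegrable _ _
  · rw [intervalIntegral.integral_ofReal]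
    simp [mul_comm]

/-! ### Chord slopes of a smooth curve -/

/-- The mean value `∫₀¹ γ'(x + θ(t - x)) dθ`, equal to `(γ t - γ x) / (t - x)` for `t ≠ x`. -/
noncomputable def chordSlope (γ : ℝ → ℂ) (x t : ℝ) : ℂ :=
  ∫ θ in (0 : ℝ)..1, deriv γ (x + θ * (t - x))

/-- The weighted mean value `∫₀¹ θ γ''(x + θ(t - x)) dθ`. -/
noncomputable def chordSlopeRemainder (γ : ℝ → ℂ) (x t : ℝ) : ℂ :=
  ∫ θ in (0 : ℝ)..1, θ * deriv (deriv γ) (x + θ * (t - x))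

section chord

variable {γ : ℝ → ℂ}

theorem continuous_chordSlope (hγ : ContDiff ℝ ∞ γ) (x : ℝ) : Continuous (chordSlope γ x) := by
  refine intervalIntegral.continuous_parametric_intervalIntegral_of_continuous'
    (f := fun t θ => deriv γ (x + θ * (t - x))) ?_ 0 1
  exact (contDiff_deriv_curve hγ).continuous.comp (by fun_prop)

theorem continuous_chordSlopeRemainder (hγ : ContDiff ℝ ∞ γ) (x : ℝ) :
    Continuous (chordSlopeRemainder γ x) := by
  refine intervalIntegral.continuous_parametric_intervalIntegral_of_continuous'
    (f := fun t θ => (θ : ℂ) * deriv (deriv γ) (x + θ * (t - x))) ?_ 0 1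
  exact (Complex.continuous_ofReal.comp continuous_snd).mul
    ((contDiff_deriv_curve (contDiff_deriv_curve hγ)).continuous.comp (by fun_prop))

theorem hasDerivAt_segment (hγ : ContDiff ℝ ∞ γ) (x t θ : ℝ) :
    HasDerivAt (fun θ : ℝ => γ (x + θ * (t - x))) ((t - x : ℝ) * deriv γ (x + θ * (t - x))) θ := by
  have h1 : HasDerivAt (fun θ : ℝ => x + θ * (t - x)) (t - x) θ := by
    simpa using ((hasDerivAt_id θ).mul_const (t - x)).const_add x
  have := (hasDerivAt_curve hγ (x + θ * (t - x))).scomp θ h1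
  simpa [Function.comp_def] using this

theorem sub_mul_chordSlope (hγ : ContDiff ℝ ∞ γ) (x t : ℝ) :
    (t - x : ℝ) * chordSlope γ x t = γ t - γ x := by
  rw [chordSlope, ← intervalIntegral.integral_const_mul,
    intervalIntegral.integral_eq_sub_of_hasDerivAt fun θ _ => hasDerivAt_segment hγ x t θ]
  · simp
  · refine Continuous.intervalIntegrable ?_ _ _
    exact continuous_const.mul ((contDiff_deriv_curve hγ).continuous.comp (by fun_prop))

/-- Integration by parts in `θ`. With `γ t - γ x = (t - x) h` and `γ'(t) = h + (t - x) k`, the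
kernel `γ'(t) / (γ t - γ x)` is `1 / (t - x) + k / h`, which isolates its regular part. -/
theorem chordSlope_add (hγ : ContDiff ℝ ∞ γ) (x t : ℝ) :
    chordSlope γ x t + (t - x : ℝ) * chordSlopeRemainder γ x t = deriv γ t := by
  have hγ' := contDiff_deriv_curve hγ
  have c1 : Continuous fun θ : ℝ => deriv γ (x + θ * (t - x)) := hγ'.continuous.comp (by fun_prop)
  have c2 : Continuous fun θ : ℝ => (θ : ℂ) * ((t - x : ℝ) * deriv (deriv γ) (x + θ * (t - x))) :=
    Complex.continuous_ofReal.mul (continuous_const.mul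
      ((contDiff_deriv_curve hγ').continuous.comp (by fun_prop)))
  have hd : ∀ θ : ℝ, HasDerivAt (fun θ : ℝ => (θ : ℂ) * deriv γ (x + θ * (t - x)))
      (deriv γ (x + θ * (t - x)) +
        (θ : ℂ) * ((t - x : ℝ) * deriv (deriv γ) (x + θ * (t - x)))) θ := fun θ => by
    have := (Complex.ofRealCLM.hasDerivAt (x := θ)).mul (hasDerivAt_segment hγ' x t θ)
    exact this.congr_deriv (by simp)
  have h := intervalIntegral.integral_eq_sub_of_hasDerivAt (a := 0) (b := 1) (fun θ _ => hd θ)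
    ((c1.add c2).intervalIntegrable _ _)
  rw [intervalIntegral.integral_add (c1.intervalIntegrable _ _) (c2.intervalIntegrable _ _)] at h
  rw [chordSlope, chordSlopeRemainder, ← intervalIntegral.integral_const_mul]
  simp only [mul_left_comm (((t - x : ℝ) : ℂ))]
  rw [h]
  simp

theorem abs_segment_sub_lt {t₀ δ x t θ : ℝ} (hx : |x - t₀| < δ) (ht : |t - t₀| < δ)
    (hθ : θ ∈ uIoc (0 : ℝ) 1) : |x + θ * (t - x) - t₀| < δ := by
  rw [uIoc_of_le zero_le_one] at hθ
  have : x + θ * (t - x) - t₀ = (1 - θ) * (x - t₀) + θ * (t - t₀) := by ring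
  rw [this]
  refine (abs_add_le _ _).trans_lt ?_
  rw [abs_mul, abs_mul, abs_of_nonneg (sub_nonneg.2 hθ.2), abs_of_pos hθ.1]
  have h1 := mul_le_mul_of_nonneg_left hx.le (sub_nonneg.2 hθ.2)
  have h2 := mul_lt_mul_of_pos_left ht hθ.1
  linarith

/-- The regular part of the kernel `γ'(t) / (γ t - γ x)` near a regular point. -/
theorem exists_regular_part (hγ : ContDiff ℝ ∞ γ) (t₀ : ℝ) (hd : deriv γ t₀ ≠ 0) :
    ∃ B ≥ 0, ∃ L ≥ 0, ∃ δ > 0, ∃ κ : ℝ → ℝ → ℂ,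
      (∀ x t, |x - t₀| < δ → |t - t₀| < δ → ‖κ x t‖ ≤ B) ∧
      (∀ x x' t, |x - t₀| < δ → |x' - t₀| < δ → |t - t₀| < δ →
        ‖κ x t - κ x' t‖ ≤ L * |x - x'|) ∧
      (∀ x, |x - t₀| < δ → ContinuousOn (κ x) {t | |t - t₀| < δ}) ∧
      ∀ x t, |x - t₀| < δ → |t - t₀| < δ → t ≠ x →
        deriv γ t / (γ t - γ x) - ((t : ℂ) - x)⁻¹ = κ x t := by
  have hγ' := contDiff_deriv_curve hγ
  have hγ'' := contDiff_deriv_curve hγ'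
  obtain ⟨K1, hK1, δ1, hδ1, hL1⟩ := exists_lipschitz_near hγ' t₀
  obtain ⟨K2, hK2, δ2, hδ2, hL2⟩ := exists_lipschitz_near hγ'' t₀
  set m := ‖deriv γ t₀‖ / 2 with hm
  have hm0 : 0 < m := half_pos (norm_pos_iff.2 hd)
  -- The last entry keeps `γ'` within half its size at `t₀`, so the averages `chordSlope` stay away
  -- from zero.
  set δ := min (min δ1 δ2) (m / (K1 + 1)) with hδdef
  have hδ : 0 < δ := lt_min (lt_min hδ1 hδ2) (by positivity)
  have d1 : ∀ {s}, |s - t₀| < δ → |s - t₀| < δ1 := fun h =>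
    h.trans_le ((min_le_left _ _).trans (min_le_left _ _))
  have d2 : ∀ {s}, |s - t₀| < δ → |s - t₀| < δ2 := fun h =>
    h.trans_le ((min_le_left _ _).trans (min_le_right _ _))
  have hnear : ∀ s, |s - t₀| < δ → ‖deriv γ s - deriv γ t₀‖ ≤ m := fun s hs => by
    refine (hL1 s t₀ (d1 hs) (by simpa using hδ1)).trans ?_
    have : |s - t₀| ≤ m / (K1 + 1) := hs.le.trans (min_le_right _ _)
    rw [le_div_iff₀ (by positivity)] at this
    nlinarith [abs_nonneg (s - t₀)]
  set M := ‖deriv (deriv γ) t₀‖ + K2 * δ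
  have hM0 : 0 ≤ M := by positivity
  have hsec : ∀ s, |s - t₀| < δ → ‖deriv (deriv γ) s‖ ≤ M := fun s hs => by
    have h1 := hL2 s t₀ (d2 hs) (by simpa using hδ2)
    have h2 := norm_le_norm_add_norm_sub' (deriv (deriv γ) s) (deriv (deriv γ) t₀)
    have h3 := mul_le_mul_of_nonneg_left hs.le hK2
    linarith
  have c1 : ∀ x t, Continuous fun θ : ℝ => deriv γ (x + θ * (t - x)) := fun x t =>
    hγ'.continuous.comp (by fun_prop)
  have c2 : ∀ x t, Continuous fun θ : ℝ => (θ : ℂ) * deriv (deriv γ) (x + θ * (t - x)) :=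
    fun x t => Complex.continuous_ofReal.mul (hγ''.continuous.comp (by fun_prop))
  have hh : ∀ x t, |x - t₀| < δ → |t - t₀| < δ → m ≤ ‖chordSlope γ x t‖ := by
    intro x t hx ht
    have h1 : chordSlope γ x t - deriv γ t₀ =
        ∫ θ in (0 : ℝ)..1, (deriv γ (x + θ * (t - x)) - deriv γ t₀) := by
      rw [intervalIntegral.integral_sub ((c1 x t).intervalIntegrable _ _)
        intervalIntegrable_const]
      simp [chordSlope]
    have h2 := intervalIntegral.norm_integral_le_of_norm_le_const (a := (0 : ℝ)) (b := 1) (C := m)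
      (f := fun θ => deriv γ (x + θ * (t - x)) - deriv γ t₀)
      fun θ hθ => hnear _ (abs_segment_sub_lt hx ht hθ)
    rw [← h1] at h2
    have h3 := norm_sub_norm_le (deriv γ t₀) (chordSlope γ x t)
    rw [norm_sub_rev] at h3
    simp at h2
    linarith
  have hk : ∀ x t, |x - t₀| < δ → |t - t₀| < δ → ‖chordSlopeRemainder γ x t‖ ≤ M := by
    intro x t hx ht
    have h2 := intervalIntegral.norm_integral_le_of_norm_le_const (a := (0 : ℝ)) (b := 1) (C := M)
      (f := fun θ => (θ : ℂ) * deriv (deriv γ) (x + θ * (t - x))) fun θ hθ => by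
      have := hsec _ (abs_segment_sub_lt hx ht hθ)
      rw [uIoc_of_le zero_le_one] at hθ
      rw [norm_mul, Complex.norm_real, Real.norm_of_nonneg hθ.1.le]
      exact (mul_le_of_le_one_left (norm_nonneg _) hθ.2).trans this
    simpa [chordSlopeRemainder] using h2
  have hseg : ∀ x x' t θ : ℝ, θ ∈ uIoc (0 : ℝ) 1 →
      |x + θ * (t - x) - (x' + θ * (t - x'))| ≤ |x - x'| := by
    intro x x' t θ hθ
    rw [uIoc_of_le zero_le_one] at hθ
    rw [show x + θ * (t - x) - (x' + θ * (t - x')) = (1 - θ) * (x - x') by ring, abs_mul,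
      abs_of_nonneg (sub_nonneg.2 hθ.2)]
    exact mul_le_of_le_one_left (abs_nonneg _) (by linarith [hθ.1])
  have hhL : ∀ x x' t, |x - t₀| < δ → |x' - t₀| < δ → |t - t₀| < δ →
      ‖chordSlope γ x t - chordSlope γ x' t‖ ≤ K1 * |x - x'| := by
    intro x x' t hx hx' ht
    rw [chordSlope, chordSlope, ← intervalIntegral.integral_sub ((c1 x t).intervalIntegrable _ _)
      ((c1 x' t).intervalIntegrable _ _)]
    refine (intervalIntegral.norm_integral_le_of_norm_le_const (C := K1 * |x - x'|)
      fun θ hθ => ?_).trans (by simp)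
    exact (hL1 _ _ (d1 (abs_segment_sub_lt hx ht hθ)) (d1 (abs_segment_sub_lt hx' ht hθ))).trans
      (mul_le_mul_of_nonneg_left (hseg x x' t θ hθ) hK1)
  have hkL : ∀ x x' t, |x - t₀| < δ → |x' - t₀| < δ → |t - t₀| < δ →
      ‖chordSlopeRemainder γ x t - chordSlopeRemainder γ x' t‖ ≤ K2 * |x - x'| := by
    intro x x' t hx hx' ht
    rw [chordSlopeRemainder, chordSlopeRemainder,
      ← intervalIntegral.integral_sub ((c2 x t).intervalIntegrable _ _)
      ((c2 x' t).intervalIntegrable _ _)]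
    refine (intervalIntegral.norm_integral_le_of_norm_le_const (C := K2 * |x - x'|)
      fun θ hθ => ?_).trans (by simp)
    have h1 := (hL2 _ _ (d2 (abs_segment_sub_lt hx ht hθ))
      (d2 (abs_segment_sub_lt hx' ht hθ))).trans
      (mul_le_mul_of_nonneg_left (hseg x x' t θ hθ) hK2)
    rw [uIoc_of_le zero_le_one] at hθ
    rw [← mul_sub, norm_mul, Complex.norm_real, Real.norm_of_nonneg hθ.1.le]
    exact (mul_le_of_le_one_left (norm_nonneg _) hθ.2).trans h1
  have hne : ∀ x t, |x - t₀| < δ → |t - t₀| < δ → chordSlope γ x t ≠ 0 := fun x t hx ht =>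
    norm_pos_iff.1 (hm0.trans_le (hh x t hx ht))
  refine ⟨M / m, by positivity, K2 / m + M * K1 / (m * m), by positivity, δ, hδ,
    fun x t => chordSlopeRemainder γ x t / chordSlope γ x t, ?_, ?_, ?_, ?_⟩
  · intro x t hx ht
    rw [norm_div]
    exact div_le_div₀ hM0 (hk x t hx ht) hm0 (hh x t hx ht)
  · intro x x' t hx hx' ht
    have n1 := hne x t hx ht
    have n2 := hne x' t hx' ht
    have e : chordSlopeRemainder γ x t / chordSlope γ x t -
        chordSlopeRemainder γ x' t / chordSlope γ x' t =
        (chordSlopeRemainder γ x t - chordSlopeRemainder γ x' t) / chordSlope γ x t -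
        chordSlopeRemainder γ x' t * (chordSlope γ x t - chordSlope γ x' t) /
          (chordSlope γ x t * chordSlope γ x' t) := by
      field_simp
      ring
    simp only
    rw [e]
    refine (norm_sub_le _ _).trans ?_
    rw [norm_div, norm_div, norm_mul, norm_mul]
    have h1 := hkL x x' t hx hx' ht
    have h2 := hhL x x' t hx hx' ht
    have h3 := hh x t hx ht
    have h4 := hh x' t hx' ht
    have h5 := hk x' t hx' ht
    calc _ ≤ K2 * |x - x'| / m + M * (K1 * |x - x'|) / (m * m) := by gcongr
      _ = _ := by ring
  · intro x hx
    exact (continuous_chordSlopeRemainder hγ x).continuousOn.div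
      (continuous_chordSlope hγ x).continuousOn fun t ht => hne x t hx ht
  · intro x t hx ht htx
    have n1 := hne x t hx ht
    have n2 : ((t - x : ℝ) : ℂ) ≠ 0 := by exact_mod_cast sub_ne_zero.2 htx
    rw [← sub_mul_chordSlope hγ, ← chordSlope_add hγ x t, ← Complex.ofReal_sub]
    field_simp
    ring

end chord

/-! ### Prescribing the argument of a holomorphic function on an arc -/

section density

variable {γ : ℝ → ℂ}

theorem differentiableOn_arc_integral (hγ : ContDiff ℝ ∞ γ) {μ : ℝ → ℝ} (hμ : Continuous μ)
    {a b : ℝ} (hab : a ≤ b) :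
    DifferentiableOn ℂ (fun z => ∫ t in a..b, (μ t : ℂ) * (deriv γ t / (γ t - z)))
      (γ '' Icc a b)ᶜ := by
  have hcomp : IsCompact (γ '' Icc a b) := isCompact_Icc.image hγ.continuous
  intro z hz
  obtain ⟨d, hd, hball⟩ := Metric.isOpen_iff.1 hcomp.isClosed.isOpen_compl z hz
  have hfar : ∀ t ∈ Icc a b, ∀ x ∈ Metric.ball z (d / 2), d / 2 ≤ ‖γ t - x‖ := by
    intro t ht x hx
    have h1 : d ≤ ‖γ t - z‖ := by
      by_contra h
      exact hball (by rw [Metric.mem_ball, dist_eq_norm]; exact not_le.1 h) ⟨t, ht, rfl⟩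
    rw [Metric.mem_ball, dist_eq_norm] at hx
    have := norm_sub_le_norm_sub_add_norm_sub (γ t) x z
    linarith
  have hne : ∀ t ∈ Icc a b, ∀ x ∈ Metric.ball z (d / 2), γ t - x ≠ 0 := fun t ht x hx =>
    norm_pos_iff.1 ((half_pos hd).trans_le (hfar t ht x hx))
  have hd' := (contDiff_deriv_curve hγ).continuous
  have hcont : ∀ x ∈ Metric.ball z (d / 2),
      ContinuousOn (fun t => (μ t : ℂ) * (deriv γ t / (γ t - x))) (uIcc a b) := fun x hx => by
    rw [uIcc_of_le hab]
    exact (Complex.continuous_ofReal.comp hμ).continuousOn.mul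
      (hd'.continuousOn.div (hγ.continuous.sub continuous_const).continuousOn
        fun t ht => hne t ht x hx)
  have hz' : z ∈ Metric.ball z (d / 2) := Metric.mem_ball_self (half_pos hd)
  have hm : ∀ {f : ℝ → ℂ}, ContinuousOn f (uIcc a b) →
      AEStronglyMeasurable f (volume.restrict (uIoc a b)) := fun hf =>
    (hf.intervalIntegrable (μ := volume)).def'.aestronglyMeasurable
  have hbc : ContinuousOn (fun t => ‖(μ t : ℂ) * deriv γ t‖ * ((d / 2) ^ 2)⁻¹) (uIcc a b) :=
    ((((Complex.continuous_ofReal.comp hμ).mul hd').norm).mul continuous_const).continuousOn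
  refine (intervalIntegral.hasDerivAt_integral_of_dominated_loc_of_deriv_le (μ := volume)
    (F := fun x t => (μ t : ℂ) * (deriv γ t / (γ t - x)))
    (F' := fun x t => (μ t : ℂ) * (deriv γ t / (γ t - x) ^ 2)) (x₀ := z)
    (bound := fun t => ‖(μ t : ℂ) * deriv γ t‖ * ((d / 2) ^ 2)⁻¹)
    (Metric.ball_mem_nhds z (half_pos hd)) ?_ (hcont z hz').intervalIntegrable ?_ ?_
    hbc.intervalIntegrable ?_).2.differentiableAt.differentiableWithinAt
  · filter_upwards [Metric.ball_mem_nhds z (half_pos hd)] with x hx using hm (hcont x hx)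
  · refine hm ?_
    rw [uIcc_of_le hab]
    exact (Complex.continuous_ofReal.comp hμ).continuousOn.mul
      (hd'.continuousOn.div ((hγ.continuous.sub continuous_const).pow 2).continuousOn
        fun t ht => pow_ne_zero 2 (hne t ht z hz'))
  · refine Eventually.of_forall fun t ht x hx => ?_
    rw [uIoc_of_le hab] at ht
    have := hfar t (Ioc_subset_Icc_self ht) x hx
    rw [← mul_div_assoc, norm_div, norm_pow, div_eq_mul_inv]
    gcongr
  · refine Eventually.of_forall fun t ht x hx => ?_
    rw [uIoc_of_le hab] at ht
    have h1 := (((hasDerivAt_id x).const_sub (γ t)).inv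
      (hne t (Ioc_subset_Icc_self ht) x hx)).const_mul ((μ t : ℂ) * deriv γ t)
    simp only [id, neg_neg] at h1
    have e : (fun x => (μ t : ℂ) * (deriv γ t / (γ t - x))) =
        fun x => (μ t : ℂ) * deriv γ t * (γ t - x)⁻¹ := by
      funext x; rw [div_eq_mul_inv, mul_assoc]
    rw [e]
    exact h1.congr_deriv (by rw [mul_assoc, mul_one_div])

/-- Up to second order in `t - w`, `collar γ w` is the tangent line at `t` evaluated at the complex
parameter `w`. So the singular part is that of the straight segment, uniformly up to the axis. -/
theorem exists_bound_cauchy_kernel_sub (hγ : ContDiff ℝ ∞ γ) (t₀ : ℝ) (hd : deriv γ t₀ ≠ 0) :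
    ∃ C, ∃ δ > 0, ∀ t : ℝ, |t - t₀| < δ → ∀ w ∈ Metric.ball (t₀ : ℂ) δ, (t : ℂ) ≠ w →
      γ t - collar γ w ≠ 0 ∧ ‖deriv γ t / (γ t - collar γ w) - ((t : ℂ) - w)⁻¹‖ ≤ C := by
  obtain ⟨δ1, hδ1, happ⟩ := exists_collar_approx hγ t₀ (half_pos (norm_pos_iff.2 hd))
  obtain ⟨K, hK, δ2, hδ2, hT⟩ := exists_taylor_near hγ t₀
  obtain ⟨K', hK', δ3, hδ3, hL⟩ := exists_lipschitz_near (contDiff_deriv_curve hγ) t₀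
  set m := ‖deriv γ t₀‖ / 2 with hm
  have hm0 : 0 < m := half_pos (norm_pos_iff.2 hd)
  refine ⟨(K + K') / m, min δ1 (min δ2 δ3), lt_min hδ1 (lt_min hδ2 hδ3),
    fun t ht w hw htw => ?_⟩
  have ht2 := ht.trans_le ((min_le_right _ _).trans (min_le_left δ2 δ3))
  have ht3 := ht.trans_le ((min_le_right _ _).trans (min_le_right δ2 δ3))
  have htb : (t : ℂ) ∈ Metric.ball (t₀ : ℂ) δ1 := by
    rw [Metric.mem_ball, dist_eq_norm, ← Complex.ofReal_sub, Complex.norm_real, Real.norm_eq_abs]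
    exact ht.trans_le (min_le_left _ _)
  have hre : |w.re - t₀| < min δ1 (min δ2 δ3) := by
    rw [Metric.mem_ball, dist_eq_norm] at hw
    refine lt_of_le_of_lt ?_ hw
    simpa using Complex.abs_re_le_norm (w - t₀)
  have hw2 := hre.trans_le ((min_le_right _ _).trans (min_le_left δ2 δ3))
  have hw3 := hre.trans_le ((min_le_right _ _).trans (min_le_right δ2 δ3))
  have hn : 0 < ‖(t : ℂ) - w‖ := norm_pos_iff.2 (sub_ne_zero.2 htw)
  have hlow : m * ‖(t : ℂ) - w‖ ≤ ‖γ t - collar γ w‖ := by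
    have h1 := happ t htb w (Metric.ball_subset_ball (min_le_left _ _) hw)
    rw [collar_ofReal] at h1
    have h2 := norm_sub_norm_le (deriv γ t₀ * ((t : ℂ) - w)) (γ t - collar γ w)
    rw [norm_sub_rev (deriv γ t₀ * ((t : ℂ) - w)), norm_mul] at h2
    have : ‖deriv γ t₀‖ = 2 * m := by rw [hm]; ring
    rw [this] at h2
    linarith
  have hpos : 0 < ‖γ t - collar γ w‖ := (mul_pos hm0 hn).trans_le hlow
  refine ⟨norm_pos_iff.1 hpos, ?_⟩
  have hnum : ‖deriv γ t * ((t : ℂ) - w) - (γ t - collar γ w)‖ ≤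
      (K + K') * ‖(t : ℂ) - w‖ ^ 2 := by
    have e : deriv γ t * ((t : ℂ) - w) - (γ t - collar γ w) =
        (γ w.re - γ t - deriv γ t * (w.re - t : ℝ)) -
          Complex.I * w.im * (deriv γ t - deriv γ w.re) := by
      rw [collar, Complex.ofReal_sub]
      linear_combination deriv γ t * Complex.re_add_im w
    have hx : |w.re - t| ≤ ‖(t : ℂ) - w‖ := by
      have := Complex.abs_re_le_norm ((t : ℂ) - w)
      rw [abs_sub_comm]; simpa using this
    have hy : |w.im| ≤ ‖(t : ℂ) - w‖ := by
      simpa using Complex.abs_im_le_norm ((t : ℂ) - w)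
    rw [e]
    refine (norm_sub_le _ _).trans ?_
    rw [norm_mul, norm_mul, Complex.norm_I, one_mul, Complex.norm_real, Real.norm_eq_abs]
    have h1 := hT w.re t hw2 ht2
    have h2 := hL t w.re ht3 hw3
    rw [abs_sub_comm] at h2
    calc _ ≤ K * ‖(t : ℂ) - w‖ ^ 2 + ‖(t : ℂ) - w‖ * (K' * ‖(t : ℂ) - w‖) := by
          gcongr
          · exact h1.trans (by gcongr)
          · exact h2.trans (by gcongr)
      _ = _ := by ring
  have e : deriv γ t / (γ t - collar γ w) - ((t : ℂ) - w)⁻¹ =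
      (deriv γ t * ((t : ℂ) - w) - (γ t - collar γ w)) /
        ((γ t - collar γ w) * ((t : ℂ) - w)) := by
    have h1 := norm_pos_iff.1 hpos
    have h2 := sub_ne_zero.2 htw
    field_simp
  rw [e, norm_div, norm_mul, div_le_div_iff₀ (by positivity) hm0]
  calc _ ≤ (K + K') * ‖(t : ℂ) - w‖ ^ 2 * m := by gcongr
    _ = (K + K') * (m * ‖(t : ℂ) - w‖ * ‖(t : ℂ) - w‖) := by ring
    _ ≤ _ := by gcongr

/-- Take `g(z) = (π i)⁻¹ ∫ μ γ' / (γ - z) dt` with real `μ`. The segment part of the kernel gives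
the boundary real part `μ`, and the regular part adds the integral operator with kernel `Im κ / π`,
so prescribing `Re g = ψ` is a Fredholm equation of the second kind. -/
theorem exists_density (hγ : ContDiff ℝ ∞ γ) (t₀ : ℝ) (hd : deriv γ t₀ ≠ 0) {ψ : ℝ → ℝ}
    (hψ : ContDiffAt ℝ 1 ψ t₀) :
    ∃ g : ℂ → ℂ, ∃ R > 0, DifferentiableOn ℂ g (γ '' Icc (t₀ - R) (t₀ + R))ᶜ ∧
      ∀ x : ℝ, |x - t₀| < R → ∃ y, Tendsto (fun w => g (collar γ w))
        (𝓝[{w | 0 < w.im}] (x : ℂ)) (𝓝 y) ∧ y.re = ψ x := by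
  obtain ⟨B, hB, L, hL, δ1, hδ1, κ, hκB, hκL, hκc, hκ⟩ := exists_regular_part hγ t₀ hd
  obtain ⟨C, δ2, hδ2, hC⟩ := exists_bound_cauchy_kernel_sub hγ t₀ hd
  obtain ⟨Kψ, s, hs, hLψ⟩ := hψ.exists_lipschitzOnWith
  obtain ⟨δ3, hδ3, hsub⟩ := Metric.mem_nhds_iff.1 hs
  have hπ := Real.pi_pos
  have hπ1 : 1 < Real.pi := by linarith [Real.pi_gt_three]
  -- The last entry makes `B` times the length `2 R` less than `1`, as the contraction requires.
  -- Division by `π > 1` preserves the bound `B`.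
  set R := min (min (δ1 / 2) (δ2 / 2)) (min (δ3 / 2) (1 / (2 * (B + 1)))) with hR
  have hR0 : 0 < R := by positivity
  have r1 : R < δ1 := by
    have : R ≤ δ1 / 2 := (min_le_left _ _).trans (min_le_left _ _)
    linarith
  have r2 : R < δ2 := by
    have : R ≤ δ2 / 2 := (min_le_left _ _).trans (min_le_right _ _)
    linarith
  have r3 : R < δ3 := by
    have : R ≤ δ3 / 2 := (min_le_right _ _).trans (min_le_left _ _)
    linarith
  have r4 : B * (2 * R) < 1 := by
    have : R ≤ 1 / (2 * (B + 1)) := (min_le_right _ _).trans (min_le_right _ _)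
    rw [le_div_iff₀ (by positivity)] at this
    nlinarith
  set a := t₀ - R with ha
  set b := t₀ + R with hb
  have hab : a ≤ b := by linarith
  have hI : ∀ {x}, x ∈ Icc a b → |x - t₀| ≤ R := fun hx =>
    abs_le.2 ⟨by linarith [hx.1], by linarith [hx.2]⟩
  have him : ∀ z : ℂ, |z.im / Real.pi| ≤ ‖z‖ := fun z => by
    rw [abs_div, abs_of_pos hπ, div_le_iff₀ hπ]
    have := Complex.abs_im_le_norm z
    nlinarith [norm_nonneg z]
  obtain ⟨μ, hμc, ⟨Cμ, -, hμL⟩, hμ⟩ := exists_lipschitz_solution (a := a) (b := b) (B := B)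
    (L := L) (K := Kψ) (κ := fun x t => (κ x t).im / Real.pi) (ψ := ψ) hab
    (fun x hx => (Complex.continuous_im.comp_continuousOn ((hκc x ((hI hx).trans_lt r1)).mono
      fun t ht => (hI ht).trans_lt r1)).div_const _)
    (fun x hx t ht => (him _).trans (hκB x t ((hI hx).trans_lt r1) ((hI ht).trans_lt r1)))
    (fun x hx x' hx' t ht => by
      rw [← sub_div, ← Complex.sub_im]
      exact (him _).trans (hκL x x' t ((hI hx).trans_lt r1) ((hI hx').trans_lt r1)
        ((hI ht).trans_lt r1)))
    (fun x hx x' hx' => by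
      have := hLψ.dist_le_mul x (hsub (by simpa [Real.dist_eq] using (hI hx).trans_lt r3)) x'
        (hsub (by simpa [Real.dist_eq] using (hI hx').trans_lt r3))
      simpa [Real.dist_eq] using this)
    hB hL (by rw [show b - a = 2 * R by rw [ha, hb]; ring]; exact r4)
  refine ⟨fun z => (Real.pi * Complex.I)⁻¹ * ∫ t in a..b, (μ t : ℂ) * (deriv γ t / (γ t - z)),
    R, hR0, (differentiableOn_arc_integral hγ hμc hab).const_mul _, fun x hx => ?_⟩
  have hx' : x ∈ Ioo a b := by
    rw [abs_lt] at hx; constructor <;> linarith [hx.1, hx.2]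
  obtain ⟨y, hy, hyim⟩ := exists_tendsto_integral_div_sub hμc hμL hx'
  have hball : ∀ᶠ w : ℂ in 𝓝[{w | 0 < w.im}] (x : ℂ), w ∈ Metric.ball (t₀ : ℂ) δ2 := by
    refine mem_nhdsWithin_of_mem_nhds (Metric.isOpen_ball.mem_nhds ?_)
    rw [Metric.mem_ball, dist_eq_norm, ← Complex.ofReal_sub, Complex.norm_real, Real.norm_eq_abs]
    exact hx.trans r2
  have hid : Tendsto (fun w : ℂ => w) (𝓝[{w | 0 < w.im}] (x : ℂ)) (𝓝 (x : ℂ)) := nhdsWithin_le_nhds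
  have hcΦ : Tendsto (collar γ) (𝓝[{w | 0 < w.im}] (x : ℂ)) (𝓝 (γ x)) := by
    have := ((continuous_collar hγ).tendsto (x : ℂ)).mono_left
      (nhdsWithin_le_nhds (s := {w | 0 < w.im}))
    rwa [collar_ofReal] at this
  have hcont1 : ∀ w : ℂ, 0 < w.im → Continuous fun t : ℝ => ((t : ℂ) - w)⁻¹ := fun w hw =>
    (Complex.continuous_ofReal.sub continuous_const).inv₀ fun t => sub_ne_zero_of_im_pos hw t
  have hcont2 : ∀ w : ℂ, 0 < w.im → w ∈ Metric.ball (t₀ : ℂ) δ2 →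
      ContinuousOn (fun t => deriv γ t / (γ t - collar γ w)) (Icc a b) := fun w hw hwb =>
    (contDiff_deriv_curve hγ).continuous.continuousOn.div
      (hγ.continuous.sub continuous_const).continuousOn
      fun t ht => (hC t ((hI ht).trans_lt r2) w hwb
        (sub_ne_zero.1 (sub_ne_zero_of_im_pos hw t))).1
  have hμc' : Continuous fun t => (μ t : ℂ) := Complex.continuous_ofReal.comp hμc
  have i1 : ∀ w : ℂ, 0 < w.im → w ∈ Metric.ball (t₀ : ℂ) δ2 → IntervalIntegrable
      (fun t => (μ t : ℂ) * (deriv γ t / (γ t - collar γ w) - ((t : ℂ) - w)⁻¹)) volume a b :=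
    fun w hw hwb => ContinuousOn.intervalIntegrable (by
      rw [uIcc_of_le hab]
      exact hμc'.continuousOn.mul ((hcont2 w hw hwb).sub (hcont1 w hw).continuousOn))
  have h1 : Tendsto (fun w : ℂ => ∫ t in a..b, (μ t : ℂ) *
      (deriv γ t / (γ t - collar γ w) - ((t : ℂ) - w)⁻¹)) (𝓝[{w | 0 < w.im}] (x : ℂ))
      (𝓝 (∫ t in a..b, (μ t : ℂ) * κ x t)) := by
    refine intervalIntegral.tendsto_integral_filter_of_dominated_convergence
      (fun t => ‖(μ t : ℂ)‖ * C) ?_ ?_ ((hμc'.norm.mul continuous_const).intervalIntegrable _ _) ?_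
    · filter_upwards [self_mem_nhdsWithin, hball] with w hw hwb
      exact (i1 w hw hwb).def'.aestronglyMeasurable
    · filter_upwards [self_mem_nhdsWithin, hball] with w hw hwb
      refine Eventually.of_forall fun t ht => ?_
      rw [uIoc_of_le hab] at ht
      rw [norm_mul]
      exact mul_le_mul_of_nonneg_left (hC t ((hI (Ioc_subset_Icc_self ht)).trans_lt r2) w hwb
        (sub_ne_zero.1 (sub_ne_zero_of_im_pos hw t))).2 (norm_nonneg _)
    · have hne : ∀ᵐ t : ℝ, t ≠ x := by simp [ae_iff, measure_singleton]
      filter_upwards [hne] with t ht htI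
      rw [uIoc_of_le hab] at htI
      have htI' := hI (Ioc_subset_Icc_self htI)
      have n1 : (t : ℂ) - x ≠ 0 := by
        rw [sub_ne_zero]; exact_mod_cast ht
      have n2 : γ t - γ x ≠ 0 := by
        have := (hC t (htI'.trans_lt r2) (x : ℂ) (by
          rw [Metric.mem_ball, dist_eq_norm, ← Complex.ofReal_sub, Complex.norm_real,
            Real.norm_eq_abs]
          exact hx.trans r2) (sub_ne_zero.1 n1)).1
        rwa [collar_ofReal] at this
      rw [← hκ x t (hx.trans r1) (htI'.trans_lt r1) ht]
      exact ((tendsto_const_nhds.div (tendsto_const_nhds.sub hcΦ) n2).sub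
        ((tendsto_const_nhds.sub hid).inv₀ n1)).const_mul _
  refine ⟨(Real.pi * Complex.I)⁻¹ * ((∫ t in a..b, (μ t : ℂ) * κ x t) + y),
    ((h1.add hy).const_mul _).congr' ?_, ?_⟩
  · filter_upwards [self_mem_nhdsWithin, hball] with w hw hwb
    have i2 : IntervalIntegrable (fun t => (μ t : ℂ) * ((t : ℂ) - w)⁻¹) volume a b :=
      (hμc'.mul (hcont1 w hw)).intervalIntegrable _ _
    rw [← intervalIntegral.integral_add (i1 w hw hwb) i2]
    congr 1
    refine intervalIntegral.integral_congr fun t _ => ?_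
    ring
  · have hxI : x ∈ Icc a b := Ioo_subset_Icc_self hx'
    have hκi : IntervalIntegrable (fun t => (μ t : ℂ) * κ x t) volume a b :=
      ContinuousOn.intervalIntegrable (by
        rw [uIcc_of_le hab]
        exact hμc'.continuousOn.mul ((hκc x (hx.trans r1)).mono
          fun t ht => (hI ht).trans_lt r1))
    have e1 : (∫ t in a..b, (μ t : ℂ) * κ x t).im = ∫ t in a..b, μ t * (κ x t).im := by
      have := Complex.imCLM.intervalIntegral_comp_comm hκi
      simp only [Complex.imCLM_apply, Complex.im_ofReal_mul] at this
      exact this.symm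
    have e2 : ∀ z : ℂ, ((Real.pi * Complex.I)⁻¹ * z).re = z.im / Real.pi := fun z => by
      rw [mul_inv, Complex.inv_I, ← Complex.ofReal_inv, mul_assoc, Complex.re_ofReal_mul]
      simp [div_eq_inv_mul]
    rw [e2, Complex.add_im, e1, hyim, ← hμ x hxI, add_div, mul_div_cancel_left₀ _ hπ.ne',
      add_comm, ← intervalIntegral.integral_div]
    congr 1
    refine intervalIntegral.integral_congr fun t _ => ?_
    ring

end density

/-! ### Straightening the boundary -/

namespace SmoothBoundary

variable {Ω : Set ℂ} {n : ℕ} {Γ : SmoothBoundary Ω n}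

/-- Near a boundary point there is a nonvanishing holomorphic function whose boundary values are
positive multiples of the conjugate tangent. -/
theorem exists_conj_tangent_direction (hopen : IsOpen Ω) (j : Fin n) (t₀ : ℝ) :
    ∃ f : ℂ → ℂ, ∃ ρ > 0, ContinuousOn f (closure Ω ∩ Metric.ball (Γ.curve j t₀) ρ) ∧
      DifferentiableOn ℂ f Ω ∧ (∀ z ∈ closure Ω ∩ Metric.ball (Γ.curve j t₀) ρ, f z ≠ 0) ∧
      ∀ z ∈ frontier Ω ∩ Metric.ball (Γ.curve j t₀) ρ, ∃ r : ℝ, 0 < r ∧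
        f z * Γ.tangent z = r := by
  have hγ := Γ.smooth j
  have hd := Γ.regular j t₀
  obtain ⟨δ, hc⟩ := Γ.exists_isChart hopen j t₀
  set γ := Γ.curve j with hγdef
  -- The target is minus the argument of `γ'` relative to its value at `t₀`. With `Re g` equal to
  -- it, `exp (i g)` cancels the rotation of the tangent. The quotient is near `1`, where the
  -- principal logarithm is smooth.
  have hψ : ContDiffAt ℝ 1 (fun x => -(Complex.log (deriv γ x / deriv γ t₀)).im) t₀ := by
    have h1 : ContDiffAt ℝ 1 (fun x => deriv γ x / deriv γ t₀) t₀ :=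
      (((contDiff_deriv_curve hγ).of_le (by simp)).contDiffAt).div_const _
    have h2 : ContDiffAt ℝ 1 Complex.log (deriv γ t₀ / deriv γ t₀) :=
      (Complex.contDiffAt_log (by rw [div_self hd]; simp)).restrict_scalars ℝ
    exact (Complex.imCLM.contDiff.contDiffAt.comp t₀
      (ContDiffAt.comp (g := Complex.log) t₀ h2 h1)).neg
  obtain ⟨g, R, hR, hgd, hg⟩ := exists_density hγ t₀ hd hψ
  obtain ⟨ρ, hρ, hnear⟩ := Γ.frontier_near j t₀ (ε := min R δ) (lt_min hR hc.pos)
  have hgΩ : DifferentiableOn ℂ g Ω := hgd.mono fun z hz => by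
    rintro ⟨t, -, rfl⟩
    exact (disjoint_frontier_iff_isOpen.2 hopen).le_bot ⟨Γ.curve_mem j t, hz⟩
  set f₀ : ℂ → ℂ := fun z => Complex.exp (Complex.I * g z) / deriv γ t₀ with hf₀
  have hf₀d : DifferentiableOn ℂ f₀ Ω := ((hgΩ.const_mul _).cexp).div_const _
  have hin : ∀ z ∈ Ω, Tendsto f₀ (𝓝[Ω] z) (𝓝 (f₀ z)) := fun z hz =>
    (hf₀d z hz).continuousWithinAt.tendsto
  have hbd : ∀ z ∈ frontier Ω, ‖z - γ t₀‖ < ρ → ∃ y, y ≠ 0 ∧ Tendsto f₀ (𝓝[Ω] z) (𝓝 y) ∧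
      ∃ r : ℝ, 0 < r ∧ y * Γ.tangent z = r := by
    intro z hz hzρ
    obtain ⟨x, hx, rfl⟩ := hnear z hz hzρ
    obtain ⟨y, hy, hyre⟩ := hg x (hx.trans_le (min_le_left _ _))
    have hxb : (x : ℂ) ∈ Metric.ball (t₀ : ℂ) δ := by
      rw [Metric.mem_ball, dist_eq_norm, ← Complex.ofReal_sub, Complex.norm_real, Real.norm_eq_abs]
      exact hx.trans_le (min_le_right _ _)
    have hlim : Tendsto g (𝓝[Ω] (γ x)) (𝓝 y) := by
      rw [← hc.map_nhdsWithin hxb]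
      exact tendsto_map'_iff.2 hy
    refine ⟨Complex.exp (Complex.I * y) / deriv γ t₀, div_ne_zero (Complex.exp_ne_zero _) hd,
      ((Complex.continuous_exp.tendsto _).comp (hlim.const_mul _)).div_const _, ?_⟩
    have hdx := Γ.regular j x
    have hq : deriv γ x / deriv γ t₀ ≠ 0 := div_ne_zero hdx hd
    refine ⟨Real.exp (Complex.I * y + Complex.log (deriv γ x / deriv γ t₀)).re / ‖deriv γ x‖,
      div_pos (Real.exp_pos _) (norm_pos_iff.2 hdx), ?_⟩
    -- The exponent of `f₀ γ'` has vanishing imaginary part, so this product is a positive number.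
    have him : (Complex.I * y + Complex.log (deriv γ x / deriv γ t₀)).im = 0 := by
      simp only [Complex.add_im, Complex.I_mul_im, hyre]
      ring
    have hexp : ((Real.exp (Complex.I * y + Complex.log (deriv γ x / deriv γ t₀)).re : ℝ) : ℂ) =
        Complex.exp (Complex.I * y) * (deriv γ x / deriv γ t₀) := by
      rw [Complex.ofReal_exp, ← Complex.exp_log hq, ← Complex.exp_add, Complex.exp_log hq]
      congr 1
      exact Complex.ext rfl (by rw [him, Complex.ofReal_im])
    rw [Γ.tangent_curve, Complex.ofReal_div, hexp]
    ring
  have hex : ∀ z ∈ closure Ω ∩ Metric.ball (γ t₀) ρ, ∃ y, y ≠ 0 ∧ Tendsto f₀ (𝓝[Ω] z) (𝓝 y) := by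
    rintro z ⟨hz, hzb⟩
    rw [closure_eq_self_union_frontier] at hz
    rcases hz with hz | hz
    · exact ⟨f₀ z, div_ne_zero (Complex.exp_ne_zero _) hd, hin z hz⟩
    · rw [Metric.mem_ball, dist_eq_norm] at hzb
      obtain ⟨y, hy0, hy, -⟩ := hbd z hz hzb
      exact ⟨y, hy0, hy⟩
  refine ⟨extendFrom Ω f₀, ρ, hρ, continuousOn_extendFrom inter_subset_left fun z hz => ?_,
    fun z hz => ?_, fun z hz => ?_, fun z hz => ?_⟩
  · obtain ⟨y, -, hy⟩ := hex z hz
    exact ⟨y, hy⟩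
  · exact (hf₀d z hz).congr (fun w hw => extendFrom_eq (subset_closure hw) (hin w hw))
      (extendFrom_eq (subset_closure hz) (hin z hz))
  · obtain ⟨y, hy0, hy⟩ := hex z hz
    rwa [extendFrom_eq hz.1 hy]
  · obtain ⟨y, -, hy, hr⟩ := hbd z hz.1 (by rw [← dist_eq_norm]; exact hz.2)
    rwa [extendFrom_eq (frontier_subset_closure hz.1) hy]

end SmoothBoundary

/-! ### Primitives in a collar and local uniformization -/

namespace SmoothBoundary

variable {Ω : Set ℂ} {n : ℕ} {Γ : SmoothBoundary Ω n}

theorem convex_upper_ball (t₀ s : ℝ) :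
    Convex ℝ (Metric.ball (t₀ : ℂ) s ∩ {w | 0 < w.im}) :=
  (convex_ball _ _).inter (convex_halfSpace_im_gt 0)

theorem IsChart.mem_closure {j : Fin n} {t₀ δ : ℝ} (hc : Γ.IsChart j t₀ δ) {w : ℂ}
    (hw : w ∈ Metric.ball (t₀ : ℂ) δ) (him : 0 ≤ w.im) : collar (Γ.curve j) w ∈ closure Ω := by
  rcases him.lt_or_eq with h | h
  · exact subset_closure ((hc.mem_iff w hw).2 h)
  · exact frontier_subset_closure ((hc.frontier_iff w hw).2 h.symm)

/-- In a collar, the form `f dz` has a primitive close to a real dilation, if `f` has boundary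
values that are positive multiples of the conjugate tangent. -/
theorem IsChart.exists_primitive {j : Fin n} {t₀ δ ρ : ℝ} (hc : Γ.IsChart j t₀ δ)
    (hρ : 0 < ρ) (hopen : IsOpen Ω) {f : ℂ → ℂ}
    (hfc : ContinuousOn f (closure Ω ∩ Metric.ball (Γ.curve j t₀) ρ))
    (hfd : DifferentiableOn ℂ f Ω)
    (hfT : ∀ z ∈ frontier Ω ∩ Metric.ball (Γ.curve j t₀) ρ, ∃ r : ℝ, 0 < r ∧
        f z * Γ.tangent z = r) :
    ∃ A : ℝ, 0 < A ∧ ∃ s : ℝ, 0 < s ∧ s ≤ δ ∧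
      (∀ w ∈ Metric.ball (t₀ : ℂ) s, collar (Γ.curve j) w ∈ Metric.ball (Γ.curve j t₀) ρ) ∧
      ∃ E : ℂ → ℂ, Continuous E ∧ E t₀ = 0 ∧
      (∀ w ∈ Metric.ball (t₀ : ℂ) s, ∀ w' ∈ Metric.ball (t₀ : ℂ) s, 0 ≤ w.im → 0 ≤ w'.im →
        ‖E w - E w' - A * (w - w')‖ ≤ A / 2 * ‖w - w'‖) ∧
      (∀ w ∈ Metric.ball (t₀ : ℂ) s, 0 < w.im → HasFDerivAt E
        (f (collar (Γ.curve j) w) • collarDeriv (Γ.curve j) w) w) ∧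
      ∀ x : ℝ, |x - t₀| < s → (E x).im = 0 := by
  have hγ := Γ.smooth j
  set γ := Γ.curve j with hγdef
  have hreal : ∀ x : ℝ, ∀ z ∈ frontier Ω ∩ Metric.ball (γ t₀) ρ, z = γ x →
      ∃ r : ℝ, 0 < r ∧ f z * deriv γ x = r := by
    rintro x z hz rfl
    obtain ⟨r, hr, h⟩ := hfT _ hz
    refine ⟨r * ‖deriv γ x‖, mul_pos hr (norm_pos_iff.2 (Γ.regular j x)), ?_⟩
    rw [Complex.ofReal_mul, ← h, Γ.tangent_curve, ← hγdef]
    have : (‖deriv γ x‖ : ℂ) ≠ 0 := by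
      exact_mod_cast norm_ne_zero_iff.2 (Γ.regular j x)
    field_simp
  obtain ⟨A, hA, hAeq⟩ := hreal t₀ (γ t₀) ⟨Γ.curve_mem j t₀, Metric.mem_ball_self hρ⟩ rfl
  have hΦ := contDiff_collar hγ
  have hΦc := continuous_collar hγ
  have hDc : Continuous (collarDeriv γ) := by
    have := hΦ.continuous_fderiv (by simp)
    refine this.congr fun w => fderiv_collar hγ w
  have ht₀ : (t₀ : ℂ) ∈ Metric.ball (t₀ : ℂ) δ := Metric.mem_ball_self hc.pos
  obtain ⟨s₀, hs₀, hs₀δ, hs₀ρ⟩ : ∃ s₀, 0 < s₀ ∧ s₀ ≤ δ ∧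
      ∀ w ∈ Metric.ball (t₀ : ℂ) s₀, collar γ w ∈ Metric.ball (γ t₀) ρ := by
    have h1 : collar γ ⁻¹' Metric.ball (γ t₀) ρ ∈ 𝓝 (t₀ : ℂ) :=
      hΦc.continuousAt.preimage_mem_nhds (by
        rw [collar_ofReal]; exact Metric.ball_mem_nhds _ hρ)
    obtain ⟨s, hs, hsub⟩ := Metric.mem_nhds_iff.1 h1
    exact ⟨min s δ, lt_min hs hc.pos, min_le_right _ _,
      fun w hw => hsub (Metric.ball_subset_ball (min_le_left _ _) hw)⟩
  set η : ℂ → ℂ →L[ℝ] ℂ := fun w => f (collar γ w) • collarDeriv γ w with hη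
  have hηc : ContinuousOn η (Metric.ball (t₀ : ℂ) s₀ ∩ {w | 0 ≤ w.im}) := by
    refine ContinuousOn.smul (hfc.comp hΦc.continuousOn fun w hw => ⟨?_, hs₀ρ w hw.1⟩)
      hDc.continuousOn
    exact hc.mem_closure (Metric.ball_subset_ball hs₀δ hw.1) hw.2
  -- The collar map is conformal on the axis, so at `t₀` the form is the positive number `A = f γ'`
  -- times the identity. Continuity keeps it within `A / 2` of that nearby.
  have hη₀ : η t₀ = A • ContinuousLinearMap.id ℝ ℂ := by
    ext v
    simp only [hη, smul_apply, collarDeriv_ofReal, collar_ofReal,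
      smul_eq_mul, ← mul_assoc, hAeq]
    simp
  obtain ⟨s, hs, hss₀, hsη⟩ : ∃ s, 0 < s ∧ s ≤ s₀ ∧ ∀ w ∈ Metric.ball (t₀ : ℂ) s, 0 ≤ w.im →
      ‖η w - A • ContinuousLinearMap.id ℝ ℂ‖ ≤ A / 2 := by
    have h1 := hηc t₀ ⟨Metric.mem_ball_self hs₀, by simp⟩
    obtain ⟨s, hs, h2⟩ := Metric.continuousWithinAt_iff.1 h1 (A / 2) (half_pos hA)
    refine ⟨min s s₀, lt_min hs hs₀, min_le_right _ _, fun w hw him => ?_⟩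
    have := h2 (x := w) ⟨Metric.ball_subset_ball (min_le_right _ _) hw, him⟩
      (Metric.ball_subset_ball (min_le_left _ _) hw)
    rw [dist_eq_norm, hη₀] at this
    exact this.le
  have hsδ : s ≤ δ := hss₀.trans hs₀δ
  set U := Metric.ball (t₀ : ℂ) s ∩ {w | 0 < w.im} with hU
  have hUo : IsOpen U := Metric.isOpen_ball.inter (isOpen_lt continuous_const Complex.continuous_im)
  have hUΩ : ∀ w ∈ U, collar γ w ∈ Ω := fun w hw =>
    (hc.mem_iff w (Metric.ball_subset_ball hsδ hw.1)).2 hw.2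
  have hUs : U ⊆ Metric.ball (t₀ : ℂ) s₀ ∩ {w | 0 ≤ w.im} := fun w hw =>
    ⟨Metric.ball_subset_ball hss₀ hw.1, le_of_lt (a := (0 : ℝ)) (b := w.im) hw.2⟩
  have hconv : Convex ℝ U := convex_upper_ball t₀ s
  -- Poincaré's lemma on a convex set. The form is closed because its derivative is the sum of `f`
  -- times a second derivative and `f'` times a symmetric product of first derivatives.
  obtain ⟨E₀, hE₀⟩ := hconv.exists_forall_hasFDerivWithinAt_of_hasFDerivWithinAt_symmetric
    (dω := fun w => f (collar γ w) • fderiv ℝ (fderiv ℝ (collar γ)) w +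
      (((deriv f (collar γ w)) • collarDeriv γ w).smulRight (collarDeriv γ w)))
    (fun w hw => by
      have h1 : HasFDerivAt f ((deriv f (collar γ w)) • (ContinuousLinearMap.id ℝ ℂ))
          (collar γ w) := by
        have := ((hfd.differentiableAt (hopen.mem_nhds (hUΩ w hw))).hasDerivAt.hasFDerivAt
          ).restrictScalars ℝ
        refine this.congr_fderiv ?_
        ext v <;> simp [mul_comm]
      have h2 := h1.comp w (hasFDerivAt_collar hγ w)
      have h3 : HasFDerivAt (collarDeriv γ) (fderiv ℝ (fderiv ℝ (collar γ)) w) w := by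
        have e : fderiv ℝ (collar γ) = collarDeriv γ := funext fun w => fderiv_collar hγ w
        rw [← e]
        have hcd : ContDiff ℝ ∞ (fderiv ℝ (collar γ)) := hΦ.fderiv_right (by simp)
        exact (hcd.differentiable (by simp) w).hasFDerivAt
      have h4 := h2.smul h3
      refine (h4.congr_fderiv ?_).hasFDerivWithinAt
      ext v u <;> simp [mul_comm])
    (fun w hw u _ v _ => by
      have h := (hΦ.contDiffAt (x := w)).isSymmSndFDerivAt
        (by simpa using ENat.LEInfty.out)
      have h' := h.eq u v
      simp only [add_apply, smul_apply,
        ContinuousLinearMap.smulRight_apply, smul_eq_mul, h']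
      ring)
  have happ₀ : ∀ w ∈ U, ∀ w' ∈ U, ‖E₀ w - E₀ w' - A * (w - w')‖ ≤ A / 2 * ‖w - w'‖ := by
    intro w hw w' hw'
    have := hconv.norm_image_sub_le_of_norm_hasFDerivWithin_le' (f := E₀) (f' := η)
      (φ := A • ContinuousLinearMap.id ℝ ℂ) hE₀
      (fun x hx => hsη x hx.1 (le_of_lt hx.2)) hw' hw
    simpa using this
  have hLip : LipschitzOnWith (3 / 2 * A).toNNReal E₀ U := by
    refine LipschitzOnWith.of_dist_le_mul fun w hw w' hw' => ?_
    rw [dist_eq_norm, dist_eq_norm, Real.coe_toNNReal _ (by positivity)]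
    have h1 := happ₀ w hw w' hw'
    have h2 := norm_le_norm_add_norm_sub' (E₀ w - E₀ w') (A * (w - w'))
    rw [norm_mul, Complex.norm_real, Real.norm_of_nonneg hA.le] at h2
    linarith
  -- The Lipschitz extension provides the values on the diameter and makes `E` continuous
  -- everywhere; its values below the axis are irrelevant.
  obtain ⟨E₁, hE₁L, hE₁⟩ := hLip.extend_finite_dimension
  have hE₁c := hE₁L.continuous
  have hdense : ∀ w ∈ Metric.ball (t₀ : ℂ) s, 0 ≤ w.im →
      Tendsto (fun y : ℝ => w + y * Complex.I) (𝓝[>] 0) (𝓝 w) ∧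
      ∀ᶠ y : ℝ in 𝓝[>] 0, w + y * Complex.I ∈ U := by
    intro w hw him
    have hlim : Tendsto (fun y : ℝ => w + y * Complex.I) (𝓝[>] 0) (𝓝 w) := by
      have hcont : Continuous fun y : ℝ => w + y * Complex.I := by fun_prop
      have := hcont.tendsto 0
      simp only [Complex.ofReal_zero, zero_mul, add_zero] at this
      exact this.mono_left nhdsWithin_le_nhds
    refine ⟨hlim, ?_⟩
    filter_upwards [hlim.eventually_mem (Metric.isOpen_ball.mem_nhds hw),
      self_mem_nhdsWithin] with y hy hy0
    refine ⟨hy, ?_⟩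
    have : (0 : ℝ) < y := hy0
    simp
    linarith
  have happ : ∀ w ∈ Metric.ball (t₀ : ℂ) s, ∀ w' ∈ Metric.ball (t₀ : ℂ) s, 0 ≤ w.im → 0 ≤ w'.im →
      ‖E₁ w - E₁ w' - A * (w - w')‖ ≤ A / 2 * ‖w - w'‖ := by
    intro w hw w' hw' h h'
    obtain ⟨l1, e1⟩ := hdense w hw h
    obtain ⟨l2, e2⟩ := hdense w' hw' h'
    have c1 := ((((hE₁c.tendsto w).comp l1).sub ((hE₁c.tendsto w').comp l2)).sub
      ((l1.sub l2).const_mul (A : ℂ))).norm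
    refine le_of_tendsto_of_tendsto c1 ((l1.sub l2).norm.const_mul (A / 2)) ?_
    filter_upwards [e1, e2] with y hy1 hy2
    simp only [Function.comp_apply]
    rw [← hE₁ hy1, ← hE₁ hy2]
    exact happ₀ _ hy1 _ hy2
  have hder : ∀ w ∈ Metric.ball (t₀ : ℂ) s, 0 < w.im → HasFDerivAt E₁ (η w) w := by
    intro w hw h
    have hwU : w ∈ U := ⟨hw, h⟩
    refine ((hE₀ w hwU).hasFDerivAt (hUo.mem_nhds hwU)).congr_of_eventuallyEq ?_
    filter_upwards [hUo.mem_nhds hwU] with v hv using (hE₁ hv).symm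
  -- Integrate along horizontal lines above the axis and let the height tend to `0`. The integrand
  -- tends to `f γ'`, which is real.
  have hdiff : ∀ x : ℝ, |x - t₀| < s → (E₁ x - E₁ t₀).im = 0 := by
    intro x hx
    have hmem : ∀ v ∈ uIcc t₀ x, |v - t₀| < s := fun v hv =>
      (abs_sub_left_of_mem_uIcc hv).trans_lt hx
    have hb : ∀ v : ℝ, |v - t₀| < s → (v : ℂ) ∈ Metric.ball (t₀ : ℂ) s := fun v hv => by
      rwa [Metric.mem_ball, dist_eq_norm, ← Complex.ofReal_sub, Complex.norm_real,
        Real.norm_eq_abs]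
    have hsmall : ∀ᶠ y : ℝ in 𝓝[>] 0, 0 < y ∧ ∀ v ∈ uIcc t₀ x, (v : ℂ) + y * Complex.I ∈ U := by
      have hpos : 0 < s - |x - t₀| := by linarith
      filter_upwards [Ioo_mem_nhdsGT hpos] with y hy
      refine ⟨hy.1, fun v hv => ⟨?_, by simpa using hy.1⟩⟩
      rw [Metric.mem_ball, dist_eq_norm]
      have h1 : ‖(v : ℂ) + y * Complex.I - t₀‖ ≤ |v - t₀| + |y| := by
        have := Complex.norm_le_abs_re_add_abs_im ((v : ℂ) + y * Complex.I - t₀)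
        simpa using this
      have := abs_sub_left_of_mem_uIcc hv
      rw [abs_of_pos hy.1] at h1
      linarith [hy.2]
    have hcl : ∀ y : ℝ, ∀ v : ℝ, HasDerivAt (fun v : ℝ => (v : ℂ) + y * Complex.I) 1 v :=
      fun y v => by simpa using (Complex.ofRealCLM.hasDerivAt (x := v)).add_const (y * Complex.I)
    have hint : ∀ᶠ y : ℝ in 𝓝[>] 0, (E₁ (x + y * Complex.I) - E₁ (t₀ + y * Complex.I)).im =
        ∫ v in t₀..x, (η ((v : ℂ) + y * Complex.I) 1).im := by
      filter_upwards [hsmall] with y ⟨hy, hyU⟩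
      have hd : ∀ v ∈ uIcc t₀ x, HasDerivAt (fun v : ℝ => E₁ ((v : ℂ) + y * Complex.I))
          (η ((v : ℂ) + y * Complex.I) 1) v := fun v hv =>
        (hder _ (hyU v hv).1 (hyU v hv).2).comp_hasDerivAt v (hcl y v)
      have hci : ContinuousOn (fun v : ℝ => η ((v : ℂ) + y * Complex.I) 1) (uIcc t₀ x) := by
        refine ContinuousOn.clm_apply (hηc.comp (by fun_prop) fun v hv => ?_) continuousOn_const
        exact hUs (hyU v hv)
      rw [← intervalIntegral.integral_eq_sub_of_hasDerivAt hd hci.intervalIntegrable]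
      have := Complex.imCLM.intervalIntegral_comp_comm (hci.intervalIntegrable (μ := volume))
      simpa using this.symm
    have hlim1 : Tendsto (fun y : ℝ => (E₁ (x + y * Complex.I) - E₁ (t₀ + y * Complex.I)).im)
        (𝓝[>] 0) (𝓝 (E₁ x - E₁ t₀).im) := by
      have hcont : Continuous fun y : ℝ =>
          (E₁ (x + y * Complex.I) - E₁ (t₀ + y * Complex.I)).im := by fun_prop
      have := hcont.tendsto 0
      simp only [Complex.ofReal_zero, zero_mul, add_zero] at this
      exact this.mono_left nhdsWithin_le_nhds
    have hlim2 : Tendsto (fun y : ℝ => ∫ v in t₀..x, (η ((v : ℂ) + y * Complex.I) 1).im)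
        (𝓝[>] 0) (𝓝 (∫ v in t₀..x, (0 : ℝ))) := by
      refine intervalIntegral.tendsto_integral_filter_of_dominated_convergence
        (fun _ => A + A / 2) ?_ ?_ intervalIntegrable_const ?_
      · filter_upwards [hsmall] with y ⟨hy, hyU⟩
        have hci : ContinuousOn (fun v : ℝ => (η ((v : ℂ) + y * Complex.I) 1).im) (uIcc t₀ x) := by
          refine Complex.continuous_im.comp_continuousOn (ContinuousOn.clm_apply
            (hηc.comp (by fun_prop) fun v hv => ?_) continuousOn_const)
          exact hUs (hyU v hv)
        exact (hci.intervalIntegrable (μ := volume)).def'.aestronglyMeasurable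
      · filter_upwards [hsmall] with y ⟨hy, hyU⟩
        refine Eventually.of_forall fun v hv => ?_
        have hv' := hyU v (uIoc_subset_uIcc hv)
        have h1 := hsη _ hv'.1 (le_of_lt hv'.2)
        have h2 := (η ((v : ℂ) + y * Complex.I) - A • ContinuousLinearMap.id ℝ ℂ).le_opNorm 1
        have h3 : (η ((v : ℂ) + y * Complex.I) - A • ContinuousLinearMap.id ℝ ℂ) 1 =
            η ((v : ℂ) + y * Complex.I) 1 - A := by simp
        rw [h3, norm_one, mul_one] at h2
        have h4 := norm_le_norm_add_norm_sub' (η ((v : ℂ) + y * Complex.I) 1) (A : ℂ)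
        rw [Complex.norm_real, Real.norm_of_nonneg hA.le] at h4
        rw [Real.norm_eq_abs]
        linarith [Complex.abs_im_le_norm (η ((v : ℂ) + y * Complex.I) 1)]
      · refine Eventually.of_forall fun v hv => ?_
        have hv0 := hmem v (uIoc_subset_uIcc hv)
        have hvs : (v : ℂ) ∈ Metric.ball (t₀ : ℂ) s₀ := Metric.ball_subset_ball hss₀ (hb v hv0)
        have hval : (η v 1).im = 0 := by
          obtain ⟨r, -, hr⟩ := hreal v (γ v) ⟨Γ.curve_mem j v, by
            have := hs₀ρ v hvs; rwa [collar_ofReal] at this⟩ rfl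
          simp only [hη, smul_apply, collarDeriv_ofReal, collar_ofReal,
            smul_eq_mul, mul_one, hr, Complex.ofReal_im]
        suffices h : Tendsto (fun y : ℝ => η ((v : ℂ) + y * Complex.I) 1) (𝓝[>] 0)
            (𝓝 (η v 1)) by
          have := (Complex.continuous_im.tendsto _).comp h
          rwa [hval] at this
        have h1 : ContinuousWithinAt (fun w => η w 1)
            (Metric.ball (t₀ : ℂ) s₀ ∩ {w | 0 ≤ w.im}) v :=
          (hηc v ⟨hvs, by simp⟩).clm_apply continuousWithinAt_const
        refine h1.tendsto.comp (tendsto_nhdsWithin_iff.2 ⟨(hdense v (hb v hv0) (by simp)).1, ?_⟩)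
        filter_upwards [(hdense v (hb v hv0) (by simp)).2] with y hy
        exact hUs hy
    have := tendsto_nhds_unique_of_eventuallyEq hlim1 hlim2 hint
    simpa using this
  refine ⟨A, hA, s, hs, hsδ, fun w hw => hs₀ρ w (Metric.ball_subset_ball hss₀ hw),
    fun w => E₁ w - E₁ t₀, hE₁c.sub continuous_const, sub_self _, ?_, ?_, hdiff⟩
  · intro w hw w' hw' h h'
    rw [sub_sub_sub_cancel_right]
    exact happ w hw w' hw' h h'
  · intro w hw h
    exact (hder w hw h).sub_const _

end SmoothBoundary

/-- A map of a half disc that is close to a dilation and real on the diameter has an inverse near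
the centre. -/
theorem exists_inverse_of_upper_half_ball {A s t₀ : ℝ} (hA : 0 < A) (hs : 0 < s) {E : ℂ → ℂ}
    (hE₀ : E t₀ = 0)
    (hE : ∀ w ∈ Metric.ball (t₀ : ℂ) s, ∀ w' ∈ Metric.ball (t₀ : ℂ) s, 0 ≤ w.im → 0 ≤ w'.im →
      ‖E w - E w' - A * (w - w')‖ ≤ A / 2 * ‖w - w'‖)
    (hEr : ∀ x : ℝ, |x - t₀| < s → (E x).im = 0) :
    ∃ v : ℂ → ℂ, ∃ ρ > 0, (∀ ζ ∈ Metric.ball (0 : ℂ) ρ, 0 ≤ ζ.im →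
        v ζ ∈ Metric.ball (t₀ : ℂ) s ∧ E (v ζ) = ζ ∧ 0 ≤ (v ζ).im ∧
          ((v ζ).im = 0 ↔ ζ.im = 0)) ∧
      (∀ ζ ∈ Metric.ball (0 : ℂ) ρ, 0 ≤ ζ.im → ∀ ζ' ∈ Metric.ball (0 : ℂ) ρ, 0 ≤ ζ'.im →
        ‖v ζ - v ζ'‖ ≤ 2 / A * ‖ζ - ζ'‖) ∧
      (∀ w ∈ Metric.ball (t₀ : ℂ) s, 0 ≤ w.im → E w ∈ Metric.ball (0 : ℂ) ρ →
        0 ≤ (E w).im ∧ ((E w).im = 0 ↔ w.im = 0) ∧ v (E w) = w) := by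
  have hexp : ∀ w ∈ Metric.ball (t₀ : ℂ) s, ∀ w' ∈ Metric.ball (t₀ : ℂ) s, 0 ≤ w.im → 0 ≤ w'.im →
      ‖w - w'‖ ≤ 2 / A * ‖E w - E w'‖ := by
    intro w hw w' hw' h h'
    have h1 := hE w hw w' hw' h h'
    have h2 := norm_sub_norm_le (A * (w - w')) (E w - E w')
    rw [norm_sub_rev (_ * _), norm_mul, Complex.norm_real, Real.norm_of_nonneg hA.le] at h2
    rw [div_mul_eq_mul_div, le_div_iff₀ hA]
    linarith
  have hre : ∀ w ∈ Metric.ball (t₀ : ℂ) s, |w.re - t₀| < s := fun w hw => by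
    have := Complex.abs_re_le_norm (w - t₀)
    rw [Metric.mem_ball, dist_eq_norm] at hw
    simp only [Complex.sub_re, Complex.ofReal_re] at this
    exact this.trans_lt hw
  have hreal : ∀ x : ℝ, |x - t₀| < s → (x : ℂ) ∈ Metric.ball (t₀ : ℂ) s := fun v hv => by
    rwa [Metric.mem_ball, dist_eq_norm, ← Complex.ofReal_sub, Complex.norm_real,
      Real.norm_eq_abs]
  have him : ∀ w ∈ Metric.ball (t₀ : ℂ) s, 0 ≤ w.im → |(E w).im - A * w.im| ≤ A / 2 * w.im := by
    intro w hw h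
    have h1 := hE w hw w.re (hreal _ (hre w hw)) h (by simp)
    have h2 := (Complex.abs_im_le_norm _).trans h1
    have h3 : ‖w - w.re‖ = w.im := by
      have : w - w.re = w.im * Complex.I := by
        apply Complex.ext <;> simp
      rw [this, norm_mul, Complex.norm_I, mul_one, Complex.norm_real, Real.norm_of_nonneg h]
    rw [h3] at h2
    simpa [hEr _ (hre w hw)] using h2
  have hsign : ∀ w ∈ Metric.ball (t₀ : ℂ) s, 0 ≤ w.im →
      0 ≤ (E w).im ∧ ((E w).im = 0 ↔ w.im = 0) := by
    intro w hw h
    have h1 := abs_le.1 (him w hw h)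
    refine ⟨by nlinarith, fun h0 => ?_, fun h0 => ?_⟩
    · rw [h0] at h1; nlinarith
    · rw [h0] at h1; linarith
  let P : ℂ → ℂ := fun w => ⟨w.re, max w.im 0⟩
  have hPim : ∀ w, 0 ≤ (P w).im := fun w => le_max_right _ _
  have hP : ∀ w w', ‖P w - P w'‖ ≤ ‖w - w'‖ := by
    intro w w'
    refine (sq_le_sq₀ (norm_nonneg _) (norm_nonneg _)).1 ?_
    rw [← Complex.normSq_eq_norm_sq, ← Complex.normSq_eq_norm_sq, Complex.normSq_apply,
      Complex.normSq_apply]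
    have h1 : |max w.im 0 - max w'.im 0| ≤ |w.im - w'.im| := abs_max_sub_max_le_abs _ _ _
    have h2 := sq_le_sq.2 h1
    simp only [P, Complex.sub_re, Complex.sub_im]
    nlinarith
  have hPof : ∀ w : ℂ, 0 ≤ w.im → P w = w := fun w h => Complex.ext rfl (max_eq_left h)
  have hPball : ∀ w ∈ Metric.ball (t₀ : ℂ) s, P w ∈ Metric.ball (t₀ : ℂ) s := by
    intro w hw
    have := hP w t₀
    rw [hPof t₀ (by simp)] at this
    rw [Metric.mem_ball, dist_eq_norm] at hw ⊢
    exact this.trans_lt hw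
  -- The half disc map, normalized and folded by `P`, is extended to the full disc by adding the
  -- negative imaginary part. The result differs from the identity by a map with Lipschitz constant
  -- `1 / 2`, so the inverse function theorem applies.
  let F : ℂ → ℂ := fun w => (A : ℂ)⁻¹ * E (P w) + (min w.im 0 : ℝ) * Complex.I
  have hAc : (A : ℂ) ≠ 0 := by exact_mod_cast hA.ne'
  have hF : ApproximatesLinearOn F ((ContinuousLinearEquiv.refl ℝ ℂ : ℂ ≃L[ℝ] ℂ) : ℂ →L[ℝ] ℂ)
      (Metric.ball (t₀ : ℂ) s) (1 / 2) := by
    intro w hw w' hw'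
    have h1 := hE _ (hPball w hw) _ (hPball w' hw') (hPim w) (hPim w')
    have hsplit : ∀ w : ℂ, w = P w + (min w.im 0 : ℝ) * Complex.I := by
      intro w
      apply Complex.ext
      · simp [P]
      · simp only [P, Complex.add_im, Complex.mul_im, Complex.ofReal_re, Complex.I_im, mul_one,
          Complex.ofReal_im, Complex.I_re, mul_zero, add_zero]
        rw [max_add_min, add_zero]
    have h2 : F w - F w' - (w - w') =
        (A : ℂ)⁻¹ * (E (P w) - E (P w') - A * (P w - P w')) := by
      conv_lhs => rw [hsplit w, hsplit w', ← hsplit w, ← hsplit w']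
      have e1 := hsplit w
      have e2 := hsplit w'
      simp only [F]
      field_simp
      linear_combination (-A : ℂ) * e1 + A * e2
    have h3 : (((ContinuousLinearEquiv.refl ℝ ℂ : ℂ ≃L[ℝ] ℂ) : ℂ →L[ℝ] ℂ) (w - w')) = w - w' := rfl
    rw [h3, h2, norm_mul, norm_inv, Complex.norm_real, Real.norm_of_nonneg hA.le]
    have h4 : A⁻¹ * (A / 2 * ‖P w - P w'‖) = 1 / 2 * ‖P w - P w'‖ := by field_simp
    calc _ ≤ A⁻¹ * (A / 2 * ‖P w - P w'‖) := by gcongr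
      _ = 1 / 2 * ‖P w - P w'‖ := h4
      _ ≤ ((1 / 2 : NNReal) : ℝ) * ‖w - w'‖ := by
        push_cast
        exact mul_le_mul_of_nonneg_left (hP w w') (by norm_num)
  have hnorm : Subsingleton ℂ ∨ (1 / 2 : NNReal) <
      ‖((ContinuousLinearEquiv.refl ℝ ℂ).symm : ℂ →L[ℝ] ℂ)‖₊⁻¹ := by
    right
    have : ‖((ContinuousLinearEquiv.refl ℝ ℂ).symm : ℂ →L[ℝ] ℂ)‖₊ = 1 := by
      ext
      exact ContinuousLinearMap.norm_id
    rw [this, inv_one, ← NNReal.coe_lt_coe]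
    norm_num
  let e := hF.toOpenPartialHomeomorph F (Metric.ball (t₀ : ℂ) s) hnorm Metric.isOpen_ball
  have hsurj : ∀ ζ ∈ e.target, ∃ w ∈ Metric.ball (t₀ : ℂ) s, F w = ζ := fun ζ hζ =>
    ⟨e.symm ζ, e.map_target hζ, e.right_inv hζ⟩
  have h0 : (0 : ℂ) ∈ e.target := by
    have h1 : e t₀ ∈ e.target := e.map_source (Metric.mem_ball_self hs)
    have h2 : e t₀ = 0 := by
      show F t₀ = 0
      simp only [F, hPof t₀ (by simp), hE₀]
      simp
    rwa [h2] at h1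
  obtain ⟨r, hr, hball⟩ := Metric.mem_nhds_iff.1 (e.open_target.mem_nhds h0)
  have hex : ∀ ζ : ℂ, ∃ w, ζ ∈ Metric.ball (0 : ℂ) (A * r) → 0 ≤ ζ.im →
      w ∈ Metric.ball (t₀ : ℂ) s ∧ E w = ζ ∧ 0 ≤ w.im := by
    intro ζ
    by_cases hζ : ζ ∈ Metric.ball (0 : ℂ) (A * r) ∧ 0 ≤ ζ.im
    · obtain ⟨w, hw, hwF⟩ := hsurj ((A : ℂ)⁻¹ * ζ) (hball (by
        have := hζ.1
        rw [mem_ball_zero_iff] at this ⊢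
        rw [norm_mul, norm_inv, Complex.norm_real, Real.norm_of_nonneg hA.le,
          inv_mul_lt_iff₀ hA]
        exact this))
      have hw0 : 0 ≤ w.im := by
        -- Below the axis `F` has the imaginary part of its argument, as `E` is real on the
        -- diameter. A point with nonnegative imaginary part therefore has no preimage there.
        by_contra! hneg
        have hPr : P w = w.re := Complex.ext rfl (by simp [P, hneg.le])
        have h1 := congrArg Complex.im hwF
        simp only [F, hPr, ← Complex.ofReal_inv, Complex.add_im, Complex.re_ofReal_mul,
          Complex.im_ofReal_mul, hEr _ (hre w hw), Complex.I_im, min_eq_left hneg.le] at h1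
        have := mul_nonneg (inv_nonneg.2 hA.le) hζ.2
        linarith
      refine ⟨w, fun _ _ => ⟨hw, ?_, hw0⟩⟩
      simp only [F, hPof w hw0, min_eq_right hw0] at hwF
      simpa [hAc] using hwF
    · exact ⟨0, fun h h' => (hζ ⟨h, h'⟩).elim⟩
  choose v hv using hex
  refine ⟨v, A * r, mul_pos hA hr, fun ζ hζ h => ?_, fun ζ hζ h ζ' hζ' h' => ?_,
    fun w hw h hEw => ?_⟩
  · obtain ⟨h1, h2, h3⟩ := hv ζ hζ h
    refine ⟨h1, h2, h3, ?_⟩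
    have := (hsign _ h1 h3).2
    rw [h2] at this
    exact this.symm
  · obtain ⟨h1, h2, h3⟩ := hv ζ hζ h
    obtain ⟨h1', h2', h3'⟩ := hv ζ' hζ' h'
    have := hexp _ h1 _ h1' h3 h3'
    rwa [h2, h2'] at this
  · obtain ⟨hs1, hs2⟩ := hsign w hw h
    obtain ⟨h1, h2, h3⟩ := hv _ hEw hs1
    refine ⟨hs1, hs2, ?_⟩
    have := hexp _ h1 _ hw h3 h
    rw [h2, sub_self, norm_zero, mul_zero] at this
    exact sub_eq_zero.1 (norm_le_zero_iff.1 this)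

namespace SmoothBoundary

variable {Ω : Set ℂ} {n : ℕ} {Γ : SmoothBoundary Ω n}

/-- Near a boundary point `Ω` is the image of a half disc under a map that is holomorphic inside
and continuous up to the diameter, and whose derivative is there a positive multiple of the
tangent. -/
theorem exists_uniformizer (hopen : IsOpen Ω) {z₀ : ℂ} (hz₀ : z₀ ∈ frontier Ω) :
    ∃ k D : ℂ → ℂ, ∃ ρ > 0,
      ContinuousOn k (Metric.ball 0 ρ ∩ {ζ | 0 ≤ ζ.im}) ∧
      ContinuousOn D (Metric.ball 0 ρ ∩ {ζ | 0 ≤ ζ.im}) ∧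
      DifferentiableOn ℂ k (Metric.ball 0 ρ ∩ {ζ | 0 < ζ.im}) ∧
      DifferentiableOn ℂ D (Metric.ball 0 ρ ∩ {ζ | 0 < ζ.im}) ∧
      k 0 = z₀ ∧
      (∀ ζ ∈ Metric.ball (0 : ℂ) ρ, 0 < ζ.im → k ζ ∈ Ω) ∧
      (∀ ζ ∈ Metric.ball (0 : ℂ) ρ, 0 ≤ ζ.im → D ζ ≠ 0) ∧
      (∀ ζ ∈ Metric.ball (0 : ℂ) ρ, ζ.im = 0 → k ζ ∈ frontier Ω ∧
        ∃ r : ℝ, 0 < r ∧ D ζ = r * Γ.tangent (k ζ)) ∧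
      𝓝[Ω] z₀ ≤ map k (𝓝[{ζ | 0 < ζ.im}] 0) := by
  obtain ⟨j, t₀, rfl⟩ : ∃ j t₀, Γ.curve j t₀ = z₀ := by
    rw [Γ.frontier_eq] at hz₀; simpa using hz₀
  obtain ⟨δ, hc⟩ := Γ.exists_isChart hopen j t₀
  obtain ⟨f, ρ₀, hρ₀, hfc, hfd, hf0, hfT⟩ := exists_conj_tangent_direction (Γ := Γ) hopen j t₀
  obtain ⟨A, hA, s, hs, hsδ, hsρ, E, hEc, hE₀, hE, hEd, hEr⟩ :=
    hc.exists_primitive hρ₀ hopen hfc hfd hfT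
  obtain ⟨v, ρ, hρ, hv, hvL, hvE⟩ := exists_inverse_of_upper_half_ball hA hs hE₀ hE hEr
  have hγ := Γ.smooth j
  set γ := Γ.curve j with hγdef
  have hvb : ∀ ζ ∈ Metric.ball (0 : ℂ) ρ, 0 ≤ ζ.im → v ζ ∈ Metric.ball (t₀ : ℂ) δ :=
    fun ζ hζ h => Metric.ball_subset_ball hsδ (hv ζ hζ h).1
  set k : ℂ → ℂ := fun ζ => collar γ (v ζ) with hk
  have hvc : ContinuousOn v (Metric.ball 0 ρ ∩ {ζ | 0 ≤ ζ.im}) := by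
    refine LipschitzOnWith.continuousOn (K := (2 / A).toNNReal)
      (LipschitzOnWith.of_dist_le_mul fun ζ hζ ζ' hζ' => ?_)
    rw [dist_eq_norm, dist_eq_norm, Real.coe_toNNReal _ (by positivity)]
    exact hvL ζ hζ.1 hζ.2 ζ' hζ'.1 hζ'.2
  have hkc : ContinuousOn k (Metric.ball 0 ρ ∩ {ζ | 0 ≤ ζ.im}) :=
    (continuous_collar hγ).comp_continuousOn hvc
  have hkcl : ∀ ζ ∈ Metric.ball (0 : ℂ) ρ, 0 ≤ ζ.im →
      k ζ ∈ closure Ω ∩ Metric.ball (γ t₀) ρ₀ := fun ζ hζ h =>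
    ⟨hc.mem_closure (hvb ζ hζ h) (hv ζ hζ h).2.2.1, hsρ _ (hv ζ hζ h).1⟩
  have hkΩ : ∀ ζ ∈ Metric.ball (0 : ℂ) ρ, 0 < ζ.im → k ζ ∈ Ω := fun ζ hζ h => by
    obtain ⟨-, -, h1, h2⟩ := hv ζ hζ h.le
    exact (hc.mem_iff _ (hvb ζ hζ h.le)).2 (h1.lt_of_ne fun h0 => h.ne' (h2.1 h0.symm))
  have hopenU : IsOpen (Metric.ball (0 : ℂ) ρ ∩ {ζ | 0 < ζ.im}) :=
    Metric.isOpen_ball.inter (isOpen_lt continuous_const Complex.continuous_im)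
  have hkd : ∀ ζ ∈ Metric.ball (0 : ℂ) ρ ∩ {ζ | 0 < ζ.im}, HasDerivAt k (f (k ζ))⁻¹ ζ := by
    rintro ζ ⟨hζ, him⟩
    have him' : 0 < ζ.im := him
    obtain ⟨h1, h2, h3, h4⟩ := hv ζ hζ him'.le
    have h5 : 0 < (v ζ).im := h3.lt_of_ne fun h0 => him'.ne' (h4.1 h0.symm)
    have hfk : f (k ζ) ≠ 0 := hf0 _ (hkcl ζ hζ him'.le)
    -- Since `dE = f dΦ`, with `Φ` the collar map, the map `Φ - E / f(k ζ)` has zero real derivative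
    -- at `v ζ`. Composing with the Lipschitz inverse `v` gives `k' = 1 / f(k)` without
    -- differentiating `v`.
    have hd : HasFDerivAt (fun w => collar γ w - (f (k ζ))⁻¹ * E w) (0 : ℂ →L[ℝ] ℂ) (v ζ) := by
      refine ((hasFDerivAt_collar hγ (v ζ)).sub ((hEd _ h1 h5).const_mul _)).congr_fderiv ?_
      ext u <;> simp [k, hfk]
    have hvt : Tendsto v (𝓝 ζ) (𝓝 (v ζ)) :=
      (hvc.mono fun x hx => ⟨hx.1, le_of_lt (a := (0 : ℝ)) hx.2⟩).continuousAt
        (hopenU.mem_nhds ⟨hζ, him⟩)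
    have hO : (fun ζ' => v ζ' - v ζ) =O[𝓝 ζ] fun ζ' => ζ' - ζ := by
      refine Asymptotics.IsBigO.of_bound (2 / A) ?_
      filter_upwards [hopenU.mem_nhds ⟨hζ, him⟩] with x hx
      exact hvL x hx.1 (le_of_lt (a := (0 : ℝ)) hx.2) ζ hζ him'.le
    rw [hasDerivAt_iff_isLittleO]
    refine ((hd.isLittleO.comp_tendsto hvt).congr' ?_ EventuallyEq.rfl).trans_isBigO hO
    filter_upwards [hopenU.mem_nhds ⟨hζ, him⟩] with x hx
    simp only [Function.comp_apply, (hv x hx.1 (le_of_lt (a := (0 : ℝ)) hx.2)).2.1, h2,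
      zero_apply, smul_eq_mul, k]
    ring
  have hkd' : DifferentiableOn ℂ k (Metric.ball 0 ρ ∩ {ζ | 0 < ζ.im}) := fun ζ hζ =>
    (hkd ζ hζ).differentiableAt.differentiableWithinAt
  have hk0 : k 0 = γ t₀ := by
    have h1 := (hvE t₀ (Metric.mem_ball_self hs) (by simp) (by
      rw [hE₀]; exact Metric.mem_ball_self hρ)).2.2
    rw [hE₀] at h1
    simp only [k, h1, collar_ofReal]
  -- The second function is the derivative of `k`. Because `f T` is positive on the boundary, its
  -- inverse is a positive multiple of `T` there.
  refine ⟨k, fun ζ => (f (k ζ))⁻¹, ρ, hρ, hkc, ?_, hkd', ?_, hk0, hkΩ, ?_, ?_, ?_⟩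
  · exact (hfc.comp hkc fun ζ hζ => hkcl ζ hζ.1 hζ.2).inv₀ fun ζ hζ =>
      hf0 _ (hkcl ζ hζ.1 hζ.2)
  · exact (hfd.comp hkd' fun ζ hζ => hkΩ ζ hζ.1 hζ.2).inv fun ζ hζ =>
      hf0 _ (hkcl ζ hζ.1 (le_of_lt (a := (0 : ℝ)) hζ.2))
  · exact fun ζ hζ h => inv_ne_zero (hf0 _ (hkcl ζ hζ h))
  · intro ζ hζ h
    have hfr : k ζ ∈ frontier Ω :=
      (hc.frontier_iff _ (hvb ζ hζ h.ge)).2 ((hv ζ hζ h.ge).2.2.2.2 h)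
    obtain ⟨r, hr, hfr'⟩ := hfT (k ζ) ⟨hfr, (hkcl ζ hζ h.ge).2⟩
    refine ⟨hfr, r⁻¹, inv_pos.2 hr, ?_⟩
    have h1 := hf0 _ (hkcl ζ hζ h.ge)
    have h2 : (r : ℂ) ≠ 0 := by exact_mod_cast hr.ne'
    rw [Complex.ofReal_inv, ← hfr']
    have hT : Γ.tangent (k ζ) ≠ 0 := fun h0 => by
      rw [h0, mul_zero] at hfr'
      exact h2 hfr'.symm
    field_simp
  · have hmap := hc.map_nhdsWithin (t := t₀) (by simpa using hc.pos)
    have hEt : Tendsto E (𝓝[{w | 0 < w.im}] (t₀ : ℂ)) (𝓝 0) := by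
      have := hEc.tendsto (t₀ : ℂ)
      rw [hE₀] at this
      exact this.mono_left nhdsWithin_le_nhds
    have hev : ∀ᶠ w in 𝓝[{w | 0 < w.im}] (t₀ : ℂ), 0 < (E w).im ∧ v (E w) = w := by
      filter_upwards [self_mem_nhdsWithin, hEt.eventually_mem (Metric.ball_mem_nhds 0 hρ),
        nhdsWithin_le_nhds (Metric.ball_mem_nhds (t₀ : ℂ) hs)] with w hw hEw hwb
      have hw' : 0 < w.im := hw
      obtain ⟨h1, h2, h3⟩ := hvE w hwb hw'.le hEw
      exact ⟨h1.lt_of_ne fun h0 => hw'.ne' (h2.1 h0.symm), h3⟩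
    rw [← hmap]
    calc map (collar γ) (𝓝[{w | 0 < w.im}] (t₀ : ℂ))
        = map (k ∘ E) (𝓝[{w | 0 < w.im}] (t₀ : ℂ)) :=
          map_congr (hev.mono fun w hw => by simp only [k, Function.comp_apply, hw.2])
      _ = map k (map E (𝓝[{w | 0 < w.im}] (t₀ : ℂ))) := map_map.symm
      _ ≤ _ := map_mono (tendsto_nhdsWithin_iff.2 ⟨hEt, hev.mono fun w hw => hw.1⟩)

end SmoothBoundary

/-! ### Schwarz reflection -/

/-- A continuous function on a disc that is holomorphic off the real axis is holomorphic. -/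
theorem differentiableOn_ball_of_im_ne_zero {c : ℂ} {r : ℝ} {f : ℂ → ℂ}
    (hc : ContinuousOn f (Metric.ball c r))
    (hd : ∀ z ∈ Metric.ball c r, z.im ≠ 0 → DifferentiableAt ℂ f z) :
    DifferentiableOn ℂ f (Metric.ball c r) := by
  have key : ∀ z w : ℂ, (uIcc z.re w.re) ×ℂ (uIcc z.im w.im) ⊆ Metric.ball c r →
      0 ∉ Ioo (min z.im w.im) (max z.im w.im) →
      (∫ x : ℝ in z.re..w.re, f (x + z.im * Complex.I)) -
        (∫ x : ℝ in z.re..w.re, f (x + w.im * Complex.I)) +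
        Complex.I • (∫ y : ℝ in z.im..w.im, f (w.re + y * Complex.I)) -
        Complex.I • (∫ y : ℝ in z.im..w.im, f (z.re + y * Complex.I)) = 0 := by
    intro z w hsub h0
    refine Complex.integral_boundary_rect_eq_zero_of_continuousOn_of_differentiableOn f z w
      (hc.mono hsub) fun u hu => (hd u (hsub ⟨?_, ?_⟩) fun h => h0 (h ▸ hu.2)
        ).differentiableWithinAt
    · exact Ioo_subset_Icc_self hu.1
    · exact Ioo_subset_Icc_self hu.2
  refine Complex.IsExactOn.differentiableOn Metric.isOpen_ball
    (Complex.IsConservativeOn.isExactOn_ball (hf' := hc) ?_)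
  rintro z w hzw
  rw [← add_eq_zero_iff_eq_neg, Complex.wedgeIntegral_add_wedgeIntegral_eq]
  have hzw' : (uIcc z.re w.re) ×ℂ (uIcc z.im w.im) ⊆ Metric.ball c r := hzw
  -- A rectangle that crosses the axis is cut along it. In each half the axis is an edge, where
  -- continuity is enough for Cauchy's theorem.
  by_cases h0 : (0 : ℝ) ∈ Ioo (min z.im w.im) (max z.im w.im)
  · have h0' : (0 : ℝ) ∈ (uIcc z.im w.im) := Ioo_subset_Icc_self h0
    have hs1 : (uIcc z.im 0) ⊆ (uIcc z.im w.im) := uIcc_subset_uIcc left_mem_uIcc h0'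
    have hs2 : (uIcc 0 w.im) ⊆ (uIcc z.im w.im) := uIcc_subset_uIcc h0' right_mem_uIcc
    have e1 := key z ⟨w.re, 0⟩ (fun u hu => hzw' ⟨hu.1, hs1 hu.2⟩) (by
      rintro ⟨h1, h2⟩
      rcases le_total z.im 0 with h | h
      · simp only [max_eq_right h, lt_irrefl] at h2
      · simp only [min_eq_right h, lt_irrefl] at h1)
    have e2 := key ⟨z.re, 0⟩ w (fun u hu => hzw' ⟨hu.1, hs2 hu.2⟩) (by
      rintro ⟨h1, h2⟩
      rcases le_total 0 w.im with h | h
      · simp only [min_eq_left h, lt_irrefl] at h1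
      · simp only [max_eq_left h, lt_irrefl] at h2)
    have hi : ∀ a ∈ (uIcc z.re w.re), ContinuousOn (fun y : ℝ => f (a + y * Complex.I))
        (uIcc z.im w.im) := fun a ha =>
      hc.comp (by fun_prop) fun y hy => hzw' ⟨by simpa using ha, by simpa using hy⟩
    have s1 := intervalIntegral.integral_add_adjacent_intervals
      (((hi _ right_mem_uIcc).mono hs1).intervalIntegrable (μ := volume))
      (((hi _ right_mem_uIcc).mono hs2).intervalIntegrable (μ := volume))
    have s2 := intervalIntegral.integral_add_adjacent_intervals
      (((hi _ left_mem_uIcc).mono hs1).intervalIntegrable (μ := volume))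
      (((hi _ left_mem_uIcc).mono hs2).intervalIntegrable (μ := volume))
    rw [← s1, ← s2]
    simp only [smul_eq_mul] at e1 e2 ⊢
    linear_combination e1 + e2
  · exact key z w hzw' h0

/-- Schwarz reflection across a diameter. -/
theorem exists_differentiableOn_ball_of_real {ρ : ℝ} {p : ℂ → ℂ}
    (hc : ContinuousOn p (Metric.ball 0 ρ ∩ {ζ | 0 ≤ ζ.im}))
    (hd : DifferentiableOn ℂ p (Metric.ball 0 ρ ∩ {ζ | 0 < ζ.im}))
    (hr : ∀ ζ ∈ Metric.ball (0 : ℂ) ρ, ζ.im = 0 → (p ζ).im = 0) :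
    ∃ P : ℂ → ℂ, DifferentiableOn ℂ P (Metric.ball 0 ρ) ∧
      ∀ ζ : ℂ, 0 ≤ ζ.im → P ζ = p ζ := by
  classical
  let P : ℂ → ℂ := fun ζ => if 0 ≤ ζ.im then p ζ else conj (p (conj ζ))
  have hconj : ∀ ζ : ℂ, ζ ∈ Metric.ball (0 : ℂ) ρ → conj ζ ∈ Metric.ball (0 : ℂ) ρ := by
    intro ζ hζ
    rw [mem_ball_zero_iff] at hζ ⊢
    rwa [Complex.norm_conj]
  have hPc : ContinuousOn P (Metric.ball 0 ρ) := by
    have hfr : ∀ ζ ∈ frontier {ζ : ℂ | 0 ≤ ζ.im}, ζ.im = 0 := fun ζ hζ =>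
      ((frontier_le_subset_eq continuous_const Complex.continuous_im) hζ).symm
    refine ContinuousOn.if (fun ζ hζ => ?_) ?_ ?_
    · have h0 := hfr ζ hζ.2
      rw [Complex.conj_eq_iff_im.2 h0, Complex.conj_eq_iff_im.2 (hr ζ hζ.1 h0)]
    · refine hc.mono fun ζ hζ => ⟨hζ.1, ?_⟩
      have := hζ.2
      rwa [(isClosed_le continuous_const Complex.continuous_im).closure_eq] at this
    · refine Complex.continuous_conj.comp_continuousOn
        (hc.comp Complex.continuous_conj.continuousOn fun ζ hζ => ⟨hconj ζ hζ.1, ?_⟩)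
      have h1 := hζ.2
      simp only [not_le] at h1
      have h2 : ζ.im ≤ 0 := closure_lt_subset_le Complex.continuous_im continuous_const h1
      simpa using h2
  refine ⟨P, differentiableOn_ball_of_im_ne_zero hPc fun ζ hζ him => ?_, fun ζ h => if_pos h⟩
  have hUo : IsOpen (Metric.ball (0 : ℂ) ρ ∩ {ζ | 0 < ζ.im}) :=
    Metric.isOpen_ball.inter (isOpen_lt continuous_const Complex.continuous_im)
  rcases him.lt_or_gt with h | h
  · have h1 : DifferentiableAt ℂ p (conj ζ) :=
      hd.differentiableAt (hUo.mem_nhds ⟨hconj ζ hζ, by simpa using h⟩)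
    have h2 := h1.conj_conj
    rw [Complex.conj_conj] at h2
    refine h2.congr_of_eventuallyEq ?_
    filter_upwards [(isOpen_lt Complex.continuous_im continuous_const).mem_nhds h] with u hu
    exact if_neg (not_le.2 hu)
  · refine (hd.differentiableAt (hUo.mem_nhds ⟨hζ, h⟩)).congr_of_eventuallyEq ?_
    filter_upwards [(isOpen_lt continuous_const Complex.continuous_im).mem_nhds h] with u hu
    exact if_pos (le_of_lt (a := (0 : ℝ)) hu)

/-- A holomorphic function vanishes only to finite order, unless it vanishes identically. -/
theorem AnalyticAt.exists_pow_le_norm {P : ℂ → ℂ} {z : ℂ} (hP : AnalyticAt ℂ P z)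
    (h : ¬ ∀ᶠ ζ in 𝓝 z, P ζ = 0) :
    ∃ m : ℕ, ∃ c > 0, ∀ᶠ ζ in 𝓝 z, c * ‖ζ - z‖ ^ m ≤ ‖P ζ‖ := by
  obtain ⟨m, g, hg, hg0, hev⟩ := hP.exists_eventuallyEq_pow_smul_nonzero_iff.2 h
  refine ⟨m, ‖g z‖ / 2, half_pos (norm_pos_iff.2 hg0), ?_⟩
  have : ∀ᶠ ζ in 𝓝 z, ‖g z‖ / 2 < ‖g ζ‖ :=
    hg.continuousAt.norm.eventually_const_lt (half_lt_self (norm_pos_iff.2 hg0))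
  filter_upwards [hev, this] with ζ h1 h2
  rw [h1, norm_smul, norm_pow, mul_comm]
  gcongr

/-! ### A maximum principle with one exceptional boundary point -/

/-- A function on a half disc that is bounded on the diameter off the centre, and of moderate
growth at the centre, obeys the same bound near the centre. -/
theorem eventually_norm_le_of_real_le {ρ C b b' : ℝ} {m : ℕ} {G : ℂ → ℂ} (hρ : 0 < ρ)
    (hc : ContinuousOn G (Metric.ball 0 ρ ∩ {ζ | 0 ≤ ζ.im} ∩ {0}ᶜ))
    (hd : DifferentiableOn ℂ G (Metric.ball 0 ρ ∩ {ζ | 0 < ζ.im}))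
    (hC : ∀ ζ ∈ Metric.ball (0 : ℂ) ρ, 0 ≤ ζ.im → ‖ζ‖ ^ m * ‖G ζ‖ ≤ C)
    (hb : ∀ᶠ ζ in 𝓝[{0}ᶜ] (0 : ℂ), ζ.im = 0 → ‖G ζ‖ ≤ b) (hb0 : 0 < b) (hbb' : b < b') :
    ∀ᶠ ζ in 𝓝[{ζ | 0 < ζ.im}] (0 : ℂ), ‖G ζ‖ ≤ b' := by
  obtain ⟨r₀, hr₀, hr₀b⟩ := Metric.mem_nhdsWithin_iff.1 hb
  obtain ⟨b₁, hbb₁, hb₁b'⟩ := exists_between hbb'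
  have hb₁0 : 0 < b₁ := hb0.trans hbb₁
  obtain ⟨R, hR, hRlt⟩ : ∃ R, 0 < R ∧ R < min ρ r₀ := exists_between (lt_min hρ hr₀)
  have hRρ : R < ρ := hRlt.trans_le (min_le_left _ _)
  have hline : ∀ ζ : ℂ, ζ ≠ 0 → ‖ζ‖ ≤ R → ζ.im = 0 → ‖G ζ‖ ≤ b := fun ζ h0 h1 h2 =>
    hr₀b ⟨mem_ball_zero_iff.2 (h1.trans_lt (hRlt.trans_le (min_le_right _ _))), h0⟩ h2
  have hmem : ∀ ζ : ℂ, ζ ≠ 0 → ‖ζ‖ ≤ R → 0 ≤ ζ.im →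
      ζ ∈ Metric.ball (0 : ℂ) ρ ∩ {ζ | 0 ≤ ζ.im} ∩ {0}ᶜ := fun ζ h0 h1 h2 =>
    ⟨⟨mem_ball_zero_iff.2 (h1.trans_lt hRρ), h2⟩, h0⟩
  -- the exponential factor
  obtain ⟨K, hK0, hK⟩ : ∃ K : ℝ, 0 ≤ K ∧ ∀ ζ : ℂ, ‖ζ‖ = R → 0 ≤ ζ.im →
      ‖G ζ‖ * Real.exp (-(K * ζ.im)) ≤ b₁ := by
    set arc : Set ℂ := Metric.sphere 0 R ∩ {ζ | 0 ≤ ζ.im} with harc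
    have harcc : IsCompact arc := (isCompact_sphere _ _).inter_right
      (isClosed_le continuous_const Complex.continuous_im)
    have hGarc : ContinuousOn G arc := hc.mono fun ζ hζ => by
      have h1 := mem_sphere_zero_iff_norm.1 hζ.1
      exact hmem ζ (norm_pos_iff.1 (h1 ▸ hR)) h1.le hζ.2
    set bad : Set ℂ := arc ∩ (fun ζ => ‖G ζ‖) ⁻¹' Ici b₁ with hbad
    have hbadc : IsCompact bad := by
      have := hGarc.norm.preimage_isClosed_of_isClosed harcc.isClosed (isClosed_Ici (a := b₁))
      exact harcc.of_isClosed_subset this inter_subset_left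
    obtain ⟨M, hM⟩ := harcc.exists_bound_of_continuousOn hGarc
    -- On the arc the bound `b₁` fails only on a compact set that avoids the diameter, because `‖G‖
    -- ≤ b < b₁` there. So a factor `exp (i K ζ)` with large `K` repairs it.
    obtain ⟨c, hc0, hcim⟩ : ∃ c : ℝ, 0 < c ∧ ∀ ζ ∈ bad, c ≤ ζ.im := by
      rcases bad.eq_empty_or_nonempty with he | hne
      · exact ⟨1, one_pos, by simp [he]⟩
      · obtain ⟨ζ, hζ, hmin⟩ := hbadc.exists_isMinOn hne Complex.continuous_im.continuousOn
        refine ⟨ζ.im, ?_, fun u hu => hmin hu⟩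
        have h1 := mem_sphere_zero_iff_norm.1 hζ.1.1
        refine lt_of_le_of_ne hζ.1.2 fun h0 => ?_
        have h2 := hline ζ (norm_pos_iff.1 (h1 ▸ hR)) h1.le h0.symm
        have h3 : b₁ ≤ ‖G ζ‖ := hζ.2
        linarith
    have hlim : Tendsto (fun K : ℝ => M * Real.exp (-(K * c))) atTop (𝓝 (M * 0)) := by
      refine Tendsto.const_mul M (Real.tendsto_exp_atBot.comp ?_)
      exact tendsto_neg_atTop_atBot.comp (tendsto_id.atTop_mul_const hc0)
    rw [mul_zero] at hlim
    obtain ⟨K, hK0, hK⟩ := ((eventually_ge_atTop 0).and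
      (hlim.eventually_le_const hb₁0)).exists
    refine ⟨K, hK0, fun ζ h1 h2 => ?_⟩
    have harcζ : ζ ∈ arc := ⟨mem_sphere_zero_iff_norm.2 h1, h2⟩
    by_cases hζ : b₁ ≤ ‖G ζ‖
    · have h3 := hcim ζ ⟨harcζ, hζ⟩
      refine le_trans ?_ hK
      have := hM ζ harcζ
      gcongr
      exact (norm_nonneg _).trans this
    · push Not at hζ
      have : Real.exp (-(K * ζ.im)) ≤ 1 := Real.exp_le_one_iff.2 (by
        have := mul_nonneg hK0 h2; linarith)
      calc _ ≤ ‖G ζ‖ * 1 := by gcongr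
        _ ≤ b₁ := by linarith
  set U : Set ℂ := Metric.ball 0 R ∩ {ζ | 0 < ζ.im} with hU
  have hUo : IsOpen U := Metric.isOpen_ball.inter (isOpen_lt continuous_const Complex.continuous_im)
  have hUcl : closure U ⊆ {ζ | ‖ζ‖ ≤ R} ∩ {ζ | 0 ≤ ζ.im} := by
    refine closure_minimal (fun ζ hζ => ⟨(mem_ball_zero_iff.1 hζ.1).le,
      le_of_lt (a := (0 : ℝ)) hζ.2⟩) ?_
    exact (isClosed_le continuous_norm continuous_const).inter
      (isClosed_le continuous_const Complex.continuous_im)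
  have hden : ∀ δ : ℝ, 0 < δ → ∀ ζ : ℂ, 0 ≤ ζ.im →
      δ ≤ ‖ζ + δ * Complex.I‖ ∧ ‖ζ‖ ≤ ‖ζ + δ * Complex.I‖ := by
    intro δ hδ ζ hζ
    constructor
    · have := Complex.abs_im_le_norm (ζ + δ * Complex.I)
      simp only [Complex.add_im, Complex.mul_im, Complex.ofReal_re, Complex.I_im, mul_one,
        Complex.ofReal_im, Complex.I_re, mul_zero, add_zero] at this
      linarith [le_abs_self (ζ.im + δ)]
    · refine (sq_le_sq₀ (norm_nonneg _) (norm_nonneg _)).1 ?_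
      rw [← Complex.normSq_eq_norm_sq, ← Complex.normSq_eq_norm_sq, Complex.normSq_apply,
        Complex.normSq_apply]
      simp
      nlinarith
  have hexp : ∀ ζ : ℂ, ‖Complex.exp (Complex.I * K * ζ)‖ = Real.exp (-(K * ζ.im)) := by
    intro ζ
    rw [Complex.norm_exp]
    simp
  -- The extra factor has modulus at most `1` on the closed half disc, vanishes at `0` to an order
  -- that beats the growth of `G`, and tends to `1` off the centre as `δ` tends to `0`.
  have hmain : ∀ δ : ℝ, 0 < δ → ∀ ζ ∈ U,
      ‖G ζ * Complex.exp (Complex.I * K * ζ) * (ζ / (ζ + δ * Complex.I)) ^ (m + 1)‖ ≤ b₁ := by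
    intro δ hδ ζ₀ hζ₀
    set h : ℂ → ℂ := fun ζ =>
      G ζ * Complex.exp (Complex.I * K * ζ) * (ζ / (ζ + δ * Complex.I)) ^ (m + 1) with hh
    have hne : ∀ ζ : ℂ, 0 ≤ ζ.im → ζ + δ * Complex.I ≠ 0 := fun ζ hζ =>
      norm_pos_iff.1 (hδ.trans_le (hden δ hδ ζ hζ).1)
    have hle1 : ∀ ζ : ℂ, 0 ≤ ζ.im → ‖(ζ / (ζ + δ * Complex.I)) ^ (m + 1)‖ ≤ 1 := by
      intro ζ hζ
      rw [norm_pow, norm_div]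
      exact pow_le_one₀ (by positivity) (div_le_one_of_le₀ (hden δ hδ ζ hζ).2 (norm_nonneg _))
    have hbd : ∀ ζ : ℂ, ‖ζ‖ ≤ R → 0 ≤ ζ.im → ‖h ζ‖ ≤ C / δ ^ (m + 1) * ‖ζ‖ := by
      intro ζ h1 h2
      have e1 : Real.exp (-(K * ζ.im)) ≤ 1 := Real.exp_le_one_iff.2 (by
        have := mul_nonneg hK0 h2; linarith)
      have e2 := hC ζ (mem_ball_zero_iff.2 (h1.trans_lt hRρ)) h2
      have e3 : δ ^ (m + 1) ≤ ‖ζ + δ * Complex.I‖ ^ (m + 1) :=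
        pow_le_pow_left₀ hδ.le (hden δ hδ ζ h2).1 _
      have hC0 : 0 ≤ C := le_trans (by positivity) e2
      simp only [hh, norm_mul, hexp, norm_pow, norm_div, div_pow]
      calc _ ≤ ‖G ζ‖ * 1 * (‖ζ‖ ^ (m + 1) / δ ^ (m + 1)) := by gcongr
        _ = (‖ζ‖ ^ m * ‖G ζ‖) / δ ^ (m + 1) * ‖ζ‖ := by ring
        _ ≤ _ := by gcongr
    have hcont : ContinuousOn h (closure U) := by
      intro ζ hζ
      obtain ⟨h1, h2⟩ := hUcl hζ
      by_cases h0 : ζ = 0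
      · subst h0
        have hz : h 0 = 0 := by simp [hh]
        have : Tendsto h (𝓝[closure U] 0) (𝓝 0) := by
          refine squeeze_zero_norm' (a := fun ζ => C / δ ^ (m + 1) * ‖ζ‖) ?_ ?_
          · filter_upwards [self_mem_nhdsWithin] with u hu
            exact hbd u (hUcl hu).1 (hUcl hu).2
          · have hcn : Continuous fun ζ : ℂ => C / δ ^ (m + 1) * ‖ζ‖ := by fun_prop
            have := hcn.tendsto 0
            simp only [norm_zero, mul_zero] at this
            exact this.mono_left nhdsWithin_le_nhds
        rw [ContinuousWithinAt, hz]
        exact this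
      · have hG : ContinuousWithinAt G (closure U) ζ := by
          refine (hc ζ (hmem ζ h0 h1 h2)).mono_of_mem_nhdsWithin ?_
          filter_upwards [self_mem_nhdsWithin,
            nhdsWithin_le_nhds (isOpen_ne.mem_nhds h0)] with u hu hu0
          exact hmem u hu0 (hUcl hu).1 (hUcl hu).2
        refine (hG.mul (by fun_prop)).mul (ContinuousWithinAt.pow ?_ _)
        exact continuousWithinAt_id.div (by fun_prop) (hne ζ h2)
    have hdiff : DifferentiableOn ℂ h U := by
      refine ((hd.mono fun u hu => ⟨Metric.ball_subset_ball hRρ.le hu.1, hu.2⟩).mul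
        (by fun_prop)).mul (DifferentiableOn.pow ?_ _)
      exact differentiableOn_id.div (by fun_prop)
        fun u hu => hne u (le_of_lt (a := (0 : ℝ)) hu.2)
    refine Complex.norm_le_of_forall_mem_frontier_norm_le
      (Metric.isBounded_ball.subset inter_subset_left) ⟨hdiff, hcont⟩ (fun ζ hζ => ?_)
      (subset_closure hζ₀)
    obtain ⟨h1, h2⟩ := hUcl hζ.1
    have h1' : ‖ζ‖ ≤ R := h1
    have h2' : 0 ≤ ζ.im := h2
    rw [← hU, hUo.frontier_eq] at hζ
    by_cases h0 : ζ = 0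
    · subst h0
      simp only [hh]
      simp [hb₁0.le]
    · have hGb : ‖G ζ‖ * Real.exp (-(K * ζ.im)) ≤ b₁ := by
        rcases h1'.lt_or_eq with hlt | heq
        · have him : ζ.im = 0 := by
            by_contra hne
            exact hζ.2 ⟨mem_ball_zero_iff.2 hlt, h2'.lt_of_ne (Ne.symm hne)⟩
          rw [him, mul_zero, neg_zero, Real.exp_zero, mul_one]
          exact (hline ζ h0 h1' him).trans hbb₁.le
        · exact hK ζ heq h2'
      simp only [hh]
      rw [norm_mul, norm_mul, hexp]
      calc _ ≤ b₁ * 1 := by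
            gcongr
            exact hle1 ζ h2'
        _ = b₁ := mul_one _
  have hlimit : ∀ ζ ∈ U, ‖G ζ‖ * Real.exp (-(K * ζ.im)) ≤ b₁ := by
    intro ζ hζ
    have hζ0 : ζ ≠ 0 := by
      rintro rfl
      exact lt_irrefl (0 : ℝ) hζ.2
    have h1 : Tendsto (fun δ : ℝ => ‖G ζ * Complex.exp (Complex.I * K * ζ) *
        (ζ / (ζ + δ * Complex.I)) ^ (m + 1)‖) (𝓝[>] 0)
        (𝓝 ‖G ζ * Complex.exp (Complex.I * K * ζ) *
        (ζ / (ζ + (0 : ℝ) * Complex.I)) ^ (m + 1)‖) := by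
      have : ContinuousAt (fun δ : ℝ => ‖G ζ * Complex.exp (Complex.I * K * ζ) *
        (ζ / (ζ + δ * Complex.I)) ^ (m + 1)‖) 0 := by
        refine (continuousAt_const.mul (ContinuousAt.pow ?_ _)).norm
        refine continuousAt_const.div (by fun_prop) ?_
        simpa using hζ0
      exact this.tendsto.mono_left nhdsWithin_le_nhds
    have h2 := le_of_tendsto h1 (by
      filter_upwards [self_mem_nhdsWithin] with δ hδ using hmain δ hδ ζ hζ)
    simpa [hζ0, hexp] using h2
  -- Since `K` is fixed, undoing the exponential near the centre costs an arbitrarily small amount,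
  -- absorbed by `b₁ < b'`.
  have hev : ∀ᶠ ζ : ℂ in 𝓝 0, b₁ * Real.exp (K * ζ.im) < b' := by
    have hcn : Continuous fun ζ : ℂ => b₁ * Real.exp (K * ζ.im) := by fun_prop
    have := hcn.tendsto 0
    simp only [Complex.zero_im, mul_zero, Real.exp_zero, mul_one] at this
    exact this.eventually_lt_const hb₁b'
  filter_upwards [self_mem_nhdsWithin, nhdsWithin_le_nhds (Metric.ball_mem_nhds (0 : ℂ) hR),
    nhdsWithin_le_nhds hev] with ζ h1 h2 h3
  have h4 := hlimit ζ ⟨h2, h1⟩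
  rw [Real.exp_neg, ← div_eq_mul_inv, div_le_iff₀ (Real.exp_pos _)] at h4
  exact h4.trans h3.le

/-! ### Quotients of two functions with real product on the diameter -/

/-- If a product of two functions on a half disc becomes real on the diameter after multiplication
by a nonvanishing function, then the functions compare near the centre as they do on the
diameter. -/
theorem eventually_ne_zero_and_norm_le_of_real {ρ b b' : ℝ} {U V D : ℂ → ℂ} (hρ : 0 < ρ)
    (hUc : ContinuousOn U (Metric.ball 0 ρ ∩ {ζ | 0 ≤ ζ.im}))
    (hVc : ContinuousOn V (Metric.ball 0 ρ ∩ {ζ | 0 ≤ ζ.im}))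
    (hDc : ContinuousOn D (Metric.ball 0 ρ ∩ {ζ | 0 ≤ ζ.im}))
    (hUd : DifferentiableOn ℂ U (Metric.ball 0 ρ ∩ {ζ | 0 < ζ.im}))
    (hVd : DifferentiableOn ℂ V (Metric.ball 0 ρ ∩ {ζ | 0 < ζ.im}))
    (hDd : DifferentiableOn ℂ D (Metric.ball 0 ρ ∩ {ζ | 0 < ζ.im}))
    (hD0 : ∀ ζ ∈ Metric.ball (0 : ℂ) ρ, 0 ≤ ζ.im → D ζ ≠ 0)
    (hr : ∀ ζ ∈ Metric.ball (0 : ℂ) ρ, ζ.im = 0 → (U ζ * V ζ * D ζ).im = 0)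
    (h0 : ¬ ∀ᶠ ζ in 𝓝[{ζ | 0 < ζ.im}] (0 : ℂ), U ζ * V ζ = 0)
    (hb : ∀ᶠ ζ in 𝓝 (0 : ℂ), ζ.im = 0 → ‖U ζ‖ ≤ b * ‖V ζ‖) (hb0 : 0 < b) (hbb' : b < b') :
    ∀ᶠ ζ in 𝓝[{ζ | 0 < ζ.im}] (0 : ℂ), U ζ ≠ 0 ∧ V ζ ≠ 0 ∧ ‖U ζ‖ / ‖V ζ‖ ≤ b' := by
  obtain ⟨P, hPd, hP⟩ := exists_differentiableOn_ball_of_real ((hUc.mul hVc).mul hDc)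
    ((hUd.mul hVd).mul hDd) hr
  simp only [Pi.mul_apply] at hP
  have hPa : AnalyticAt ℂ P 0 := hPd.analyticAt (Metric.ball_mem_nhds _ hρ)
  obtain ⟨m, c, hc, hPm⟩ := hPa.exists_pow_le_norm fun h => h0 (by
    filter_upwards [nhdsWithin_le_nhds h, self_mem_nhdsWithin,
      nhdsWithin_le_nhds (Metric.ball_mem_nhds (0 : ℂ) hρ)] with ζ h1 h2 h3
    have h2' : 0 ≤ ζ.im := le_of_lt (a := (0 : ℝ)) h2
    rw [hP ζ h2'] at h1
    exact (mul_eq_zero.1 h1).resolve_right (hD0 ζ h3 h2'))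
  have hmem0 : (0 : ℂ) ∈ Metric.ball (0 : ℂ) ρ ∩ {ζ | 0 ≤ ζ.im} :=
    ⟨Metric.mem_ball_self hρ, by simp⟩
  have hbdd : ∀ W : ℂ → ℂ, ContinuousOn W (Metric.ball 0 ρ ∩ {ζ | 0 ≤ ζ.im}) →
      ∀ᶠ ζ in 𝓝 (0 : ℂ), ζ ∈ Metric.ball (0 : ℂ) ρ → 0 ≤ ζ.im → ‖W ζ‖ ≤ ‖W 0‖ + 1 := by
    intro W hW
    have := (hW 0 hmem0).norm.eventually_lt_const (lt_add_one ‖W 0‖)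
    filter_upwards [eventually_nhdsWithin_iff.1 this] with ζ h1 h2 h3
    exact (h1 ⟨h2, h3⟩).le
  obtain ⟨r, hr0, hrsub⟩ := Metric.eventually_nhds_iff_ball.1
    (((hbdd U hUc).and (hbdd D hDc)).and (hPm.and hb))
  have hrr : 0 < min r ρ := lt_min hr0 hρ
  have hsub : Metric.ball (0 : ℂ) (min r ρ) ⊆ Metric.ball 0 ρ :=
    Metric.ball_subset_ball (min_le_right _ _)
  -- The reflected product vanishes only to finite order, which bounds `U V D` from below by a power
  -- of the distance to the centre.
  have hlow : ∀ ζ ∈ Metric.ball (0 : ℂ) (min r ρ), 0 ≤ ζ.im →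
      c * ‖ζ‖ ^ m ≤ ‖U ζ‖ * ‖V ζ‖ * ‖D ζ‖ := by
    intro ζ hζ h
    have h1 := (hrsub ζ (Metric.ball_subset_ball (min_le_left _ _) hζ)).2.1
    rwa [sub_zero, hP ζ h, norm_mul, norm_mul] at h1
  have hne : ∀ ζ ∈ Metric.ball (0 : ℂ) (min r ρ), 0 ≤ ζ.im → ζ ≠ 0 → U ζ ≠ 0 ∧ V ζ ≠ 0 := by
    intro ζ hζ h hζ0
    have h1 := hlow ζ hζ h
    have h2 : 0 < c * ‖ζ‖ ^ m := by have := norm_pos_iff.2 hζ0; positivity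
    constructor
    · intro h3
      rw [h3] at h1
      simp only [norm_zero, zero_mul] at h1
      linarith
    · intro h3
      rw [h3] at h1
      simp only [norm_zero, zero_mul, mul_zero] at h1
      linarith
  -- The constant comes from `‖U / V‖ = ‖U‖² ‖D‖ / ‖U V D‖`, with the numerator bounded near the
  -- centre and the denominator at least `c ‖ζ‖ ^ m`.
  have key := eventually_norm_le_of_real_le (G := fun ζ => U ζ / V ζ) (m := m) (b := b) (b' := b')
    (C := (‖U 0‖ + 1) ^ 2 * (‖D 0‖ + 1) / c) hrr ?_ ?_ ?_ ?_ hb0 hbb'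
  · filter_upwards [key, self_mem_nhdsWithin,
      nhdsWithin_le_nhds (Metric.ball_mem_nhds (0 : ℂ) hrr)] with ζ h1 h2 h3
    have h2' : 0 < ζ.im := h2
    obtain ⟨h4, h5⟩ := hne ζ h3 h2'.le (by rintro rfl; simp at h2')
    exact ⟨h4, h5, by rwa [norm_div] at h1⟩
  · refine ContinuousOn.div (hUc.mono fun ζ hζ => ⟨hsub hζ.1.1, hζ.1.2⟩)
      (hVc.mono fun ζ hζ => ⟨hsub hζ.1.1, hζ.1.2⟩) fun ζ hζ => (hne ζ hζ.1.1 hζ.1.2 hζ.2).2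
  · refine DifferentiableOn.div (hUd.mono fun ζ hζ => ⟨hsub hζ.1, hζ.2⟩)
      (hVd.mono fun ζ hζ => ⟨hsub hζ.1, hζ.2⟩) fun ζ hζ => ?_
    have h2' : 0 < ζ.im := hζ.2
    exact (hne ζ hζ.1 h2'.le (by rintro rfl; simp at h2')).2
  · intro ζ hζ h
    obtain ⟨⟨h1, h2⟩, -⟩ := hrsub ζ (Metric.ball_subset_ball (min_le_left _ _) hζ)
    have hU := h1 (hsub hζ) h
    have hD := h2 (hsub hζ) h
    rw [norm_div]
    by_cases hV : V ζ = 0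
    · rw [hV, norm_zero, div_zero, mul_zero]
      positivity
    · have hV' := norm_pos_iff.2 hV
      rw [le_div_iff₀ hc]
      calc ‖ζ‖ ^ m * (‖U ζ‖ / ‖V ζ‖) * c = c * ‖ζ‖ ^ m * (‖U ζ‖ / ‖V ζ‖) := by ring
        _ ≤ ‖U ζ‖ * ‖V ζ‖ * ‖D ζ‖ * (‖U ζ‖ / ‖V ζ‖) :=
          mul_le_mul_of_nonneg_right (hlow ζ hζ h) (by positivity)
        _ = ‖U ζ‖ ^ 2 * ‖D ζ‖ := by field_simp
        _ ≤ _ := by gcongr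
  · filter_upwards [self_mem_nhdsWithin, nhdsWithin_le_nhds (Metric.ball_mem_nhds (0 : ℂ) hrr)]
      with ζ h1 h2 h3
    have h4 := (hrsub ζ (Metric.ball_subset_ball (min_le_left _ _) h2)).2.2 h3
    rw [norm_div, div_le_iff₀ (norm_pos_iff.2 (hne ζ h2 h3.ge h1).2)]
    exact h4

/-- The quotient of the two functions has on the half disc the limit of its modulus on the
diameter. -/
theorem tendsto_norm_div_of_real {ρ l : ℝ} {U V D : ℂ → ℂ} {w : ℂ → ℝ} (hρ : 0 < ρ)
    (hUc : ContinuousOn U (Metric.ball 0 ρ ∩ {ζ | 0 ≤ ζ.im}))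
    (hVc : ContinuousOn V (Metric.ball 0 ρ ∩ {ζ | 0 ≤ ζ.im}))
    (hDc : ContinuousOn D (Metric.ball 0 ρ ∩ {ζ | 0 ≤ ζ.im}))
    (hUd : DifferentiableOn ℂ U (Metric.ball 0 ρ ∩ {ζ | 0 < ζ.im}))
    (hVd : DifferentiableOn ℂ V (Metric.ball 0 ρ ∩ {ζ | 0 < ζ.im}))
    (hDd : DifferentiableOn ℂ D (Metric.ball 0 ρ ∩ {ζ | 0 < ζ.im}))
    (hD0 : ∀ ζ ∈ Metric.ball (0 : ℂ) ρ, 0 ≤ ζ.im → D ζ ≠ 0)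
    (hr : ∀ ζ ∈ Metric.ball (0 : ℂ) ρ, ζ.im = 0 → (U ζ * V ζ * D ζ).im = 0)
    (h0 : ¬ ∀ᶠ ζ in 𝓝[{ζ | 0 < ζ.im}] (0 : ℂ), U ζ * V ζ = 0)
    (hw : ∀ᶠ ζ in 𝓝 (0 : ℂ), ζ.im = 0 → ‖U ζ‖ = w ζ * ‖V ζ‖) (hl : 0 < l)
    (hwl : Tendsto w (𝓝[{ζ | ζ.im = 0}] 0) (𝓝 l)) :
    Tendsto (fun ζ => ‖U ζ / V ζ‖) (𝓝[{ζ | 0 < ζ.im}] 0) (𝓝 l) := by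
  have upper : ∀ b', l < b' → ∀ᶠ ζ in 𝓝[{ζ | 0 < ζ.im}] (0 : ℂ),
      U ζ ≠ 0 ∧ V ζ ≠ 0 ∧ ‖U ζ‖ / ‖V ζ‖ ≤ b' := by
    intro b' hb'
    obtain ⟨b, hlb, hbb'⟩ := exists_between hb'
    refine eventually_ne_zero_and_norm_le_of_real hρ hUc hVc hDc hUd hVd hDd hD0 hr h0 ?_
      (hl.trans hlb) hbb'
    filter_upwards [hw, eventually_nhdsWithin_iff.1 (hwl.eventually_lt_const hlb)] with ζ h1 h2 h3
    rw [h1 h3]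
    have := h2 h3
    gcongr
  -- The hypotheses are symmetric in `U` and `V`, so the lower bound is the upper bound for the
  -- inverse quotient.
  have lower : ∀ b', l⁻¹ < b' → ∀ᶠ ζ in 𝓝[{ζ | 0 < ζ.im}] (0 : ℂ),
      V ζ ≠ 0 ∧ U ζ ≠ 0 ∧ ‖V ζ‖ / ‖U ζ‖ ≤ b' := by
    intro b' hb'
    obtain ⟨b, hlb, hbb'⟩ := exists_between hb'
    have hb0 : 0 < b := (inv_pos.2 hl).trans hlb
    refine eventually_ne_zero_and_norm_le_of_real hρ hVc hUc hDc hVd hUd hDd hD0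
      (fun ζ hζ h => by rw [mul_comm (V ζ)]; exact hr ζ hζ h)
      (fun h => h0 (h.mono fun ζ hζ => by rwa [mul_comm])) ?_ hb0 hbb'
    filter_upwards [hw, eventually_nhdsWithin_iff.1
      (hwl.eventually_const_lt (inv_lt_of_inv_lt₀ hl hlb))] with ζ h1 h2 h3
    rw [h1 h3, ← mul_assoc]
    have h4 : 1 ≤ b * w ζ := by
      have := mul_le_mul_of_nonneg_left (h2 h3).le hb0.le
      rwa [mul_inv_cancel₀ hb0.ne'] at this
    exact le_mul_of_one_le_left (norm_nonneg _) h4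
  refine tendsto_order.2 ⟨fun a ha => ?_, fun a ha => ?_⟩
  · by_cases ha0 : 0 < a
    · obtain ⟨b, hlb, hba⟩ := exists_between ((inv_lt_inv₀ hl ha0).2 ha)
      filter_upwards [lower b hlb] with ζ ⟨h1, h2, h3⟩
      have h1' := norm_pos_iff.2 h1
      have h2' := norm_pos_iff.2 h2
      rw [norm_div, lt_div_iff₀ h1']
      have h4 := (div_lt_iff₀ h2').1 (h3.trans_lt hba)
      rwa [inv_mul_eq_div, lt_div_iff₀ ha0, mul_comm] at h4
    · filter_upwards [upper (l + 1) (lt_add_one l)] with ζ ⟨h1, h2, _⟩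
      exact (not_lt.1 ha0).trans_lt (norm_pos_iff.2 (div_ne_zero h1 h2))
  · obtain ⟨b, hlb, hba⟩ := exists_between ha
    filter_upwards [upper b hlb] with ζ ⟨_, _, h3⟩
    rw [norm_div]
    exact h3.trans_lt hba

/-! ### The boundary modulus of the weighted Ahlfors map -/

theorem mainTheorem5 {Ω : Set ℂ} {n : ℕ} (hopen : IsOpen Ω) (hconn : IsConnected Ω)
    (hbdd : Bornology.IsBounded Ω) (Γ : SmoothBoundary Ω n) (φ : ℂ → ℝ) (hφ : Γ.IsWeight φ)
    (a : ℂ) (ha : a ∈ Ω) :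
    ∀ z₀ ∈ frontier Ω,
      Tendsto (fun z => ‖Γ.ahlfors φ a z‖) (𝓝[Ω] z₀) (𝓝 (1 / φ z₀)) := by
  intro z₀ hz₀
  obtain ⟨S, H, hSc, hSd, hHc, hHd, hS, hL, hSa, hSL⟩ := hφ.exists_kernels hopen hconn hbdd ha
  obtain ⟨k, D, ρ₀, hρ₀, hkc, hDc, hkd, hDd, hk0, hkΩ, hD0, hkr, hknhds⟩ :=
    SmoothBoundary.exists_uniformizer (Γ := Γ) hopen hz₀
  have hfa : ∀ z ∈ frontier Ω, z ≠ a := fun z hz h =>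
    (disjoint_frontier_iff_isOpen.2 hopen).le_bot ⟨h ▸ hz, ha⟩
  set L : ℂ → ℂ := fun z => 1 / (2 * Real.pi) * (1 / (z - a)) - Complex.I * H z with hLdef
  have hLc : ContinuousOn L (closure Ω \ {a}) := by
    refine (continuousOn_const.mul (continuousOn_const.div (by fun_prop) fun z hz =>
      sub_ne_zero.2 hz.2)).sub (continuousOn_const.mul (hHc.mono sdiff_subset))
  have hLd : DifferentiableOn ℂ L (Ω \ {a}) := by
    refine ((differentiableOn_const _).mul ((differentiableOn_const _).div (by fun_prop)
      fun z hz => sub_ne_zero.2 hz.2)).sub ((differentiableOn_const _).mul (hHd.mono sdiff_subset))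
  obtain ⟨ρ, hρ, hρρ₀, hka⟩ : ∃ ρ > 0, ρ ≤ ρ₀ ∧
      ∀ ζ ∈ Metric.ball (0 : ℂ) ρ, 0 ≤ ζ.im → k ζ ≠ a := by
    have h1 := (hkc 0 ⟨Metric.mem_ball_self hρ₀, by simp⟩).eventually_ne (hk0 ▸ hfa z₀ hz₀)
    obtain ⟨r, hr, h2⟩ := Metric.mem_nhdsWithin_iff.1 h1
    exact ⟨min r ρ₀, lt_min hr hρ₀, min_le_right _ _, fun ζ hζ h =>
      h2 ⟨Metric.ball_subset_ball (min_le_left _ _) hζ,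
        Metric.ball_subset_ball (min_le_right _ _) hζ, h⟩⟩
  have hsub : Metric.ball (0 : ℂ) ρ ⊆ Metric.ball 0 ρ₀ := Metric.ball_subset_ball hρρ₀
  have hle : ∀ ζ : ℂ, ζ ∈ {ζ : ℂ | 0 < ζ.im} → 0 ≤ ζ.im := fun ζ h => le_of_lt (a := (0 : ℝ)) h
  have hkcl : ∀ ζ ∈ Metric.ball (0 : ℂ) ρ, 0 ≤ ζ.im → k ζ ∈ closure Ω \ {a} := by
    intro ζ hζ h
    refine ⟨?_, hka ζ hζ h⟩
    rcases h.lt_or_eq with h' | h'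
    · exact subset_closure (hkΩ ζ (hsub hζ) h')
    · exact frontier_subset_closure (hkr ζ (hsub hζ) h'.symm).1
  have hkc' : ContinuousOn k (Metric.ball 0 ρ ∩ {ζ | 0 ≤ ζ.im}) :=
    hkc.mono fun ζ hζ => ⟨hsub hζ.1, hζ.2⟩
  have hkd' : DifferentiableOn ℂ k (Metric.ball 0 ρ ∩ {ζ | 0 < ζ.im}) :=
    hkd.mono fun ζ hζ => ⟨hsub hζ.1, hζ.2⟩
  have hnorm : ∀ z ∈ frontier Ω, φ z * ‖S z‖ = ‖L z‖ := by
    intro z hz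
    have := congrArg norm ((hSL z hz).trans (congrArg _ (show _ = L z from rfl)))
    simpa [Γ.norm_tangent hz, abs_of_pos (hφ.pos z hz)] using this
  -- Multiplying by `z - a` removes the pole of `L` and leaves a function holomorphic on `Ω` with
  -- value `S(a) / (2 π) ≠ 0` at `a`. By the identity theorem it cannot vanish on an open subset of
  -- `Ω`, hence `S L` cannot vanish throughout a one-sided neighbourhood of `z₀`.
  have hnz : ¬ ∀ᶠ z in 𝓝[Ω] z₀, S z * L z = 0 := by
    intro hzero
    have hg : AnalyticOnNhd ℂ (fun z => S z * (1 / (2 * Real.pi) - Complex.I * (z - a) * H z)) Ω := by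
      refine DifferentiableOn.analyticOnNhd (hSd.mul ((differentiableOn_const _).sub
        (DifferentiableOn.mul (by fun_prop) hHd))) hopen
    obtain ⟨W, hW, hWz₀, hWsub⟩ := mem_nhdsWithin.1 hzero
    obtain ⟨b, hbW, hbΩ⟩ : (W ∩ Ω).Nonempty :=
      mem_closure_iff.1 (frontier_subset_closure hz₀) W hW hWz₀
    have hgb : (fun z => S z * (1 / (2 * Real.pi) - Complex.I * (z - a) * H z)) =ᶠ[𝓝[≠] b] 0 := by
      have h1 : ∀ᶠ z in 𝓝[≠] b, z ≠ a := by
        by_cases hba : b = a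
        · subst hba; exact self_mem_nhdsWithin
        · exact nhdsWithin_le_nhds (isOpen_ne.mem_nhds hba)
      filter_upwards [nhdsWithin_le_nhds ((hW.inter hopen).mem_nhds ⟨hbW, hbΩ⟩), h1] with z hz hza
      have h2 : S z * L z = 0 := hWsub hz
      have h3 : z - a ≠ 0 := sub_ne_zero.2 hza
      have h4 : 1 / (2 * Real.pi) - Complex.I * (z - a) * H z = (z - a) * L z := by
        simp only [hLdef]
        field_simp
      simp only [h4, Pi.zero_apply]
      linear_combination (z - a) * h2
    have h5 := hg.eqOn_zero_of_preconnected_of_frequently_eq_zero hconn.isPreconnected hbΩ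
      hgb.frequently ha
    simp [hSa] at h5
  -- The factor `i` makes the product with `L` and `D` equal to `-r φ |S|²` on the diameter, with
  -- `r` the positive ratio of `D` to the tangent; it does not affect the modulus of the quotient.
  have key := tendsto_norm_div_of_real (U := fun ζ => Complex.I * S (k ζ))
    (V := fun ζ => L (k ζ)) (D := D) (w := fun ζ => (φ (k ζ))⁻¹) (l := (φ z₀)⁻¹) hρ
    (continuousOn_const.mul (hSc.comp hkc' fun ζ hζ => (hkcl ζ hζ.1 hζ.2).1))
    (hLc.comp hkc' fun ζ hζ => hkcl ζ hζ.1 hζ.2)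
    (hDc.mono fun ζ hζ => ⟨hsub hζ.1, hζ.2⟩)
    ((differentiableOn_const _).mul (hSd.comp hkd' fun ζ hζ => hkΩ ζ (hsub hζ.1) hζ.2))
    (hLd.comp hkd' fun ζ hζ => ⟨hkΩ ζ (hsub hζ.1) hζ.2, hka ζ hζ.1 (hle ζ hζ.2)⟩)
    (hDd.mono fun ζ hζ => ⟨hsub hζ.1, hζ.2⟩)
    (fun ζ hζ h => hD0 ζ (hsub hζ) h) ?_ ?_ ?_ (inv_pos.2 (hφ.pos z₀ hz₀)) ?_
  · have hF : Tendsto (fun z => ‖Γ.ahlfors φ a z‖) (map k (𝓝[{ζ | 0 < ζ.im}] 0))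
        (𝓝 (1 / φ z₀)) := by
      rw [one_div]
      refine tendsto_map'_iff.2 (Tendsto.congr' ?_ key)
      filter_upwards [self_mem_nhdsWithin,
        nhdsWithin_le_nhds (Metric.ball_mem_nhds (0 : ℂ) hρ)] with ζ h1 h2
      have h3 : k ζ ∈ Ω := hkΩ ζ (hsub h2) h1
      rw [Function.comp_apply, SmoothBoundary.ahlfors, if_neg (hka ζ h2 (hle ζ h1)),
        hS _ h3, hL _ h3, norm_div, norm_div, norm_mul, Complex.norm_I, one_mul]
    exact hF.mono_left hknhds
  · intro ζ hζ h
    obtain ⟨hfr, r, -, hr⟩ := hkr ζ (hsub hζ) h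
    have h1 := hSL _ hfr
    have h2 : Complex.I * S (k ζ) * L (k ζ) * D ζ =
        ((-(r * φ (k ζ) * Complex.normSq (S (k ζ))) : ℝ) : ℂ) := by
      rw [hr]
      push_cast
      rw [← Complex.mul_conj]
      linear_combination (r * S (k ζ)) * h1
    rw [h2, Complex.ofReal_im]
  · intro h
    refine hnz (hknhds (h.mono fun ζ hζ => ?_))
    simpa [mul_assoc] using hζ
  · filter_upwards [Metric.ball_mem_nhds (0 : ℂ) hρ] with ζ hζ h
    have hfr := (hkr ζ (hsub hζ) h).1
    rw [norm_mul, Complex.norm_I, one_mul, ← hnorm _ hfr,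
      inv_mul_cancel_left₀ (hφ.pos _ hfr).ne']
  · refine Tendsto.inv₀ ?_ (hφ.pos z₀ hz₀).ne'
    have h1 : Tendsto k (𝓝[{ζ | ζ.im = 0}] 0) (𝓝[frontier Ω] z₀) := by
      refine tendsto_nhdsWithin_iff.2 ⟨?_, ?_⟩
      · have h2 := hkc' 0 ⟨Metric.mem_ball_self hρ, by simp⟩
        rw [ContinuousWithinAt, hk0] at h2
        refine h2.mono_left (le_inf nhdsWithin_le_nhds (le_principal_iff.2 ?_))
        filter_upwards [self_mem_nhdsWithin,
          nhdsWithin_le_nhds (Metric.ball_mem_nhds (0 : ℂ) hρ)] with ζ h3 h4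
        exact ⟨h4, ge_of_eq (a := ζ.im) (b := 0) h3⟩
      · filter_upwards [self_mem_nhdsWithin,
          nhdsWithin_le_nhds (Metric.ball_mem_nhds (0 : ℂ) hρ)] with ζ h3 h4
        exact (hkr ζ (hsub h4) h3).1
    exact (hφ.continuousOn z₀ hz₀).tendsto.comp h1
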